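/- **Model.** For every $n\in\mathbb N$ consider an instance of the group matrix network autoregression (GMNAR) model with sizes $N_1,N_2,T\ge 1$, $p_1,p_2,G_0,H_0$ (all may depend on $n$; we suppress $n$): nonnegative adjacency matrices $A_1\in\mathbb R^{N_1\times N_1}$, $A_2\in\mathbb R^{N_2\times N_2}$ with zero diagonal, their normalizations $w_{1ik}=a_{1ik}/\sum_l a_{1il}$ and $w_{2kj}=a_{2kj}/\sum_l a_{2lj}$, true memberships $g_i^0\in[G_0]$, $h_j^0\in[H_0]$, true parameters $\lambda^0_g,\gamma^0_h,\alpha^0_{gh}\in\mathbb R$, $\zeta^0_g\in\mathbb R^{p_1}$, $\delta^0_h\in\mathbb R^{p_2}$, and random $Y_t\in\mathbb R^{N_1\times N_2}$, $x_{it}\in\mathbb R^{p_1}$, $z_{jt}\in\mathbb R^{p_2}$ ($0\le t\le T$), $\varepsilon_{ijt}\in\mathbb R$ with, almost surely for $1\le t\le T$, $$Y_{ijt}=\lambda^0_{g^0_i}\sum_k w_{1ik}Y_{kj(t-1)}+\gamma^0_{h^0_j}\sum_k Y_{ik(t-1)}w_{2kj}+\alpha^0_{g^0_ih^0_j}Y_{ij(t-1)}+x_{it}^\top\zeta^0_{g^0_i}+z_{jt}^\top\delta^0_{h^0_j}+\varepsilon_{ijt}.$$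 Put $m=p_1+p_2+3$, $\mathcal X_{ijt}=(\sum_k w_{1ik}Y_{kj(t-1)},x_{it}^\top,\sum_kY_{ik(t-1)}w_{2kj},z_{jt}^\top,Y_{ij(t-1)})^\top\in\mathbb R^m$ and, for group parameters and memberships $(\theta,\mathcal G,\mathcal H)$ with any numbers of groups, $\Theta_{ij}=(\lambda_{g_i},\zeta_{g_i}^\top,\gamma_{h_j},\delta_{h_j}^\top,\alpha_{g_ih_j})^\top\in\mathbb R^m$; $\Theta^0$ is the tensor of the true parameters. **Assumptions.** There are constants $R,\tau,\sigma,K>0$ and $\kappa\in(0,1)$, not depending on $n$, such that: 1. (Parameter space) $\|\Theta^0\|_{\max}<R$. 2. (Convexity) $\mathcal X_{ijt}$ is square integrable, $\Sigma_{ij}=E(\mathcal X_{ijt}\mathcal X_{ijt}^\top)$ does not depend on $t\in[T]$, and $\min_{i,j}\lambda_{\min}(\Sigma_{ij})\ge\tau$. 3. (Noise) The $\varepsilon_{ijt}$, $t\in[T]$, are i.i.d., centered, with $E e^{u\varepsilon_{ijt}}\le e^{\sigma^2u^2/2}$ for all $u\in\mathbb R$; each $\varepsilon_{ijt}$ is independent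 of $(Y_s)_{0\le s\le t-1},(x_{\cdot s},z_{\cdot s})_{0\le s\le t}$; and the covariates are exogenous: the array $(\varepsilon_{ijt})_{i,j,\,t\in[T]}$ is independent of $(x_{\cdot t},z_{\cdot t})_{0\le t\le T}$. 4. (Covariates) $E x_{it}=0$ and $E z_{jt}=0$ for $t\in[T]$, and the vector $V$ of all coordinates of all $x_{it},z_{jt}$, $0\le t\le T$, has the $K$-convex concentration property: for every convex $1$-Lipschitz (Euclidean norm) $\varphi$, $\varphi(V)$ is integrable and $P(|\varphi(V)-E\varphi(V)|\ge s)\le 2e^{-s^2/K^2}$ for all $s>0$. 5. (Stationarity) $\max_{g,h}(|\lambda^0_g|+|\gamma^0_h|+|\alpha^0_{gh}|)\le\kappa$. **Theorem.** Suppose moreover that $m/\sqrt T\to0$, that $G\ge G_0$ and $H\ge H_0$ ($G,H$ may depend on $n$), and that $\widehat\Theta$ is the tensor of any (almost sure) minimizer $(\widehat\theta,\widehat{\mathcal G},\widehat{\mathcal H})$ of the least squares objective $$Q(\Theta)=\sum_{i,j}\sum_{t=1}^T(Y_{ijt}-\mathcal X_{ijt}^\top\Theta_{ij})^2$$ over all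 group parameters and memberships with $G$ row groups and $H$ column groups and $\|\Theta\|_{\max}\le R$. Then the pseudo-distance $d(\widehat\Theta,\Theta^0)=\frac1{N_1N_2}\sum_{i,j}\|\widehat\Theta_{ij}-\Theta^0_{ij}\|^2$ satisfies $$d(\widehat\Theta,\Theta^0)=O_p\big(T^{-1/2}(m+\log(N_1N_2))\big),$$ that is, for every $\delta>0$ there is $M>0$ such that $P\big(d(\widehat\Theta,\Theta^0)>M\,T^{-1/2}(m+\log(N_1N_2))\big)\le\delta$ for all $n$. -/

import Mathlib

open MeasureTheory ProbabilityTheory Filter Topology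
open scoped NNReal ENNReal

noncomputable section

namespace GMNAR

universe u

/-- Coordinates of a node-wise parameter `(λ, ζ, γ, δ, α)`, or of a node-wise regressor
(row network lag, row covariate, column network lag, column covariate, own lag);
there are `p₁ + p₂ + 3` of them. -/
abbrev Coord (p₁ p₂ : ℕ) : Type := (Unit ⊕ Fin p₁) ⊕ (Unit ⊕ Fin p₂) ⊕ Unit

/-- Group-level parameters with `G` row groups and `H` column groups. -/
structure Params (p₁ p₂ G H : ℕ) where
  lam : Fin G → ℝ
  zeta : Fin G → Fin p₁ → ℝ
  gam : Fin H → ℝ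
  delta : Fin H → Fin p₂ → ℝ
  alpha : Fin G → Fin H → ℝ

/-- Group-level parameters together with row and column memberships. -/
structure Grouped (N₁ N₂ p₁ p₂ G H : ℕ) where
  par : Params p₁ p₂ G H
  g : Fin N₁ → Fin G
  h : Fin N₂ → Fin H

/-- The node-wise parameter tensor `Θ = (Θ_ij)`. -/
def Grouped.tensor {N₁ N₂ p₁ p₂ G H : ℕ} (θ : Grouped N₁ N₂ p₁ p₂ G H)
    (i : Fin N₁) (j : Fin N₂) : Coord p₁ p₂ → ℝ :=
  Sum.elim (Sum.elim (fun _ => θ.par.lam (θ.g i)) (θ.par.zeta (θ.g i)))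
    (Sum.elim (Sum.elim (fun _ => θ.par.gam (θ.h j)) (θ.par.delta (θ.h j)))
      (fun _ => θ.par.alpha (θ.g i) (θ.h j)))

/-- Averaged pseudo-distance `(N₁N₂)⁻¹ ∑_{i,j} ‖Θ_ij - Θ'_ij‖²` (Euclidean norm). -/
def pseudoDist {N₁ N₂ p₁ p₂ : ℕ} (Θ Θ' : Fin N₁ → Fin N₂ → Coord p₁ p₂ → ℝ) : ℝ :=
  (1 / ((N₁ : ℝ) * (N₂ : ℝ))) * ∑ i, ∑ j, ∑ a, (Θ i j a - Θ' i j a) ^ 2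

/-- Row-normalized adjacency matrix. -/
def rowNormalize {N : ℕ} (A : Fin N → Fin N → ℝ) (i k : Fin N) : ℝ := A i k / ∑ l, A i l

/-- Column-normalized adjacency matrix. -/
def colNormalize {N : ℕ} (A : Fin N → Fin N → ℝ) (k j : Fin N) : ℝ := A k j / ∑ l, A l j

/-- A random vector has the `K`-convex concentration property if every convex 1-Lipschitz
function `φ` of it is integrable and
`P(|φ(V) - E φ(V)| ≥ t) ≤ 2 exp(-t² / K²)` for all `t > 0`. -/
def ConvexConcentration {Ω : Type u} [MeasurableSpace Ω] (μ : Measure Ω) {ι : Type}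
    [Fintype ι] (K : ℝ) (V : Ω → EuclideanSpace ℝ ι) : Prop :=
  ∀ φ : EuclideanSpace ℝ ι → ℝ, ConvexOn ℝ Set.univ φ → LipschitzWith 1 φ →
    Integrable (fun ω => φ (V ω)) μ ∧
    ∀ t : ℝ, 0 < t →
      μ {ω | t ≤ |φ (V ω) - ∫ ω', φ (V ω') ∂μ|} ≤
        ENNReal.ofReal (2 * Real.exp (-(t ^ 2 / K ^ 2)))

/-- The objects of one instance of the model: sizes, two networks, true parameters and
memberships, the probability space, the responses `Y t`, the row covariates `x t`, the column
covariates `z t` (used at times `0 ≤ t ≤ T`), and the noise `ε t` (used at `1 ≤ t ≤ T`). -/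
structure Setting where
  N₁ : ℕ
  N₂ : ℕ
  T : ℕ
  p₁ : ℕ
  p₂ : ℕ
  G₀ : ℕ
  H₀ : ℕ
  A₁ : Fin N₁ → Fin N₁ → ℝ
  A₂ : Fin N₂ → Fin N₂ → ℝ
  θ₀ : Grouped N₁ N₂ p₁ p₂ G₀ H₀
  Ω : Type u
  mΩ : MeasurableSpace Ω
  μ : @Measure Ω mΩ
  Y : ℕ → Ω → Fin N₁ → Fin N₂ → ℝ
  x : ℕ → Ω → Fin N₁ → Fin p₁ → ℝ
  z : ℕ → Ω → Fin N₂ → Fin p₂ → ℝ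
  ε : ℕ → Ω → Fin N₁ → Fin N₂ → ℝ

attribute [instance] Setting.mΩ

namespace Setting

variable (S : Setting.{u})

/-- `m = p₁ + p₂ + 3`. -/
def m : ℕ := S.p₁ + S.p₂ + 3

/-- The regressor `𝒳_ijt`, built from `Y_{t-1}`, `x_t`, `z_t`. -/
def regressor (t : ℕ) (ω : S.Ω) (i : Fin S.N₁) (j : Fin S.N₂) : Coord S.p₁ S.p₂ → ℝ :=
  Sum.elim
    (Sum.elim (fun _ => ∑ k, rowNormalize S.A₁ i k * S.Y (t - 1) ω k j) (S.x t ω i))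
    (Sum.elim
      (Sum.elim (fun _ => ∑ k, S.Y (t - 1) ω i k * colNormalize S.A₂ k j) (S.z t ω j))
      (fun _ => S.Y (t - 1) ω i j))

/-- The systematic part of the model equation for `Y_ijt` under the parameters `θ`. -/
def fitted {G H : ℕ} (θ : Grouped S.N₁ S.N₂ S.p₁ S.p₂ G H)
    (t : ℕ) (ω : S.Ω) (i : Fin S.N₁) (j : Fin S.N₂) : ℝ :=
  θ.par.lam (θ.g i) * (∑ k, rowNormalize S.A₁ i k * S.Y (t - 1) ω k j)
    + θ.par.gam (θ.h j) * (∑ k, S.Y (t - 1) ω i k * colNormalize S.A₂ k j)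
    + θ.par.alpha (θ.g i) (θ.h j) * S.Y (t - 1) ω i j
    + (∑ a, S.x t ω i a * θ.par.zeta (θ.g i) a)
    + (∑ a, S.z t ω j a * θ.par.delta (θ.h j) a)

theorem fitted_eq {G H : ℕ} (θ : Grouped S.N₁ S.N₂ S.p₁ S.p₂ G H)
    (t : ℕ) (ω : S.Ω) (i : Fin S.N₁) (j : Fin S.N₂) :
    S.fitted θ t ω i j = ∑ a, S.regressor t ω i j a * θ.tensor i j a := by
  simp only [fitted, regressor, Grouped.tensor, Fintype.sum_sum_type, Sum.elim_inl,
    Sum.elim_inr, Finset.univ_unique, Finset.sum_singleton]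
  ring

/-- The least squares objective `Q(θ, 𝒢, ℋ)`. -/
def Q {G H : ℕ} (ω : S.Ω) (θ : Grouped S.N₁ S.N₂ S.p₁ S.p₂ G H) : ℝ :=
  ∑ i, ∑ j, ∑ t ∈ Finset.Icc 1 S.T, (S.Y t ω i j - S.fitted θ t ω i j) ^ 2

/-- `θ` minimizes the least squares objective, over all parameters and memberships with `G` row
and `H` column groups, in the compact parameter space `‖Θ‖_max ≤ R`. -/
def IsLeastSquares {G H : ℕ} (R : ℝ) (ω : S.Ω)
    (θ : Grouped S.N₁ S.N₂ S.p₁ S.p₂ G H) : Prop :=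
  (∀ i j a, |θ.tensor i j a| ≤ R) ∧
  ∀ θ' : Grouped S.N₁ S.N₂ S.p₁ S.p₂ G H,
    (∀ i j a, |θ'.tensor i j a| ≤ R) → S.Q ω θ ≤ S.Q ω θ'

/-- All covariates at the times `0, …, T`, stacked into one vector. -/
def covariateVector (ω : S.Ω) :
    EuclideanSpace ℝ (Fin (S.T + 1) × ((Fin S.N₁ × Fin S.p₁) ⊕ (Fin S.N₂ × Fin S.p₂))) :=
  WithLp.toLp 2 fun k =>
    Sum.elim (fun q => S.x k.1 ω q.1 q.2) (fun q => S.z k.1 ω q.1 q.2) k.2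

/-- `E(𝒳_ijt 𝒳_ijtᵀ)`. -/
def secondMoment (t : ℕ) (i : Fin S.N₁) (j : Fin S.N₂) :
    Matrix (Coord S.p₁ S.p₂) (Coord S.p₁ S.p₂) ℝ :=
  Matrix.of fun a b => ∫ ω, S.regressor t ω i j a * S.regressor t ω i j b ∂S.μ

/-- The GMNAR model on a probability space: nonnegative adjacency weights without self-loops,
measurable variables, and the model equation at the times `1, …, T`. -/
structure IsModel : Prop where
  prob : IsProbabilityMeasure S.μ
  A₁_nonneg : ∀ i k, 0 ≤ S.A₁ i k
  A₁_diag : ∀ i, S.A₁ i i = 0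
  A₂_nonneg : ∀ k j, 0 ≤ S.A₂ k j
  A₂_diag : ∀ j, S.A₂ j j = 0
  meas_Y : ∀ t, Measurable (S.Y t)
  meas_x : ∀ t, Measurable (S.x t)
  meas_z : ∀ t, Measurable (S.z t)
  meas_ε : ∀ t, Measurable (S.ε t)
  equation : ∀ᵐ ω ∂S.μ, ∀ t ∈ Finset.Icc 1 S.T, ∀ i j,
    S.Y t ω i j = S.fitted S.θ₀ t ω i j + S.ε t ω i j

/-- Parameter space. -/
def ParameterSpace (R : ℝ) : Prop := ∀ i j a, |S.θ₀.tensor i j a| < R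

/-- Convexity: the regressors are square integrable, their second moment matrices `Σ_ij` do not
depend on the time, and all eigenvalues of all `Σ_ij` are at least `τ`. -/
structure Convexity (τ : ℝ) : Prop where
  memLp : ∀ t ∈ Finset.Icc 1 S.T, ∀ i j a,
    MemLp (fun ω => S.regressor t ω i j a) 2 S.μ
  stationary : ∀ t ∈ Finset.Icc 1 S.T, ∀ i j, S.secondMoment t i j = S.secondMoment 1 i j
  lowerBound : ∀ i j, (S.secondMoment 1 i j - τ • 1).PosSemidef

/-- Noise: i.i.d., centered, sub-Gaussian with scale `σ`; `ε_ijt` is independent of the past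
`(Y_s)_{s < t}, (x_s, z_s)_{s ≤ t}`, and the covariates are exogenous, that is, the noise array
is independent of the covariates. -/
structure Noise (σ : ℝ≥0) : Prop where
  indep : iIndepFun (fun (k : Fin S.T × Fin S.N₁ × Fin S.N₂) ω => S.ε (k.1 + 1) ω k.2.1 k.2.2) S.μ
  identDistrib : ∀ t ∈ Finset.Icc 1 S.T, ∀ t' ∈ Finset.Icc 1 S.T, ∀ i j i' j',
    IdentDistrib (fun ω => S.ε t ω i j) (fun ω => S.ε t' ω i' j') S.μ S.μ
  mean_zero : ∀ t ∈ Finset.Icc 1 S.T, ∀ i j, ∫ ω, S.ε t ω i j ∂S.μ = 0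
  subGaussian : ∀ t ∈ Finset.Icc 1 S.T, ∀ i j,
    HasSubgaussianMGF (fun ω => S.ε t ω i j) (σ ^ 2) S.μ
  indep_past : ∀ t ∈ Finset.Icc 1 S.T, ∀ i j,
    IndepFun (fun ω => S.ε t ω i j)
      (fun ω => ((fun s : Fin t => S.Y s ω),
        (fun s : Fin (t + 1) => S.x s ω), (fun s : Fin (t + 1) => S.z s ω))) S.μ
  exogenous :
    IndepFun (fun ω (s : Fin S.T) => S.ε (s + 1) ω)
      (fun ω => ((fun s : Fin (S.T + 1) => S.x s ω), (fun s : Fin (S.T + 1) => S.z s ω))) S.μ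

/-- Covariates: centered and, stacked, with the `K`-convex concentration property. -/
structure Covariates (K : ℝ) : Prop where
  mean_x : ∀ t ∈ Finset.Icc 1 S.T, ∀ i a, ∫ ω, S.x t ω i a ∂S.μ = 0
  mean_z : ∀ t ∈ Finset.Icc 1 S.T, ∀ j a, ∫ ω, S.z t ω j a ∂S.μ = 0
  concentration : ConvexConcentration S.μ K S.covariateVector

/-- Stationarity condition on the true autoregression coefficients. -/
def Stationarity (κ : ℝ) : Prop :=
  ∀ g h, |S.θ₀.par.lam g| + |S.θ₀.par.gam h| + |S.θ₀.par.alpha g h| ≤ κ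

end Setting

end GMNAR

end

/-! Least squares is compared with the true parameters, which stay feasible after padding with empty
groups. With Δ = Θ̂ − Θ⁰ this gives the basic inequality Σ_{ij} Σ_t (𝒳_ijtᵀ Δ_ij)² ≤ 2 Σ_{ij} Σ_a
Δ_ija Σ_t ε_ijt 𝒳_ijta (`IsLeastSquares.sum_sq_le`). The right side needs no union bound over
memberships. Since |Δ_ija| ≤ 2R it is at most a constant times the sum of the absolute scores, and
each score is a martingale of second moment O(T) times that of its regressor. Only the three lag
coordinates have large second moments, so the averaged scores of one node have mean O(m/√T)
(`exists_sum_integral_abs_score_le`).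

The left side is bounded below node by node (`exists_gram_lower_bound`). By linearity of the
autoregression the regressor splits into a linear functional of the covariates, a linear functional
of the noise, and a remainder due to the initial value. Row-normalized weights and κ < 1 make the
recursion a contraction in sup norm over nodes, with values in any normed space; with values in time
sequences this yields operator norm bounds for the coefficients. (a) Covariates: the root of the
empirical quadratic form in a direction u is a convex Lipschitz function of the covariate vector, so
it concentrates at scale √(m/T). A net, taken after whitening by the population matrix, makes this
uniform in u. (b) Noise: it lives on three coordinates, and a variance bound for quadratic forms in
white noise suffices. (c) Cross moments: given the covariates they are linear in the noise. (d)
Initial value: its L² norm is O(√m), because second moments do not change in time, and its influence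
decays geometrically. Together the Gram matrix of a node exceeds τ/32 outside an event of
probability O(T^{-1/2}).

On that event ‖Δ_ij‖² ≤ 4R²m is used instead. Averaging over nodes dominates the pseudo-distance by
a variable of mean O(m/√T) (`exists_dominating`), and Markov's inequality concludes. Bad nodes are
counted in mean rather than excluded simultaneously, so no logarithm of N₁N₂ is incurred; the one in
the rate is simply nonnegative. -/

noncomputable section

namespace GMNAR

universe u

open scoped InnerProductSpace

/-! ### Second moments from tail bounds and convex concentration -/

/-- A Gaussian tail bound implies a bound on the second moment. -/
theorem integral_sq_le_of_tail {Ω : Type*} [MeasurableSpace Ω] {μ : Measure Ω} {Z : Ω → ℝ}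
    (hZ : AEStronglyMeasurable Z μ) {L : ℝ} (hL : 0 < L)
    (tail : ∀ t : ℝ, 0 < t → μ {ω | t ≤ |Z ω|} ≤ ENNReal.ofReal (2 * Real.exp (-(t ^ 2 / L ^ 2)))) :
    MemLp Z 2 μ ∧ ∫ ω, Z ω ^ 2 ∂μ ≤ 2 * L ^ 2 := by
  have hL2 : 0 < L ^ 2 := by positivity
  have key : ∫⁻ ω, ENNReal.ofReal (Z ω ^ 2) ∂μ ≤ ENNReal.ofReal (2 * L ^ 2) := by
    -- Layer cake: μ{Z² ≥ t} ≤ 2 exp(-t/L²), which integrates to 2L².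
    rw [lintegral_eq_lintegral_meas_le μ (Eventually.of_forall fun ω => sq_nonneg _)
      (hZ.aemeasurable.pow_const 2)]
    have h_int : IntegrableOn (fun t : ℝ => 2 * Real.exp (-(1 / L ^ 2) * t)) (Set.Ioi 0) :=
      (exp_neg_integrableOn_Ioi 0 (by positivity)).const_mul 2
    have hval : ∫ t in Set.Ioi (0 : ℝ), 2 * Real.exp (-(1 / L ^ 2) * t) = 2 * L ^ 2 := by
      rw [integral_const_mul, integral_exp_mul_Ioi (by simp; positivity)]
      simp
    calc ∫⁻ t in Set.Ioi (0 : ℝ), μ {ω | t ≤ Z ω ^ 2}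
        ≤ ∫⁻ t in Set.Ioi (0 : ℝ), ENNReal.ofReal (2 * Real.exp (-(1 / L ^ 2) * t)) := by
          refine setLIntegral_mono' measurableSet_Ioi fun t ht => ?_
          have ht' : 0 < t := ht
          refine (measure_mono ?_).trans ((tail (√t) (Real.sqrt_pos.2 ht')).trans (le_of_eq ?_))
          · intro ω hω
            exact Real.sqrt_le_left (abs_nonneg _) |>.2 (by simpa using hω)
          · rw [Real.sq_sqrt ht'.le]; congr 3; ring
      _ = ENNReal.ofReal (2 * L ^ 2) := by
          rw [← ofReal_integral_eq_lintegral_ofReal h_int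
            (Eventually.of_forall fun t => by positivity), hval]
  have hi : Integrable (fun ω => Z ω ^ 2) μ := by
    refine ⟨hZ.pow 2, ?_⟩
    rw [hasFiniteIntegral_iff_ofReal (Eventually.of_forall fun ω => sq_nonneg _)]
    exact key.trans_lt ENNReal.ofReal_lt_top
  refine ⟨(memLp_two_iff_integrable_sq hZ).2 hi, ?_⟩
  rw [integral_eq_lintegral_of_nonneg_ae (Eventually.of_forall fun ω => sq_nonneg _) (hZ.pow 2)]
  exact ENNReal.toReal_le_of_le_ofReal (by positivity) key

section Concentration

variable {Ω : Type u} [MeasurableSpace Ω] {μ : Measure Ω} {ι : Type} [Fintype ι] {K : ℝ}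
  {V : Ω → EuclideanSpace ℝ ι}

theorem ConvexConcentration.tail (h : ConvexConcentration μ K V) {φ : EuclideanSpace ℝ ι → ℝ}
    (hφ : ConvexOn ℝ Set.univ φ) {L : ℝ} (hL : 0 < L)
    (hLip : ∀ v w, |φ v - φ w| ≤ L * ‖v - w‖) :
    Integrable (fun ω => φ (V ω)) μ ∧
    ∀ t : ℝ, 0 < t →
      μ {ω | t ≤ |φ (V ω) - ∫ ω', φ (V ω') ∂μ|} ≤
        ENNReal.ofReal (2 * Real.exp (-(t ^ 2 / (L * K) ^ 2))) := by
  obtain ⟨h1, h2⟩ := h (fun v => L⁻¹ * φ v)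
    (by simpa using hφ.smul (inv_nonneg.2 hL.le))
    (LipschitzWith.of_dist_le_mul fun v w => by
      rw [Real.dist_eq, ← mul_sub, abs_mul, abs_of_pos (inv_pos.2 hL), dist_eq_norm, NNReal.coe_one,
        one_mul, inv_mul_le_iff₀ hL]
      exact hLip v w)
  refine ⟨by simpa [hL.ne'] using h1.const_mul L, fun t ht => ?_⟩
  refine (measure_mono ?_).trans ((h2 (L⁻¹ * t) (by positivity)).trans (le_of_eq ?_))
  · intro ω hω
    simp only [Set.mem_ofPred_eq] at hω ⊢
    rw [integral_const_mul, ← mul_sub, abs_mul, abs_of_pos (inv_pos.2 hL)]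
    gcongr
  · congr 4
    field_simp

theorem ConvexConcentration.variance_le [IsProbabilityMeasure μ] (h : ConvexConcentration μ K V)
    (hK : 0 < K) {φ : EuclideanSpace ℝ ι → ℝ}
    (hφ : ConvexOn ℝ Set.univ φ) {L : ℝ} (hL : 0 < L)
    (hLip : ∀ v w, |φ v - φ w| ≤ L * ‖v - w‖) :
    MemLp (fun ω => φ (V ω)) 2 μ ∧
      ∫ ω, φ (V ω) ^ 2 ∂μ ≤ (∫ ω, φ (V ω) ∂μ) ^ 2 + 2 * (L * K) ^ 2 := by
  obtain ⟨h1, h2⟩ := h.tail hφ hL hLip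
  obtain ⟨h3, h4⟩ := integral_sq_le_of_tail (h1.aestronglyMeasurable.sub aestronglyMeasurable_const)
    (mul_pos hL hK) h2
  set e := ∫ ω, φ (V ω) ∂μ with he
  have h5 : MemLp (fun ω => φ (V ω)) 2 μ := by
    have := h3.add (memLp_const e)
    refine this.ae_eq (Eventually.of_forall fun ω => ?_)
    simp
  refine ⟨h5, ?_⟩
  have : ∫ ω, (φ (V ω) - e) ^ 2 ∂μ = ∫ ω, φ (V ω) ^ 2 ∂μ - e ^ 2 := by
    have h6 : ∀ ω, (φ (V ω) - e) ^ 2 = φ (V ω) ^ 2 - 2 * e * φ (V ω) + e ^ 2 := fun ω => by ring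
    simp_rw [h6]
    have h7 : Integrable (fun ω => φ (V ω) ^ 2 - 2 * e * φ (V ω)) μ :=
      h5.integrable_sq.sub (h1.const_mul _)
    rw [integral_add h7 (integrable_const _),
      integral_sub h5.integrable_sq (h1.const_mul _), integral_const_mul]
    simp only [integral_const, probReal_univ, smul_eq_mul, one_mul]
    rw [← he]; ring
  simp only [Pi.sub_apply] at h4
  linarith

/-- Centered linear functionals of a vector with convex concentration. -/
theorem ConvexConcentration.inner_sq_le [IsProbabilityMeasure μ] (h : ConvexConcentration μ K V)
    (hK : 0 < K) (b : EuclideanSpace ℝ ι) :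
    MemLp (fun ω => ⟪b, V ω⟫_ℝ) 2 μ ∧
      (∫ ω, ⟪b, V ω⟫_ℝ ∂μ = 0 → ∫ ω, ⟪b, V ω⟫_ℝ ^ 2 ∂μ ≤ 2 * K ^ 2 * ‖b‖ ^ 2) := by
  rcases eq_or_ne b 0 with rfl | hb
  · simp
  have hc : ConvexOn ℝ Set.univ (fun v : EuclideanSpace ℝ ι => ⟪b, v⟫_ℝ) :=
    (innerₗ (EuclideanSpace ℝ ι) b).convexOn convex_univ
  obtain ⟨h1, h2⟩ := h.variance_le hK hc (norm_pos_iff.2 hb) fun v w => by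
    rw [← inner_sub_right]; exact abs_real_inner_le_norm _ _
  refine ⟨h1, fun h0 => h2.trans (le_of_eq ?_)⟩
  rw [h0]; ring

end Concentration

/-! ### Nets and uniform control of random quadratic forms -/

section Net

variable {E : Type*} [NormedAddCommGroup E] [InnerProductSpace ℝ E] [FiniteDimensional ℝ E]

/-- The unit ball has a `1/2`-net of cardinality at most `5 ^ dim`. -/
theorem exists_half_net : ∃ s : Finset E, s.card ≤ 5 ^ Module.finrank ℝ E ∧
    (∀ x ∈ s, ‖x‖ ≤ 1) ∧ ∀ v : E, ‖v‖ ≤ 1 → ∃ x ∈ s, ‖v - x‖ ≤ 1 / 2 := by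
  classical
  let P : ℕ → Prop := fun k => ∃ s : Finset E, s.card = k ∧ (∀ x ∈ s, ‖x‖ ≤ 1) ∧
    ∀ x ∈ s, ∀ y ∈ s, x ≠ y → 1 / 2 < ‖x - y‖
  have hbound : ∀ k, P k → k ≤ 5 ^ Module.finrank ℝ E := by
    rintro k ⟨s, rfl, h1, h2⟩
    have h2inj : Function.Injective fun x : E => (2 : ℝ) • x :=
      smul_right_injective E (two_ne_zero)
    rw [← Finset.card_image_of_injective s h2inj]
    -- Doubled, the points are 1-separated in the ball of radius 2, the normalization in which the
    -- volume bound is 5 ^ dim.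
    refine Besicovitch.card_le_of_separated _ ?_ ?_
    · simp only [Finset.mem_image, forall_exists_index, and_imp, forall_apply_eq_imp_iff₂]
      intro x hx
      rw [norm_smul]; simp; linarith [h1 x hx]
    · simp only [Finset.mem_image, forall_exists_index, and_imp, forall_apply_eq_imp_iff₂]
      intro x hx y hy hxy
      rw [← smul_sub, norm_smul]; simp
      linarith [h2 x hx y hy (fun h => hxy (by rw [h]))]
  have h0 : P 0 := ⟨∅, by simp⟩
  -- A separated set of greatest cardinality is a net: a point far from all its members could be
  -- added to it.
  obtain ⟨s, hs, h1, h2⟩ := Nat.findGreatest_spec (P := P) (Nat.zero_le (5 ^ Module.finrank ℝ E)) h0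
  refine ⟨s, hs ▸ Nat.findGreatest_le _, h1, fun v hv => ?_⟩
  by_contra! hcon
  have hvs : v ∉ s := fun h => by have := hcon v h; simp at this; linarith
  have hP : P (s.card + 1) := by
    refine ⟨insert v s, Finset.card_insert_of_notMem hvs, ?_, ?_⟩
    · intro x hx
      rcases Finset.mem_insert.1 hx with rfl | hx
      exacts [hv, h1 x hx]
    · intro x hx y hy hxy
      rcases Finset.mem_insert.1 hx with rfl | hx' <;>
        rcases Finset.mem_insert.1 hy with rfl | hy'
      · exact absurd rfl hxy
      · exact hcon y hy'
      · rw [norm_sub_rev]; exact hcon x hx'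
      · exact h2 x hx' y hy' hxy
  have := Nat.le_findGreatest (P := P) (hbound _ hP) hP
  omega

/-- The unit ball has a `1/4`-net of cardinality at most `25 ^ dim`, contained in the ball of
radius `3/2`. -/
theorem exists_quarter_net : ∃ s : Finset E, s.card ≤ 25 ^ Module.finrank ℝ E ∧
    (∀ x ∈ s, ‖x‖ ≤ 3 / 2) ∧ ∀ v : E, ‖v‖ ≤ 1 → ∃ x ∈ s, ‖v - x‖ ≤ 1 / 4 := by
  classical
  obtain ⟨s, hs, h1, h2⟩ := exists_half_net (E := E)
  -- Two-step approximation: the doubled remainder `2 • (v - x)` lies again in the unit ball and is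
  -- approximated by the same net. Hence 5² = 25 and radius 1 + 1/2.
  refine ⟨(s ×ˢ s).image fun p => p.1 + (2⁻¹ : ℝ) • p.2, ?_, ?_, ?_⟩
  · refine Finset.card_image_le.trans ?_
    rw [Finset.card_product, show (25 : ℕ) = 5 * 5 from rfl, mul_pow]
    exact Nat.mul_le_mul hs hs
  · simp only [Finset.mem_image, Finset.mem_product, forall_exists_index, and_imp]
    rintro x ⟨p, q⟩ hp hq rfl
    refine (norm_add_le _ _).trans ?_
    rw [norm_smul]; simp
    linarith [h1 p hp, h1 q hq]
  · intro v hv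
    obtain ⟨x, hx, hvx⟩ := h2 v hv
    obtain ⟨y, hy, hvy⟩ := h2 ((2 : ℝ) • (v - x)) (by rw [norm_smul]; simp; linarith)
    refine ⟨_, Finset.mem_image.2 ⟨(x, y), Finset.mem_product.2 ⟨hx, hy⟩, rfl⟩, ?_⟩
    have : v - (x + (2⁻¹ : ℝ) • y) = (2⁻¹ : ℝ) • ((2 : ℝ) • (v - x) - y) := by
      rw [smul_sub, smul_smul]; norm_num; abel
    rw [this, norm_smul]; simp; linarith

/-- A symmetric bilinear form is controlled by its values on a net. -/
theorem abs_bilin_le_of_net (b : E →ₗ[ℝ] E →ₗ[ℝ] ℝ) (hb : ∀ x y, b x y = b y x) {s : Finset E}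
    (hs2 : ∀ v : E, ‖v‖ ≤ 1 → ∃ x ∈ s, ‖v - x‖ ≤ 1 / 4) {c : ℝ}
    (hc : ∀ x ∈ s, |b x x| ≤ c) (v : E) : |b v v| ≤ 5 * c * ‖v‖ ^ 2 := by
  have hcont : Continuous fun v : E => |b v v| := by
    have h1 : Continuous fun p : E × E => b.toContinuousBilinearMap p.1 p.2 := by fun_prop
    exact (h1.comp (continuous_id.prodMk continuous_id)).abs
  obtain ⟨w, hw, hmax⟩ := (isCompact_closedBall (0 : E) 1).exists_isMaxOn
    (Metric.nonempty_closedBall.2 zero_le_one) hcont.continuousOn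
  set M := |b w w| with hM
  have hM0 : 0 ≤ M := abs_nonneg _
  have hMv : ∀ v : E, |b v v| ≤ M * ‖v‖ ^ 2 := by
    intro v
    rcases eq_or_ne v 0 with rfl | hv
    · simp
    have hv' : ‖v‖ ≠ 0 := norm_ne_zero_iff.2 hv
    have h1 := hmax (show (‖v‖⁻¹ • v) ∈ Metric.closedBall (0 : E) 1 by
      simp [norm_smul, hv'])
    simp only [Set.mem_ofPred_eq, map_smul, LinearMap.smul_apply, smul_eq_mul] at h1
    rw [← mul_assoc, abs_mul, abs_of_nonneg (by positivity), ← pow_two, inv_pow,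
      inv_mul_le_iff₀ (by positivity)] at h1
    linarith
  have hw1 : ‖w‖ ≤ 1 := by simpa using hw
  obtain ⟨x, hx, hwx⟩ := hs2 w hw1
  -- By symmetry the difference is `b (w - x) (w + x)`, polarized here at the rescaled pair 2(w −
  -- x), (w + x)/2 of norms at most 1/2 and 9/8. The parallelogram law bounds it by 97/128 · M ≤ 4/5
  -- · M, so M ≤ 5c.
  have hpol : b w w - b x x = 4⁻¹ * (b ((w - x) + (w - x) + (2⁻¹ : ℝ) • (w + x))
      ((w - x) + (w - x) + (2⁻¹ : ℝ) • (w + x)) -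
      b ((w - x) + (w - x) - (2⁻¹ : ℝ) • (w + x)) ((w - x) + (w - x) - (2⁻¹ : ℝ) • (w + x))) := by
    simp only [map_add, map_sub, map_smul, LinearMap.add_apply, LinearMap.sub_apply,
      LinearMap.smul_apply, smul_eq_mul, hb x w]
    ring
  have hpar := parallelogram_law_with_norm ℝ ((w - x) + (w - x)) ((2⁻¹ : ℝ) • (w + x))
  have h2 := hMv ((w - x) + (w - x) + (2⁻¹ : ℝ) • (w + x))
  have h3 := hMv ((w - x) + (w - x) - (2⁻¹ : ℝ) • (w + x))
  have h4 : ‖(w - x) + (w - x)‖ ≤ 1 / 2 := (norm_add_le _ _).trans (by linarith)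
  have h5 : ‖(2⁻¹ : ℝ) • (w + x)‖ ≤ 5 / 4 - 1 / 8 := by
    have : w + x = w + w - (w - x) := by abel
    rw [this, norm_smul]
    have := norm_sub_le (w + w) (w - x)
    have := norm_add_le w w
    simp only [norm_inv, Real.norm_ofNat]; linarith
  have h6 : M ≤ c + M * (4 / 5) := by
    have h7 : |b w w - b x x| ≤ 4⁻¹ * (M * (2 * ((1 / 2) ^ 2 + (9 / 8) ^ 2))) := by
      rw [hpol, abs_mul, abs_of_pos (by norm_num : (0 : ℝ) < 4⁻¹)]
      gcongr
      refine (abs_sub _ _).trans ((add_le_add h2 h3).trans ?_)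
      rw [← mul_add]
      gcongr
      have h8 : ‖(w - x) + (w - x)‖ ^ 2 ≤ (1 / 2) ^ 2 := by gcongr
      have h9 : ‖(2⁻¹ : ℝ) • (w + x)‖ ^ 2 ≤ (9 / 8) ^ 2 := by gcongr; linarith
      nlinarith
    have h10 : M ≤ |b x x| + |b w w - b x x| := by
      have := abs_add_le (b x x) (b w w - b x x)
      simpa [hM] using this
    have := hc x hx
    nlinarith
  refine (hMv v).trans ?_
  gcongr
  linarith

end Net

section Whitening

open Matrix
open scoped MatrixOrder

/-- If the quadratic form of a random symmetric matrix `G` is close to that of `B ≥ 0` for every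
single vector with probability `1 - p`, then it is close uniformly with probability
`1 - 25 ^ dim * p`, relative to `B + 1`. -/
theorem measure_exists_quadForm_le {Ω : Type*} [MeasurableSpace Ω] {μ : Measure Ω} {ι : Type*}
    [Fintype ι] [DecidableEq ι] (G : Ω → Matrix ι ι ℝ) (hG : ∀ ω, (G ω).IsSymm) {B : Matrix ι ι ℝ}
    (hB : B.PosSemidef) {c : ℝ} {p : ℝ≥0∞}
    (h : ∀ u : ι → ℝ, u ⬝ᵥ u ≤ 9 / 4 → u ⬝ᵥ B *ᵥ u ≤ 9 / 4 →
      μ {ω | c < |u ⬝ᵥ (G ω - B) *ᵥ u|} ≤ p) :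
    μ {ω | ∃ u : ι → ℝ, 5 * c * (u ⬝ᵥ B *ᵥ u + u ⬝ᵥ u) < |u ⬝ᵥ (G ω - B) *ᵥ u|} ≤
      25 ^ Fintype.card ι * p := by
  -- With B + 1 = DᵀD, the map D⁻¹ carries a net of the Euclidean ball to a net of the ellipsoid
  -- uᵀBu + uᵀu ≤ 1. Its points satisfy uᵀBu + uᵀu ≤ (3/2)², so the hypothesis is needed only for
  -- directions with bounded population form, however large B is.
  have hA : (B + 1).PosDef := PosDef.posSemidef_add hB PosDef.one
  obtain ⟨D, hD⟩ := CStarAlgebra.nonneg_iff_eq_star_mul_self.mp hA.posSemidef.nonneg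
  rw [star_eq_conjTranspose, conjTranspose_eq_transpose_of_trivial] at hD
  have hDu : IsUnit D := by
    have h1 := hA.isUnit
    rw [hD, isUnit_iff_isUnit_det, det_mul, det_transpose] at h1
    rw [isUnit_iff_isUnit_det]
    exact isUnit_of_mul_isUnit_left h1
  have hDinv : D * D⁻¹ = 1 := mul_nonsing_inv D ((isUnit_iff_isUnit_det D).1 hDu)
  have hDinv' : D⁻¹ * D = 1 := nonsing_inv_mul D ((isUnit_iff_isUnit_det D).1 hDu)
  have hnorm : ∀ u : ι → ℝ, u ⬝ᵥ B *ᵥ u + u ⬝ᵥ u = ‖WithLp.toLp 2 (D *ᵥ u)‖ ^ 2 := by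
    intro u
    rw [EuclideanSpace.real_norm_sq_eq]
    have : u ⬝ᵥ B *ᵥ u + u ⬝ᵥ u = u ⬝ᵥ (B + 1) *ᵥ u := by
      rw [add_mulVec, dotProduct_add, one_mulVec]
    rw [this, hD, ← mulVec_mulVec, dotProduct_mulVec, vecMul_transpose]
    simp [dotProduct, pow_two]
  obtain ⟨s, hs, hs1, hs2⟩ := exists_quarter_net (E := EuclideanSpace ℝ ι)
  rw [finrank_euclideanSpace] at hs
  let L : EuclideanSpace ℝ ι →ₗ[ℝ] (ι → ℝ) :=
    (toLin' D⁻¹) ∘ₗ (WithLp.linearEquiv 2 ℝ (ι → ℝ)).toLinearMap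
  have hL : ∀ v, WithLp.toLp 2 (D *ᵥ L v) = v := by
    intro v
    simp [L, hDinv]
  have hL' : ∀ u, L (WithLp.toLp 2 (D *ᵥ u)) = u := by
    intro u
    simp [L, hDinv']
  let b : Ω → EuclideanSpace ℝ ι →ₗ[ℝ] EuclideanSpace ℝ ι →ₗ[ℝ] ℝ := fun ω =>
    (toBilin' (G ω - B)).compl₁₂ L L
  have hb : ∀ ω v w, b ω v w = L v ⬝ᵥ (G ω - B) *ᵥ L w := fun ω v w => by
    rw [LinearMap.compl₁₂_apply, toBilin'_apply']
  have hsymm : ∀ ω v w, b ω v w = b ω w v := by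
    intro ω v w
    have hT : (G ω - B)ᵀ = G ω - B := by
      rw [transpose_sub, (hG ω).eq]
      have := hB.isHermitian.eq
      rw [conjTranspose_eq_transpose_of_trivial] at this
      rw [this]
    rw [hb, hb, dotProduct_mulVec, ← mulVec_transpose, hT, dotProduct_comm]
  calc μ {ω | ∃ u : ι → ℝ, 5 * c * (u ⬝ᵥ B *ᵥ u + u ⬝ᵥ u) < |u ⬝ᵥ (G ω - B) *ᵥ u|}
      ≤ μ (⋃ x ∈ s, {ω | c < |L x ⬝ᵥ (G ω - B) *ᵥ L x|}) := by
        refine measure_mono fun ω hω => ?_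
        by_contra hcon
        simp only [Set.mem_iUnion, Set.mem_ofPred_eq, not_exists, not_lt] at hcon
        obtain ⟨u, hu⟩ := hω
        have h1 := abs_bilin_le_of_net (b ω) (hsymm ω) hs2
          (fun x hx => by rw [hb]; exact hcon x hx) (WithLp.toLp 2 (D *ᵥ u))
        rw [hb, hL', ← hnorm] at h1
        exact absurd hu (not_lt.2 h1)
    _ ≤ ∑ x ∈ s, μ {ω | c < |L x ⬝ᵥ (G ω - B) *ᵥ L x|} := measure_biUnion_finset_le _ _
    _ ≤ ∑ x ∈ s, p := by
        refine Finset.sum_le_sum fun x hx => ?_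
        have h1 := hnorm (L x)
        rw [hL] at h1
        have h2 : ‖x‖ ^ 2 ≤ 9 / 4 := by
          have := pow_le_pow_left₀ (norm_nonneg _) (hs1 x hx) 2
          linarith
        have h3 : 0 ≤ L x ⬝ᵥ L x := by simpa using dotProduct_star_self_nonneg (L x)
        have h4 : 0 ≤ L x ⬝ᵥ B *ᵥ L x := by simpa using hB.dotProduct_mulVec_nonneg (L x)
        exact h _ (by linarith) (by linarith)
    _ ≤ 25 ^ Fintype.card ι * p := by
        rw [Finset.sum_const, nsmul_eq_mul]
        gcongr
        exact_mod_cast hs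

end Whitening

/-! ### White noise: moments, linear combinations, quadratic forms -/

section Moments

variable {Ω : Type*} [MeasurableSpace Ω] {μ : Measure Ω}

/-- From |x|ⁿ ≤ n! exp|x| at x = X/σ and E exp(±X/σ) ≤ exp(1/2) ≤ 2; the constant is 96 = 4! · (2 +
2). -/
theorem integral_sq_pow_four_le_of_subgaussian {X : Ω → ℝ} {σ : ℝ≥0} (hσ : 0 < σ)
    (h : HasSubgaussianMGF X (σ ^ 2) μ) :
    ∫ ω, X ω ^ 2 ∂μ ≤ 96 * σ ^ 2 ∧ ∫ ω, X ω ^ 4 ∂μ ≤ 96 * σ ^ 4 := by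
  have hσ' : (0 : ℝ) < σ := hσ
  have hm : ∀ t : ℝ, t ^ 2 = (σ ^ 2 : ℝ)⁻¹ → ∫ ω, Real.exp (t * X ω) ∂μ ≤ 2 := by
    intro t ht
    refine (h.mgf_le t).trans ?_
    rw [ht]
    push_cast
    rw [mul_inv_cancel₀ (by positivity)]
    have := Real.exp_one_lt_d9
    have h2 : Real.exp (1 / 2) ^ 2 = Real.exp 1 := by rw [← Real.exp_nat_mul]; norm_num
    nlinarith [Real.exp_pos (1 / 2)]
  have h1 := hm (σ : ℝ)⁻¹ (by rw [inv_pow])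
  have h2 := hm (-(σ : ℝ)⁻¹) (by rw [neg_sq, inv_pow])
  have key : ∀ n : ℕ, n ≤ 4 → Even n → ∫ ω, X ω ^ n ∂μ ≤ 96 * σ ^ n := by
    intro n hn heven
    have hi := (h.integrable_exp_mul (σ : ℝ)⁻¹).add (h.integrable_exp_mul (-(σ : ℝ)⁻¹))
    calc ∫ ω, X ω ^ n ∂μ
        ≤ ∫ ω, 24 * σ ^ n * (Real.exp ((σ : ℝ)⁻¹ * X ω) + Real.exp (-(σ : ℝ)⁻¹ * X ω)) ∂μ := by
          refine integral_mono_of_nonneg (Eventually.of_forall fun ω => heven.pow_nonneg _)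
            (hi.const_mul _) (Eventually.of_forall fun ω => ?_)
          have h3 := Real.pow_div_factorial_le_exp _ (abs_nonneg ((σ : ℝ)⁻¹ * X ω)) n
          have h4 : Real.exp |(σ : ℝ)⁻¹ * X ω| ≤
              Real.exp ((σ : ℝ)⁻¹ * X ω) + Real.exp (-(σ : ℝ)⁻¹ * X ω) := by
            rcases abs_choice ((σ : ℝ)⁻¹ * X ω) with h | h <;> rw [h]
            · linarith [Real.exp_pos (-(σ : ℝ)⁻¹ * X ω)]
            · rw [← neg_mul]; linarith [Real.exp_pos ((σ : ℝ)⁻¹ * X ω)]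
          have h5 : (n.factorial : ℝ) ≤ 24 := by
            exact_mod_cast (Nat.factorial_le hn).trans (by decide)
          have h6 : X ω ^ n = σ ^ n * |(σ : ℝ)⁻¹ * X ω| ^ n := by
            rw [heven.pow_abs, mul_pow, ← mul_assoc, ← mul_pow, mul_inv_cancel₀ hσ'.ne', one_pow,
              one_mul]
          have h7 : |(σ : ℝ)⁻¹ * X ω| ^ n ≤ n.factorial * Real.exp |(σ : ℝ)⁻¹ * X ω| := by
            rwa [div_le_iff₀' (by positivity)] at h3
          simp only
          rw [h6, mul_comm (24 : ℝ), mul_assoc]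
          gcongr
          refine h7.trans ?_
          gcongr
      _ ≤ 96 * σ ^ n := by
          rw [integral_const_mul, integral_add (h.integrable_exp_mul _) (h.integrable_exp_mul _)]
          have : (0 : ℝ) < σ ^ n := by positivity
          nlinarith
  exact ⟨key 2 (by norm_num) (by decide), key 4 le_rfl (by decide)⟩

/-- A centered white noise, independent across indices, with second moment `v` and fourth moments
at most `w`. -/
structure IsWhiteNoise {κ : Type*} (μ : Measure Ω) (e : κ → Ω → ℝ) (v w : ℝ) : Prop where
  meas : ∀ k, Measurable (e k)
  indep : iIndepFun e μ
  memLp : ∀ k, MemLp (e k) 4 μ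
  mean : ∀ k, ∫ ω, e k ω ∂μ = 0
  sq : ∀ k, ∫ ω, e k ω ^ 2 ∂μ = v
  four : ∀ k, ∫ ω, e k ω ^ 4 ∂μ ≤ w

variable {κ : Type*} {e : κ → Ω → ℝ} {v w : ℝ}

theorem memLp_mul_of_four {X Y : Ω → ℝ} (hX : MemLp X 4 μ) (hY : MemLp Y 4 μ) :
    MemLp (fun ω => X ω * Y ω) 2 μ := by
  have : ENNReal.HolderTriple 4 4 2 := ⟨by
    rw [← two_mul, show (4 : ℝ≥0∞) = 2 * 2 by norm_num,
      ENNReal.mul_inv (by simp) (by simp), ← mul_assoc,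
      ENNReal.mul_inv_cancel (by simp) (by simp), one_mul]⟩
  exact hY.mul hX

theorem IsWhiteNoise.sq_nonneg' (h : IsWhiteNoise μ e v w) (k : κ) : 0 ≤ v := by
  rw [← h.sq k]; exact integral_nonneg fun ω => sq_nonneg _

theorem IsWhiteNoise.sq_le [IsProbabilityMeasure μ] (h : IsWhiteNoise μ e v w) (k : κ) :
    v ^ 2 ≤ w := by
  have h2 : MemLp (fun ω => e k ω ^ 2) 2 μ := by
    simpa [pow_two] using memLp_mul_of_four (h.memLp k) (h.memLp k)
  have h1 := variance_nonneg (fun ω => e k ω ^ 2) μ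
  rw [variance_eq_sub h2] at h1
  have h3 := h.four k
  have h4 : ∫ ω, ((fun ω => e k ω ^ 2) ^ 2) ω ∂μ = ∫ ω, e k ω ^ 4 ∂μ := by
    congr 1; ext ω; simp only [Pi.pow_apply]; ring
  rw [h4, h.sq k] at h1
  linarith

variable [Fintype κ] [DecidableEq κ]

/-- Second moment of a linear combination of white noise with independent random coefficients. -/
theorem IsWhiteNoise.integral_sum_mul_sq [IsProbabilityMeasure μ] (h : IsWhiteNoise μ e v w)
    {d : κ → Ω → ℝ} (hd : ∀ k, Measurable (d k)) (hd2 : ∀ k, MemLp (d k) 2 μ)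
    (hind : IndepFun (fun ω k => e k ω) (fun ω k => d k ω) μ) :
    MemLp (fun ω => ∑ k, d k ω * e k ω) 2 μ ∧
      ∫ ω, (∑ k, d k ω * e k ω) ^ 2 ∂μ = v * ∑ k, ∫ ω, d k ω ^ 2 ∂μ := by
  have he2 : ∀ k, MemLp (e k) 2 μ := fun k => (h.memLp k).mono_exponent (by norm_num)
  have hL2 : ∀ k, MemLp (fun ω => d k ω * e k ω) 2 μ := by
    intro k
    rw [memLp_two_iff_integrable_sq (f := fun ω => d k ω * e k ω)
      (((hd k).mul (h.meas k)).aestronglyMeasurable)]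
    have h1 : IndepFun (fun ω => d k ω ^ 2) (fun ω => e k ω ^ 2) μ :=
      hind.symm.comp (φ := fun x : κ → ℝ => x k ^ 2) (ψ := fun x : κ → ℝ => x k ^ 2)
        (by fun_prop) (by fun_prop)
    have := h1.integrable_mul (hd2 k).integrable_sq (he2 k).integrable_sq
    refine this.congr (Eventually.of_forall fun ω => ?_)
    simp [mul_pow]
  have hprod : ∀ k l, ∫ ω, (d k ω * e k ω) * (d l ω * e l ω) ∂μ =
      if k = l then v * ∫ ω, d k ω ^ 2 ∂μ else 0 := by
    intro k l
    have h1 := hind.integral_fun_comp_mul_comp (f := fun x : κ → ℝ => x k * x l)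
      (g := fun x : κ → ℝ => x k * x l) (measurable_pi_iff.2 h.meas).aemeasurable
      (measurable_pi_iff.2 hd).aemeasurable (by fun_prop) (by fun_prop)
    have h2 : ∀ ω, (d k ω * e k ω) * (d l ω * e l ω) = (e k ω * e l ω) * (d k ω * d l ω) :=
      fun ω => by ring
    simp_rw [h2]
    rw [h1]
    split_ifs with hkl
    · subst hkl
      simp_rw [← pow_two]
      rw [h.sq k]
    · rw [(h.indep.indepFun hkl).integral_fun_mul_eq_mul_integral (h.meas k).aestronglyMeasurable
        (h.meas l).aestronglyMeasurable, h.mean k]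
      simp
  refine ⟨memLp_finsetSum _ fun k _ => hL2 k, ?_⟩
  have hi : ∀ k l, Integrable (fun ω => (d k ω * e k ω) * (d l ω * e l ω)) μ := fun k l =>
    (hL2 k).integrable_mul (hL2 l)
  simp_rw [pow_two, Finset.sum_mul_sum]
  rw [integral_finsetSum _ fun k _ => integrable_finsetSum _ fun l _ => hi k l]
  simp_rw [integral_finsetSum _ fun l _ => hi _ l, hprod]
  simp [Finset.mul_sum, pow_two]

theorem IsWhiteNoise.integral_linear_sq [IsProbabilityMeasure μ] (h : IsWhiteNoise μ e v w)
    (c : κ → ℝ) :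
    MemLp (fun ω => ∑ k, c k * e k ω) 2 μ ∧
      ∫ ω, (∑ k, c k * e k ω) ^ 2 ∂μ = v * ∑ k, c k ^ 2 := by
  have := h.integral_sum_mul_sq (d := fun k _ => c k) (fun k => measurable_const)
    (fun k => memLp_const _) (indepFun_const_right _ _)
  simpa using this

/-- Variance bound for quadratic forms in white noise. -/
theorem IsWhiteNoise.integral_quadForm_sq_le [IsProbabilityMeasure μ] (h : IsWhiteNoise μ e v w)
    (A : κ → κ → ℝ) (s : Finset κ) :
    MemLp (fun ω => ∑ k ∈ s, ∑ l ∈ s, A k l * (e k ω * e l ω) - v * ∑ k ∈ s, A k k) 2 μ ∧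
    ∫ ω, (∑ k ∈ s, ∑ l ∈ s, A k l * (e k ω * e l ω) - v * ∑ k ∈ s, A k k) ^ 2 ∂μ ≤
      4 * w * ∑ k ∈ s, ∑ l ∈ s, A k l ^ 2 := by
  have he2 : ∀ k l, MemLp (fun ω => e k ω * e l ω) 2 μ := fun k l =>
    memLp_mul_of_four (h.memLp k) (h.memLp l)
  have hq : ∀ s : Finset κ,
      MemLp (fun ω => ∑ k ∈ s, ∑ l ∈ s, A k l * (e k ω * e l ω) - v * ∑ k ∈ s, A k k) 2 μ :=
    fun s => (memLp_finsetSum _ fun k _ => memLp_finsetSum _ fun l _ => (he2 k l).const_mul _).sub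
      (memLp_const _)
  refine ⟨hq s, ?_⟩
  induction s using Finset.induction_on with
  | empty => simp
  | insert n s hn ih =>
    set q : Ω → ℝ := fun ω => ∑ k ∈ s, ∑ l ∈ s, A k l * (e k ω * e l ω) - v * ∑ k ∈ s, A k k with hqdef
    set ℓ : Ω → ℝ := fun ω => ∑ k ∈ s, (A k n + A n k) * e k ω with hℓ
    have hℓ2 : ∀ ω, ℓ ω = ∑ k, (if k ∈ s then A k n + A n k else 0) * e k ω := by
      intro ω
      simp [hℓ, ite_mul, Finset.sum_ite_mem]
    -- A new index adds the increment e_n ℓ + A_nn (e_n² − v), where ℓ is linear in the noise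
    -- already present. The increment is uncorrelated with the previous centered form, so second
    -- moments add up, and only fourth moments are needed.
    have hexp : ∀ ω, ∑ k ∈ insert n s, ∑ l ∈ insert n s, A k l * (e k ω * e l ω)
        - v * ∑ k ∈ insert n s, A k k = q ω + (e n ω * ℓ ω + A n n * (e n ω ^ 2 - v)) := by
      intro ω
      simp only [Finset.sum_insert hn, Finset.sum_add_distrib, hqdef, hℓ, Finset.mul_sum, add_mul]
      have h1 : ∑ k ∈ s, e n ω * (A k n * e k ω) = ∑ k ∈ s, A k n * (e k ω * e n ω) :=
        Finset.sum_congr rfl fun k _ => by ring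
      have h2 : ∑ k ∈ s, e n ω * (A n k * e k ω) = ∑ k ∈ s, A n k * (e n ω * e k ω) :=
        Finset.sum_congr rfl fun k _ => by ring
      simp only [mul_add, Finset.mul_sum, h1, h2]
      ring
    have hind : IndepFun (fun ω (k : s) => e k ω) (e n) μ := by
      have := h.indep.indepFun_finset s {n} (by simpa using hn) h.meas
      exact this.comp (φ := id) (ψ := fun x : ({n} : Finset κ) → ℝ => x ⟨n, by simp⟩)
        measurable_id (by fun_prop)
    have hsm : AEMeasurable (fun ω (k : s) => e k ω) μ :=
      (measurable_pi_iff.2 fun k : s => h.meas k).aemeasurable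
    have hmn : AEMeasurable (e n) μ := (h.meas n).aemeasurable
    let Q : (s → ℝ) → ℝ := fun x => ∑ k : s, ∑ l : s, A k l * (x k * x l) - v * ∑ k ∈ s, A k k
    let Λ : (s → ℝ) → ℝ := fun x => ∑ k : s, (A k n + A n k) * x k
    have hQ : ∀ ω, q ω = Q fun k => e k ω := by
      intro ω
      simp only [hqdef, Q]
      rw [← Finset.sum_coe_sort s]
      simp_rw [← Finset.sum_coe_sort s (fun l => A _ l * (e _ ω * e l ω))]
    have hΛ : ∀ ω, ℓ ω = Λ fun k => e k ω := by
      intro ω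
      simp only [hℓ, Λ]
      rw [← Finset.sum_coe_sort s]
    have hQm : Measurable Q := by fun_prop
    have hΛm : Measurable Λ := by fun_prop
    have hℓL := h.integral_linear_sq (fun k => if k ∈ s then A k n + A n k else 0)
    simp_rw [← hℓ2] at hℓL
    have hℓm : Measurable ℓ := by
      have := h.meas
      simp only [hℓ]; fun_prop
    have hn2 : MemLp (fun ω => e n ω ^ 2 - v) 2 μ := by
      simp_rw [pow_two]
      exact (he2 n n).sub (memLp_const v)
    have hnℓ : MemLp (fun ω => e n ω * ℓ ω) 2 μ := by
      have : MemLp (fun ω => ∑ k ∈ s, (A k n + A n k) * (e n ω * e k ω)) 2 μ :=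
        memLp_finsetSum _ fun k _ => (he2 n k).const_mul _
      refine this.ae_eq (Eventually.of_forall fun ω => ?_)
      simp only [hℓ, Finset.mul_sum]
      exact Finset.sum_congr rfl fun k _ => by ring
    have hcross1 : ∫ ω, q ω * (e n ω * ℓ ω) ∂μ = 0 := by
      have h1 := hind.integral_fun_comp_mul_comp (f := fun x => Q x * Λ x) (g := fun y : ℝ => y)
        hsm hmn (by fun_prop) (by fun_prop)
      have h2 : ∀ ω, q ω * (e n ω * ℓ ω) = Q (fun k => e k ω) * Λ (fun k => e k ω) * e n ω :=
        fun ω => by rw [← hQ, ← hΛ]; ring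
      simp_rw [h2]
      rw [h1, h.mean n, mul_zero]
    have hcross2 : ∫ ω, q ω * (e n ω ^ 2 - v) ∂μ = 0 := by
      have h1 := hind.integral_fun_comp_mul_comp (f := fun x => Q x) (g := fun y : ℝ => y ^ 2 - v)
        hsm hmn (by fun_prop) (by fun_prop)
      simp_rw [hQ]
      rw [h1, integral_sub ((h.memLp n).mono_exponent (by norm_num)).integrable_sq
        (integrable_const _), h.sq n]
      simp
    have hℓsq : ∫ ω, (e n ω * ℓ ω) ^ 2 ∂μ = v * (v * ∑ k ∈ s, (A k n + A n k) ^ 2) := by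
      have h1 := hind.integral_fun_comp_mul_comp (f := fun x => Λ x ^ 2) (g := fun y : ℝ => y ^ 2)
        hsm hmn (by fun_prop) (by fun_prop)
      simp_rw [← hΛ] at h1
      simp_rw [mul_pow, mul_comm (e n _ ^ 2)]
      rw [h1, h.sq n, hℓL.2, mul_comm]
      simp [ite_pow, Finset.sum_ite_mem]
    have hv0 := h.sq_nonneg' n
    have hvw := h.sq_le n
    have hnsq : ∫ ω, (e n ω ^ 2 - v) ^ 2 ∂μ ≤ w := by
      have h1 : ∀ ω, (e n ω ^ 2 - v) ^ 2 = (e n ω * e n ω) ^ 2 - 2 * v * e n ω ^ 2 + v ^ 2 :=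
        fun ω => by ring
      have i1 := (he2 n n).integrable_sq
      have i2 : Integrable (fun ω => 2 * v * e n ω ^ 2) μ :=
        ((h.memLp n).mono_exponent (by norm_num)).integrable_sq.const_mul _
      have i3 : Integrable (fun ω => (e n ω * e n ω) ^ 2 - 2 * v * e n ω ^ 2) μ := i1.sub i2
      simp_rw [h1]
      rw [integral_add i3 (integrable_const _), integral_sub i1 i2, integral_const_mul, h.sq n]
      have h2 := h.four n
      have h3 : ∀ ω, (e n ω * e n ω) ^ 2 = e n ω ^ 4 := fun ω => by ring
      simp_rw [h3]
      simp only [integral_const, probReal_univ, smul_eq_mul, one_mul]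
      nlinarith
    set D : Ω → ℝ := fun ω => e n ω * ℓ ω + A n n * (e n ω ^ 2 - v) with hD
    have hD2 : MemLp D 2 μ := hnℓ.add (hn2.const_mul _)
    have hDsq : ∫ ω, D ω ^ 2 ∂μ ≤ 2 * (v * (v * ∑ k ∈ s, (A k n + A n k) ^ 2)) + 2 * A n n ^ 2 * w := by
      calc ∫ ω, D ω ^ 2 ∂μ
          ≤ ∫ ω, (2 * (e n ω * ℓ ω) ^ 2 + 2 * A n n ^ 2 * (e n ω ^ 2 - v) ^ 2) ∂μ := by
            refine integral_mono hD2.integrable_sq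
              ((hnℓ.integrable_sq.const_mul _).add (hn2.integrable_sq.const_mul _)) fun ω => ?_
            simp only [hD]
            nlinarith [sq_nonneg (e n ω * ℓ ω - A n n * (e n ω ^ 2 - v))]
        _ ≤ _ := by
            rw [integral_add (hnℓ.integrable_sq.const_mul _) (hn2.integrable_sq.const_mul _),
              integral_const_mul, integral_const_mul, hℓsq]
            gcongr
    have hsum : ∫ ω, (q ω + D ω) ^ 2 ∂μ = ∫ ω, q ω ^ 2 ∂μ + ∫ ω, D ω ^ 2 ∂μ := by
      have h1 : ∀ ω, (q ω + D ω) ^ 2 = q ω ^ 2 + D ω ^ 2 +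
          (2 * (q ω * (e n ω * ℓ ω)) + 2 * A n n * (q ω * (e n ω ^ 2 - v))) :=
        fun ω => by simp only [hD]; ring
      simp_rw [h1]
      have i1 : Integrable (fun ω => q ω ^ 2) μ := (hq s).integrable_sq
      have i2 := hD2.integrable_sq
      have i12 : Integrable (fun ω => q ω ^ 2 + D ω ^ 2) μ := i1.add i2
      have i3 : Integrable (fun ω => 2 * (q ω * (e n ω * ℓ ω))) μ :=
        ((hq s).integrable_mul hnℓ).const_mul 2
      have i4 : Integrable (fun ω => 2 * A n n * (q ω * (e n ω ^ 2 - v))) μ :=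
        ((hq s).integrable_mul hn2).const_mul _
      have i34 : Integrable (fun ω => 2 * (q ω * (e n ω * ℓ ω)) +
          2 * A n n * (q ω * (e n ω ^ 2 - v))) μ := i3.add i4
      rw [integral_add i12 i34, integral_add i1 i2, integral_add i3 i4,
        integral_const_mul, integral_const_mul, hcross1, hcross2]
      simp
    simp_rw [hexp]
    rw [hsum]
    have hfin : ∑ k ∈ insert n s, ∑ l ∈ insert n s, A k l ^ 2 =
        ∑ k ∈ s, ∑ l ∈ s, A k l ^ 2 + (A n n ^ 2 + (∑ k ∈ s, A n k ^ 2 + ∑ k ∈ s, A k n ^ 2)) := by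
      simp only [Finset.sum_insert hn, Finset.sum_add_distrib]; ring
    have hsq : ∑ k ∈ s, (A k n + A n k) ^ 2 ≤ 2 * (∑ k ∈ s, A n k ^ 2 + ∑ k ∈ s, A k n ^ 2) := by
      rw [← Finset.sum_add_distrib, Finset.mul_sum]
      exact Finset.sum_le_sum fun k _ => by nlinarith [sq_nonneg (A k n - A n k)]
    rw [hfin]
    have hw0 : 0 ≤ w := (sq_nonneg v).trans hvw
    have h5 : v * (v * ∑ k ∈ s, (A k n + A n k) ^ 2) ≤
        w * (2 * (∑ k ∈ s, A n k ^ 2 + ∑ k ∈ s, A k n ^ 2)) := by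
      rw [← mul_assoc, ← pow_two]
      exact mul_le_mul hvw hsq (Finset.sum_nonneg fun _ _ => sq_nonneg _) hw0
    have h6 : 0 ≤ A n n ^ 2 * w := by positivity
    linarith

end Moments

/-! ### Averaging operators and families of vectors indexed by time -/

theorem sum_abs_rowNormalize_le {N : ℕ} {A : Fin N → Fin N → ℝ} (hA : ∀ i k, 0 ≤ A i k)
    (i : Fin N) : ∑ k, |rowNormalize A i k| ≤ 1 := by
  have h0 : 0 ≤ ∑ l, A i l := Finset.sum_nonneg fun l _ => hA i l
  have : ∀ k, |rowNormalize A i k| = A i k / ∑ l, A i l := fun k =>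
    abs_of_nonneg (div_nonneg (hA i k) h0)
  simp_rw [this]
  rw [← Finset.sum_div]
  exact div_self_le_one _

theorem sum_abs_colNormalize_le {N : ℕ} {A : Fin N → Fin N → ℝ} (hA : ∀ k j, 0 ≤ A k j)
    (j : Fin N) : ∑ k, |colNormalize A k j| ≤ 1 :=
  sum_abs_rowNormalize_le (A := fun i k => A k i) (fun i k => hA k i) j

/-- Averaging with weights of total mass at most one does not increase a supremum of norms. The
space is left general because the network lags act on time sequences, on coefficient vectors and on
L². -/
theorem norm_sum_smul_le {ι E : Type*} [Fintype ι] [SeminormedAddCommGroup E] [NormedSpace ℝ E]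
    {c : ι → ℝ} (hc : ∑ k, |c k| ≤ 1) {y : ι → E} {B : ℝ} (hB : 0 ≤ B) (hy : ∀ k, ‖y k‖ ≤ B) :
    ‖∑ k, c k • y k‖ ≤ B := by
  calc ‖∑ k, c k • y k‖ ≤ ∑ k, |c k| * B := by
        refine (norm_sum_le _ _).trans (Finset.sum_le_sum fun k _ => ?_)
        rw [norm_smul, Real.norm_eq_abs]
        gcongr
        exact hy k
    _ ≤ B := by
        rw [← Finset.sum_mul]
        exact mul_le_of_le_one_left hB hc

/-- If the vectors `f t` have norm at most `ρ` and are supported on disjoint blocks of coordinates,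
then `e ↦ (⟪f t, e⟫)_t` has operator norm at most `ρ`. -/
theorem sum_inner_sq_le_of_block {ι : Type*} [Fintype ι] {f : ℕ → EuclideanSpace ℝ ι} {b : ι → ℕ}
    (hf : ∀ t k, b k ≠ t → f t k = 0) {ρ : ℝ} (hρ : ∀ t, ‖f t‖ ^ 2 ≤ ρ) (e : EuclideanSpace ℝ ι)
    (s : Finset ℕ) : ∑ t ∈ s, ⟪f t, e⟫_ℝ ^ 2 ≤ ρ * ‖e‖ ^ 2 := by
  have h1 : ∀ t, ⟪f t, e⟫_ℝ ^ 2 ≤ ρ * ∑ k, if b k = t then e k ^ 2 else 0 := by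
    intro t
    have h2 : ⟪f t, e⟫_ℝ = ∑ k, f t k * (if b k = t then e k else 0) := by
      simp only [PiLp.inner_apply, RCLike.inner_apply, conj_trivial]
      refine Finset.sum_congr rfl fun k _ => ?_
      split_ifs with hk
      · ring
      · simp [hf t k hk]
    rw [h2]
    refine (Finset.sum_mul_sq_le_sq_mul_sq _ _ _).trans ?_
    rw [← EuclideanSpace.real_norm_sq_eq]
    refine mul_le_mul (hρ t) (le_of_eq ?_) (Finset.sum_nonneg fun k _ => sq_nonneg _)
      ((sq_nonneg _).trans (hρ t))
    exact Finset.sum_congr rfl fun k _ => by split_ifs <;> simp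
  calc ∑ t ∈ s, ⟪f t, e⟫_ℝ ^ 2 ≤ ∑ t ∈ s, ρ * ∑ k, (if b k = t then e k ^ 2 else 0) :=
        Finset.sum_le_sum fun t _ => h1 t
    _ = ρ * ∑ k, ∑ t ∈ s, (if b k = t then e k ^ 2 else 0) := by
        rw [← Finset.mul_sum, Finset.sum_comm]
    _ ≤ ρ * ‖e‖ ^ 2 := by
        rw [EuclideanSpace.real_norm_sq_eq]
        refine mul_le_mul_of_nonneg_left (Finset.sum_le_sum fun k _ => ?_)
          ((sq_nonneg _).trans (hρ 0))
        rw [Finset.sum_ite_eq]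
        split_ifs
        exacts [le_rfl, sq_nonneg _]

/-- The first `s` values of a sequence, as a Euclidean vector. -/
def initial (s : ℕ) (φ : ℕ → ℝ) : EuclideanSpace ℝ (Fin s) := WithLp.toLp 2 fun t => φ t

theorem norm_initial_sq (s : ℕ) (φ : ℕ → ℝ) :
    ‖initial s φ‖ ^ 2 = ∑ t ∈ Finset.range s, φ t ^ 2 := by
  rw [EuclideanSpace.real_norm_sq_eq, Finset.sum_range]; rfl

theorem norm_initial_le_iff {s : ℕ} {φ : ℕ → ℝ} {B : ℝ} (hB : 0 ≤ B) :
    ‖initial s φ‖ ≤ B ↔ ∑ t ∈ Finset.range s, φ t ^ 2 ≤ B ^ 2 := by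
  rw [← norm_initial_sq, sq_le_sq₀ (norm_nonneg _) hB]

/-- `initial` as a linear map. -/
def initialₗ (s : ℕ) : (ℕ → ℝ) →ₗ[ℝ] EuclideanSpace ℝ (Fin s) where
  toFun := initial s
  map_add' _ _ := rfl
  map_smul' _ _ := rfl

/-! ### The autoregression as a recursion in an arbitrary module -/

namespace Setting

variable (S : Setting.{u})

section Module

variable {E F : Type*} [AddCommGroup E] [Module ℝ E] [AddCommGroup F] [Module ℝ F]

/-- Row network lag of an array. -/
def rowLag (y : Fin S.N₁ → Fin S.N₂ → E) (i : Fin S.N₁) (j : Fin S.N₂) : E :=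
  ∑ k, rowNormalize S.A₁ i k • y k j

/-- Column network lag of an array. -/
def colLag (y : Fin S.N₁ → Fin S.N₂ → E) (i : Fin S.N₁) (j : Fin S.N₂) : E :=
  ∑ k, colNormalize S.A₂ k j • y i k

/-- Autoregressive part of the model equation. -/
def step (y : Fin S.N₁ → Fin S.N₂ → E) (i : Fin S.N₁) (j : Fin S.N₂) : E :=
  S.θ₀.par.lam (S.θ₀.g i) • S.rowLag y i j + S.θ₀.par.gam (S.θ₀.h j) • S.colLag y i j
    + S.θ₀.par.alpha (S.θ₀.g i) (S.θ₀.h j) • y i j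

/-- Solution of the autoregression with initial value `y₀` and forcing terms `f`. -/
def path (y₀ : Fin S.N₁ → Fin S.N₂ → E) (f : ℕ → Fin S.N₁ → Fin S.N₂ → E) :
    ℕ → Fin S.N₁ → Fin S.N₂ → E
  | 0 => y₀
  | t + 1 => fun i j => S.step (path y₀ f t) i j + f (t + 1) i j

/-- The regressors built from a lagged array and covariates. -/
def features (y : Fin S.N₁ → Fin S.N₂ → E) (a : Fin S.p₁ → E) (b : Fin S.p₂ → E)
    (i : Fin S.N₁) (j : Fin S.N₂) : Coord S.p₁ S.p₂ → E :=
  Sum.elim (Sum.elim (fun _ => S.rowLag y i j) a)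
    (Sum.elim (Sum.elim (fun _ => S.colLag y i j) b) (fun _ => y i j))

/-- Linear maps commute with the lags, the recursion and the features. This moves identities and
bounds between coefficient vectors, their pairings with a test vector, square integrable functions
and their L² classes. -/
theorem map_rowLag (f : E →ₗ[ℝ] F) (y : Fin S.N₁ → Fin S.N₂ → E) (i : Fin S.N₁) (j : Fin S.N₂) :
    f (S.rowLag y i j) = S.rowLag (fun k l => f (y k l)) i j := by
  simp [rowLag]

theorem map_colLag (f : E →ₗ[ℝ] F) (y : Fin S.N₁ → Fin S.N₂ → E) (i : Fin S.N₁) (j : Fin S.N₂) :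
    f (S.colLag y i j) = S.colLag (fun k l => f (y k l)) i j := by
  simp [colLag]

theorem map_step (f : E →ₗ[ℝ] F) (y : Fin S.N₁ → Fin S.N₂ → E) (i : Fin S.N₁) (j : Fin S.N₂) :
    f (S.step y i j) = S.step (fun k l => f (y k l)) i j := by
  simp [step, map_rowLag, map_colLag]

theorem map_path (f : E →ₗ[ℝ] F) (y₀ : Fin S.N₁ → Fin S.N₂ → E)
    (g : ℕ → Fin S.N₁ → Fin S.N₂ → E) (t : ℕ) (i : Fin S.N₁) (j : Fin S.N₂) :
    f (S.path y₀ g t i j) = S.path (fun k l => f (y₀ k l)) (fun s k l => f (g s k l)) t i j := by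
  induction t generalizing i j with
  | zero => rfl
  | succ t ih => simp only [path, map_add, map_step, ih]

theorem map_features (f : E →ₗ[ℝ] F) (y : Fin S.N₁ → Fin S.N₂ → E) (a : Fin S.p₁ → E)
    (b : Fin S.p₂ → E) (i : Fin S.N₁) (j : Fin S.N₂) (c : Coord S.p₁ S.p₂) :
    f (S.features y a b i j c) =
      S.features (fun k l => f (y k l)) (fun q => f (a q)) (fun q => f (b q)) i j c := by
  rcases c with (_ | _) | (_ | _) | _ <;> simp [features, map_rowLag, map_colLag]

theorem rowLag_add (y y' : Fin S.N₁ → Fin S.N₂ → E) (i : Fin S.N₁) (j : Fin S.N₂) :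
    S.rowLag (fun k l => y k l + y' k l) i j = S.rowLag y i j + S.rowLag y' i j := by
  simp [rowLag, Finset.sum_add_distrib]

theorem colLag_add (y y' : Fin S.N₁ → Fin S.N₂ → E) (i : Fin S.N₁) (j : Fin S.N₂) :
    S.colLag (fun k l => y k l + y' k l) i j = S.colLag y i j + S.colLag y' i j := by
  simp [colLag, Finset.sum_add_distrib]

theorem step_add (y y' : Fin S.N₁ → Fin S.N₂ → E) (i : Fin S.N₁) (j : Fin S.N₂) :
    S.step (fun k l => y k l + y' k l) i j = S.step y i j + S.step y' i j := by
  simp only [step, rowLag_add, colLag_add, smul_add]; abel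

end Module

section Normed

variable {S}
variable {E : Type*} [SeminormedAddCommGroup E] [NormedSpace ℝ E]

theorem IsModel.norm_rowLag_le (hS : S.IsModel) {y : Fin S.N₁ → Fin S.N₂ → E} {B : ℝ} (hB : 0 ≤ B)
    (hy : ∀ k l, ‖y k l‖ ≤ B) (i : Fin S.N₁) (j : Fin S.N₂) : ‖S.rowLag y i j‖ ≤ B :=
  norm_sum_smul_le (sum_abs_rowNormalize_le hS.A₁_nonneg i) hB fun k => hy k j

theorem IsModel.norm_colLag_le (hS : S.IsModel) {y : Fin S.N₁ → Fin S.N₂ → E} {B : ℝ} (hB : 0 ≤ B)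
    (hy : ∀ k l, ‖y k l‖ ≤ B) (i : Fin S.N₁) (j : Fin S.N₂) : ‖S.colLag y i j‖ ≤ B :=
  norm_sum_smul_le (sum_abs_colNormalize_le hS.A₂_nonneg j) hB fun k => hy i k

theorem IsModel.norm_step_le (hS : S.IsModel) {κ : ℝ} (hκ : S.Stationarity κ)
    {y : Fin S.N₁ → Fin S.N₂ → E} {B : ℝ} (hB : 0 ≤ B)
    (hy : ∀ k l, ‖y k l‖ ≤ B) (i : Fin S.N₁) (j : Fin S.N₂) : ‖S.step y i j‖ ≤ κ * B := by
  have h1 := hκ (S.θ₀.g i) (S.θ₀.h j)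
  calc ‖S.step y i j‖ ≤ |S.θ₀.par.lam (S.θ₀.g i)| * B + |S.θ₀.par.gam (S.θ₀.h j)| * B
        + |S.θ₀.par.alpha (S.θ₀.g i) (S.θ₀.h j)| * B := by
        refine (norm_add₃_le).trans ?_
        simp only [norm_smul, Real.norm_eq_abs]
        gcongr
        exacts [hS.norm_rowLag_le hB hy i j, hS.norm_colLag_le hB hy i j, hy i j]
    _ ≤ κ * B := by rw [← add_mul, ← add_mul]; gcongr

end Normed

section SquareSums

variable {S}

/-- The first `s` values at a node form a vector of ℝ^s, and the lag averages such vectors over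
nodes; the general norm bound applies. -/
theorem IsModel.sum_rowLag_sq_le (hS : S.IsModel) {y : ℕ → Fin S.N₁ → Fin S.N₂ → ℝ} {B : ℝ}
    (hB : 0 ≤ B) {s : ℕ} (hy : ∀ k l, ∑ t ∈ Finset.range s, y t k l ^ 2 ≤ B ^ 2)
    (i : Fin S.N₁) (j : Fin S.N₂) : ∑ t ∈ Finset.range s, S.rowLag (y t) i j ^ 2 ≤ B ^ 2 := by
  rw [← norm_initial_le_iff hB (φ := fun t => S.rowLag (y t) i j)]
  have h1 : initial s (fun t => S.rowLag (y t) i j) =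
      S.rowLag (fun k l => initial s fun t => y t k l) i j := by
    rw [show initial s (fun t => S.rowLag (y t) i j) =
      initialₗ s (S.rowLag (fun k l t => y t k l) i j) from ?_, map_rowLag]
    · rfl
    · change initial s _ = initial s _
      congr 1; ext t; simp [rowLag]
  rw [h1]
  exact hS.norm_rowLag_le hB (fun k l => (norm_initial_le_iff hB).2 (hy k l)) i j

theorem IsModel.sum_colLag_sq_le (hS : S.IsModel) {y : ℕ → Fin S.N₁ → Fin S.N₂ → ℝ} {B : ℝ}
    (hB : 0 ≤ B) {s : ℕ} (hy : ∀ k l, ∑ t ∈ Finset.range s, y t k l ^ 2 ≤ B ^ 2)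
    (i : Fin S.N₁) (j : Fin S.N₂) : ∑ t ∈ Finset.range s, S.colLag (y t) i j ^ 2 ≤ B ^ 2 := by
  rw [← norm_initial_le_iff hB (φ := fun t => S.colLag (y t) i j)]
  have h1 : initial s (fun t => S.colLag (y t) i j) =
      S.colLag (fun k l => initial s fun t => y t k l) i j := by
    rw [show initial s (fun t => S.colLag (y t) i j) =
      initialₗ s (S.colLag (fun k l t => y t k l) i j) from ?_, map_colLag]
    · rfl
    · change initial s _ = initial s _
      congr 1; ext t; simp [colLag]
  rw [h1]
  exact hS.norm_colLag_le hB (fun k l => (norm_initial_le_iff hB).2 (hy k l)) i j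

/-- The autoregression maps square summable forcing terms to square summable solutions. -/
theorem IsModel.sum_path_sq_le (hS : S.IsModel) {κ : ℝ} (hκ : S.Stationarity κ) (hκ1 : κ < 1)
    {g : ℕ → Fin S.N₁ → Fin S.N₂ → ℝ} {r : ℝ} (hr : 0 ≤ r)
    (hg : ∀ s i j, ∑ t ∈ Finset.range s, g (t + 1) i j ^ 2 ≤ r ^ 2) (s : ℕ)
    (i : Fin S.N₁) (j : Fin S.N₂) :
    ∑ t ∈ Finset.range s, S.path (fun _ _ => 0) g t i j ^ 2 ≤ (r / (1 - κ)) ^ 2 := by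
  have hκ' : 0 < 1 - κ := by linarith
  have hB : 0 ≤ r / (1 - κ) := by positivity
  induction s generalizing i j with
  | zero => simpa using sq_nonneg _
  | succ s ih =>
    -- The path starts at zero, so the zeroth term drops out and the shifted sequence is one step
    -- applied to the previous `s` values plus the forcing. The bound B = r/(1 − κ) is the fixed
    -- point of B ↦ κB + r.
    rw [Finset.sum_range_succ']
    simp only [path, ne_eq, OfNat.ofNat_ne_zero, not_false_eq_true, zero_pow, add_zero]
    rw [← norm_initial_le_iff hB
      (φ := fun t => S.step (S.path (fun _ _ => 0) g t) i j + g (t + 1) i j)]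
    have h1 : initial s (fun t => S.step (S.path (fun _ _ => 0) g t) i j + g (t + 1) i j) =
        S.step (fun k l => initial s fun t => S.path (fun _ _ => 0) g t k l) i j +
          initial s fun t => g (t + 1) i j := by
      have h2 : initialₗ s (S.step (fun k l t => S.path (fun _ _ => 0) g t k l) i j) =
        S.step (fun k l => initial s fun t => S.path (fun _ _ => 0) g t k l) i j := by
        rw [map_step]; rfl
      rw [← h2]
      change _ = initial s _ + initial s _
      ext t
      simp [initial, step, rowLag, colLag]
    rw [h1]
    refine (norm_add_le _ _).trans ?_
    have h3 := hS.norm_step_le hκ hB (fun k l => (norm_initial_le_iff hB).2 (ih k l)) i j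
    have h4 := (norm_initial_le_iff (φ := fun t => g (t + 1) i j) hr).2 (hg s i j)
    have h5 : κ * (r / (1 - κ)) + r = r / (1 - κ) := by field_simp; ring
    linarith

end SquareSums

end Setting

/-! ### Coefficient vectors and the decomposition of the regressors -/

/-- Indicator of the three lag coordinates. -/
def lagWeight {p₁ p₂ : ℕ} : Coord p₁ p₂ → ℝ :=
  Sum.elim (Sum.elim (fun _ => 1) (fun _ => 0)) (Sum.elim (Sum.elim (fun _ => 1) (fun _ => 0)) (fun _ => 1))

theorem lagWeight_nonneg {p₁ p₂ : ℕ} (a : Coord p₁ p₂) : 0 ≤ lagWeight a := by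
  rcases a with (_ | _) | (_ | _) | _ <;> simp [lagWeight]

theorem sum_lagWeight {p₁ p₂ : ℕ} : ∑ a : Coord p₁ p₂, lagWeight a = 3 := by
  simp [lagWeight]; norm_num

namespace Setting

variable (S : Setting.{u})

theorem card_coord : Fintype.card (Coord S.p₁ S.p₂) = S.m := by
  simp [m]; ring

/-- Indices of the stacked covariates. -/
abbrev CovIndex : Type := Fin (S.T + 1) × ((Fin S.N₁ × Fin S.p₁) ⊕ (Fin S.N₂ × Fin S.p₂))

/-- Indices of the stacked noise. -/
abbrev NoiseIndex : Type := Fin S.T × Fin S.N₁ × Fin S.N₂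

/-- Coefficient vector of the linear functional `x_itᵀ a + z_jtᵀ b` of the covariates. -/
def covVec (t : ℕ) (i : Fin S.N₁) (j : Fin S.N₂) (a : Fin S.p₁ → ℝ) (b : Fin S.p₂ → ℝ) :
    EuclideanSpace ℝ S.CovIndex :=
  WithLp.toLp 2 fun k => if (k.1 : ℕ) = t then
    Sum.elim (fun q => if q.1 = i then a q.2 else 0) (fun q => if q.1 = j then b q.2 else 0) k.2
    else 0

/-- Only an inequality: `t` is unrestricted and the vector vanishes beyond `S.T`. Later bounds can
then run over all of ℕ. -/
theorem norm_covVec_sq_le (t : ℕ) (i : Fin S.N₁) (j : Fin S.N₂) (a : Fin S.p₁ → ℝ)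
    (b : Fin S.p₂ → ℝ) : ‖S.covVec t i j a b‖ ^ 2 ≤ ∑ q, a q ^ 2 + ∑ q, b q ^ 2 := by
  have h0 : 0 ≤ ∑ q, a q ^ 2 + ∑ q, b q ^ 2 := by positivity
  rw [EuclideanSpace.real_norm_sq_eq]
  simp only [covVec, Fintype.sum_prod_type, Fintype.sum_sum_type, Sum.elim_inl, Sum.elim_inr]
  have h1 : ∀ k : Fin (S.T + 1), (∑ x : Fin S.N₁, ∑ y : Fin S.p₁,
      (if (k : ℕ) = t then if x = i then a y else 0 else 0) ^ 2 + ∑ x : Fin S.N₂, ∑ y : Fin S.p₂,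
      (if (k : ℕ) = t then if x = j then b y else 0 else 0) ^ 2) =
      if (k : ℕ) = t then ∑ q, a q ^ 2 + ∑ q, b q ^ 2 else 0 := by
    intro k
    split_ifs with hk
    · simp only [ite_pow, ne_eq, OfNat.ofNat_ne_zero, not_false_eq_true, zero_pow]
      congr 1 <;> rw [Finset.sum_comm] <;> simp
    · simp
  simp_rw [h1]
  by_cases ht : t < S.T + 1
  · rw [Finset.sum_eq_single ⟨t, ht⟩]
    · simp
    · intro k _ hk
      rw [if_neg]
      intro h; exact hk (Fin.ext h)
    · simp
  · rw [Finset.sum_eq_zero]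
    · exact h0
    · intro k _
      rw [if_neg]
      intro h; exact ht (h ▸ k.2)

theorem inner_covVec {t : ℕ} (ht : t ≤ S.T) (i : Fin S.N₁) (j : Fin S.N₂) (a : Fin S.p₁ → ℝ)
    (b : Fin S.p₂ → ℝ) (ω : S.Ω) : ⟪S.covVec t i j a b, S.covariateVector ω⟫_ℝ =
      ∑ q, S.x t ω i q * a q + ∑ q, S.z t ω j q * b q := by
  simp only [PiLp.inner_apply, RCLike.inner_apply, conj_trivial, covVec, covariateVector,
    Fintype.sum_prod_type, Fintype.sum_sum_type, Sum.elim_inl, Sum.elim_inr]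
  rw [Finset.sum_eq_single (⟨t, by omega⟩ : Fin (S.T + 1))]
  · simp only [if_true, mul_ite, mul_zero]
    congr 1 <;> rw [Finset.sum_comm] <;> simp
  · intro k _ hk
    have : (k : ℕ) ≠ t := fun h => hk (Fin.ext h)
    simp [this]
  · simp

theorem covVec_add (t : ℕ) (i : Fin S.N₁) (j : Fin S.N₂) (a a' : Fin S.p₁ → ℝ)
    (b b' : Fin S.p₂ → ℝ) :
    S.covVec t i j (a + a') (b + b') = S.covVec t i j a b + S.covVec t i j a' b' := by
  ext k
  rcases k with ⟨k, q | q⟩ <;> simp only [covVec, PiLp.add_apply, Sum.elim_inl, Sum.elim_inr] <;>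
    split_ifs <;> simp

theorem covVec_smul (t : ℕ) (i : Fin S.N₁) (j : Fin S.N₂) (c : ℝ) (a : Fin S.p₁ → ℝ)
    (b : Fin S.p₂ → ℝ) : S.covVec t i j (c • a) (c • b) = c • S.covVec t i j a b := by
  ext k
  rcases k with ⟨k, q | q⟩ <;> simp only [covVec, PiLp.smul_apply, Sum.elim_inl, Sum.elim_inr] <;>
    split_ifs <;> simp

/-- `covVec` as a linear map. -/
def covVecₗ (t : ℕ) (i : Fin S.N₁) (j : Fin S.N₂) :
    ((Fin S.p₁ → ℝ) × (Fin S.p₂ → ℝ)) →ₗ[ℝ] EuclideanSpace ℝ S.CovIndex where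
  toFun p := S.covVec t i j p.1 p.2
  map_add' p q := S.covVec_add t i j p.1 q.1 p.2 q.2
  map_smul' c p := S.covVec_smul t i j c p.1 p.2

/-- Different times use disjoint blocks of covariates, so summing over time costs no factor
depending on its length. -/
theorem sum_inner_covVec_sq_le (i : Fin S.N₁) (j : Fin S.N₂) (a : Fin S.p₁ → ℝ) (b : Fin S.p₂ → ℝ)
    (e : EuclideanSpace ℝ S.CovIndex) (s : ℕ) :
    ∑ t ∈ Finset.range s, ⟪S.covVec (t + 1) i j a b, e⟫_ℝ ^ 2 ≤
      (∑ q, a q ^ 2 + ∑ q, b q ^ 2) * ‖e‖ ^ 2 := by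
  have h := sum_inner_sq_le_of_block (f := fun t => S.covVec t i j a b)
    (b := fun k : S.CovIndex => (k.1 : ℕ)) (fun t k hk => by simp [covVec, hk])
    (fun t => S.norm_covVec_sq_le t i j a b) e ((Finset.range s).image (· + 1))
  rwa [Finset.sum_image (by simp)] at h

/-- The stacked noise. -/
def noiseVector (ω : S.Ω) : EuclideanSpace ℝ S.NoiseIndex :=
  WithLp.toLp 2 fun k => S.ε (k.1 + 1) ω k.2.1 k.2.2

/-- Coefficient vector of `ε_ijt`. -/
def noiseVec (t : ℕ) (i : Fin S.N₁) (j : Fin S.N₂) : EuclideanSpace ℝ S.NoiseIndex :=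
  WithLp.toLp 2 fun k => if (k.1 : ℕ) + 1 = t then if k.2 = (i, j) then 1 else 0 else 0

theorem noiseVec_eq_single (t : ℕ) (ht : t < S.T) (i : Fin S.N₁) (j : Fin S.N₂) :
    S.noiseVec (t + 1) i j = EuclideanSpace.single ((⟨t, ht⟩, i, j) : S.NoiseIndex) (1 : ℝ) := by
  ext k
  rcases k with ⟨k, q⟩
  simp only [noiseVec, PiLp.single_apply, Prod.mk.injEq, Fin.ext_iff, add_left_inj]
  split_ifs <;> simp_all

theorem noiseVec_eq_zero (t : ℕ) (ht : ¬ t < S.T) (i : Fin S.N₁) (j : Fin S.N₂) :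
    S.noiseVec (t + 1) i j = 0 := by
  ext k
  have : (k.1 : ℕ) ≠ t := fun h => ht (h ▸ k.1.2)
  simp [noiseVec, this]

theorem inner_noiseVec {t : ℕ} (ht : t < S.T) (i : Fin S.N₁) (j : Fin S.N₂) (ω : S.Ω) :
    ⟪S.noiseVec (t + 1) i j, S.noiseVector ω⟫_ℝ = S.ε (t + 1) ω i j := by
  rw [S.noiseVec_eq_single t ht, EuclideanSpace.inner_single_left]
  simp [noiseVector]

theorem sum_inner_noiseVec_sq_le (i : Fin S.N₁) (j : Fin S.N₂)
    (e : EuclideanSpace ℝ S.NoiseIndex) (s : ℕ) :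
    ∑ t ∈ Finset.range s, ⟪S.noiseVec (t + 1) i j, e⟫_ℝ ^ 2 ≤ ‖e‖ ^ 2 := by
  have h := sum_inner_sq_le_of_block (f := fun t => S.noiseVec (t + 1) i j)
    (b := fun k : S.NoiseIndex => (k.1 : ℕ)) (fun t k hk => by simp [noiseVec, hk])
    (ρ := 1) (fun t => by
      by_cases ht : t < S.T
      · rw [S.noiseVec_eq_single t ht]; simp
      · rw [S.noiseVec_eq_zero t ht]; simp) e (Finset.range s)
  simpa using h

/-- Coefficients of the covariate-driven part of `Y_ijt`. -/
def covPath : ℕ → Fin S.N₁ → Fin S.N₂ → EuclideanSpace ℝ S.CovIndex :=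
  S.path (fun _ _ => 0) fun t i j =>
    S.covVec t i j (S.θ₀.par.zeta (S.θ₀.g i)) (S.θ₀.par.delta (S.θ₀.h j))

/-- Coefficients of the noise-driven part of `Y_ijt`. -/
def noisePath : ℕ → Fin S.N₁ → Fin S.N₂ → EuclideanSpace ℝ S.NoiseIndex :=
  S.path (fun _ _ => 0) S.noiseVec

/-- The part of `Y_ijt` that stems from the initial value. -/
def initPath (t : ℕ) (ω : S.Ω) : Fin S.N₁ → Fin S.N₂ → ℝ := S.path (S.Y 0 ω) (fun _ _ _ => 0) t

/-- Coefficients of the covariate-driven part of the regressor at time `t + 1`. -/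
def covFeature (t : ℕ) (i : Fin S.N₁) (j : Fin S.N₂) :
    Coord S.p₁ S.p₂ → EuclideanSpace ℝ S.CovIndex :=
  S.features (S.covPath t) (fun q => S.covVec (t + 1) i j (Pi.single q 1) 0)
    (fun q => S.covVec (t + 1) i j 0 (Pi.single q 1)) i j

/-- Coefficients of the noise-driven part of the regressor at time `t + 1`. -/
def noiseFeature (t : ℕ) (i : Fin S.N₁) (j : Fin S.N₂) :
    Coord S.p₁ S.p₂ → EuclideanSpace ℝ S.NoiseIndex :=
  S.features (S.noisePath t) (fun _ => 0) (fun _ => 0) i j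

/-- The part of the regressor at time `t + 1` that stems from the initial value. -/
def initFeature (t : ℕ) (ω : S.Ω) (i : Fin S.N₁) (j : Fin S.N₂) : Coord S.p₁ S.p₂ → ℝ :=
  S.features (S.initPath t ω) (fun _ => 0) (fun _ => 0) i j

theorem regressor_succ (t : ℕ) (ω : S.Ω) (i : Fin S.N₁) (j : Fin S.N₂) :
    S.regressor (t + 1) ω i j = S.features (S.Y t ω) (S.x (t + 1) ω i) (S.z (t + 1) ω j) i j := by
  simp [regressor, features, rowLag, colLag, mul_comm]

theorem fitted_succ (t : ℕ) (ω : S.Ω) (i : Fin S.N₁) (j : Fin S.N₂) :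
    S.fitted S.θ₀ (t + 1) ω i j = S.step (S.Y t ω) i j +
      (∑ q, S.x (t + 1) ω i q * S.θ₀.par.zeta (S.θ₀.g i) q +
        ∑ q, S.z (t + 1) ω j q * S.θ₀.par.delta (S.θ₀.h j) q) := by
  simp [fitted, step, rowLag, colLag, mul_comm, add_assoc]

/-- The functional `⟪·, e⟫`. -/
def innerLeft {E : Type*} [NormedAddCommGroup E] [InnerProductSpace ℝ E] (e : E) : E →ₗ[ℝ] ℝ :=
  (innerₗ E).flip e

@[simp] theorem innerLeft_apply {E : Type*} [NormedAddCommGroup E] [InnerProductSpace ℝ E]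
    (e x : E) : innerLeft e x = ⟪x, e⟫_ℝ := rfl

variable {S}

/-- Superposition for a linear recursion with three sources. The covariate and noise parts become
linear functionals with deterministic coefficients of the two stacked vectors; the initial part
stays random, as nothing is assumed about the law of `Y 0` beyond its second moments and its
independence from later noise. -/
theorem IsModel.ae_Y_eq (hS : S.IsModel) : ∀ᵐ ω ∂S.μ, ∀ t ≤ S.T, ∀ i j,
    S.Y t ω i j = ⟪S.covPath t i j, S.covariateVector ω⟫_ℝ +
      ⟪S.noisePath t i j, S.noiseVector ω⟫_ℝ + S.initPath t ω i j := by
  filter_upwards [hS.equation] with ω hω t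
  induction t with
  | zero => simp [covPath, noisePath, initPath, path]
  | succ t ih =>
    intro ht i j
    have ih' := ih (by omega)
    rw [hω (t + 1) (by simp; omega) i j, fitted_succ]
    have hY : S.Y t ω = fun k l => ⟪S.covPath t k l, S.covariateVector ω⟫_ℝ +
      ⟪S.noisePath t k l, S.noiseVector ω⟫_ℝ + S.initPath t ω k l := by
      ext k l; exact ih' k l
    have h1 : ⟪S.covPath (t + 1) i j, S.covariateVector ω⟫_ℝ =
        S.step (fun k l => ⟪S.covPath t k l, S.covariateVector ω⟫_ℝ) i j +
        (∑ q, S.x (t + 1) ω i q * S.θ₀.par.zeta (S.θ₀.g i) q +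
        ∑ q, S.z (t + 1) ω j q * S.θ₀.par.delta (S.θ₀.h j) q) := by
      rw [← S.inner_covVec ht]
      have := S.map_step (innerLeft (S.covariateVector ω)) (S.covPath t) i j
      simp only [innerLeft_apply] at this
      rw [← this, ← inner_add_left]
      rfl
    have h2 : ⟪S.noisePath (t + 1) i j, S.noiseVector ω⟫_ℝ =
        S.step (fun k l => ⟪S.noisePath t k l, S.noiseVector ω⟫_ℝ) i j + S.ε (t + 1) ω i j := by
      rw [← S.inner_noiseVec (by omega)]
      have := S.map_step (innerLeft (S.noiseVector ω)) (S.noisePath t) i j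
      simp only [innerLeft_apply] at this
      rw [← this, ← inner_add_left]
      rfl
    have h3 : S.initPath (t + 1) ω i j = S.step (S.initPath t ω) i j := by
      simp [initPath, path]
    rw [h1, h2, h3, hY, step_add, step_add]
    ring

theorem IsModel.ae_regressor_eq (hS : S.IsModel) : ∀ᵐ ω ∂S.μ, ∀ t < S.T, ∀ i j a,
    S.regressor (t + 1) ω i j a = ⟪S.covFeature t i j a, S.covariateVector ω⟫_ℝ +
      ⟪S.noiseFeature t i j a, S.noiseVector ω⟫_ℝ + S.initFeature t ω i j a := by
  filter_upwards [hS.ae_Y_eq] with ω hω t ht i j a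
  have hY : S.Y t ω = fun k l => ⟪S.covPath t k l, S.covariateVector ω⟫_ℝ +
      ⟪S.noisePath t k l, S.noiseVector ω⟫_ℝ + S.initPath t ω k l := by
    ext k l; exact hω t ht.le k l
  have h1 := S.map_features (innerLeft (S.covariateVector ω)) (S.covPath t)
    (fun q => S.covVec (t + 1) i j (Pi.single q 1) 0)
    (fun q => S.covVec (t + 1) i j 0 (Pi.single q 1)) i j a
  have h2 := S.map_features (innerLeft (S.noiseVector ω)) (S.noisePath t)
    (fun _ => 0) (fun _ => 0) i j a
  simp only [innerLeft_apply, S.inner_covVec (Nat.succ_le_of_lt ht)] at h1 h2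
  rw [regressor_succ, hY, covFeature, noiseFeature, h1, h2, initFeature]
  rcases a with (_ | q) | (_ | q) | _ <;>
    simp [features, rowLag_add, colLag_add, Pi.single_apply]

/-! ### Operator norm bounds for the coefficient families -/

section Bounds

variable {κ R : ℝ}

theorem ParameterSpace.sum_sq_le (hR : S.ParameterSpace R) (i : Fin S.N₁) (j : Fin S.N₂) :
    ∑ q, S.θ₀.par.zeta (S.θ₀.g i) q ^ 2 + ∑ q, S.θ₀.par.delta (S.θ₀.h j) q ^ 2 ≤ R ^ 2 * S.m := by
  have h1 : ∀ q, S.θ₀.par.zeta (S.θ₀.g i) q ^ 2 ≤ R ^ 2 := fun q =>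
    sq_le_sq' (by linarith [(abs_lt.1 (hR i j (Sum.inl (Sum.inr q)))).1, show S.θ₀.tensor i j (Sum.inl (Sum.inr q)) = S.θ₀.par.zeta (S.θ₀.g i) q from rfl])
      (abs_lt.1 (hR i j (Sum.inl (Sum.inr q)))).2.le
  have h2 : ∀ q, S.θ₀.par.delta (S.θ₀.h j) q ^ 2 ≤ R ^ 2 := fun q =>
    sq_le_sq' (by linarith [(abs_lt.1 (hR i j (Sum.inr (Sum.inl (Sum.inr q))))).1, show S.θ₀.tensor i j (Sum.inr (Sum.inl (Sum.inr q))) = S.θ₀.par.delta (S.θ₀.h j) q from rfl])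
      (abs_lt.1 (hR i j (Sum.inr (Sum.inl (Sum.inr q))))).2.le
  calc _ ≤ ∑ _q : Fin S.p₁, R ^ 2 + ∑ _q : Fin S.p₂, R ^ 2 :=
        add_le_add (Finset.sum_le_sum fun q _ => h1 q) (Finset.sum_le_sum fun q _ => h2 q)
    _ ≤ R ^ 2 * S.m := by
        simp only [Finset.sum_const, Finset.card_univ, Fintype.card_fin, nsmul_eq_mul, m]
        push_cast
        nlinarith [sq_nonneg R]

/-- Operator norm bound for the covariate-driven path. -/
theorem IsModel.sum_inner_covPath_sq_le (hS : S.IsModel) (hκ : S.Stationarity κ) (hκ1 : κ < 1)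
    (hR0 : 0 ≤ R) (hR : S.ParameterSpace R) (e : EuclideanSpace ℝ S.CovIndex) (s : ℕ)
    (i : Fin S.N₁) (j : Fin S.N₂) :
    ∑ t ∈ Finset.range s, ⟪S.covPath t i j, e⟫_ℝ ^ 2 ≤ (R * √S.m * ‖e‖ / (1 - κ)) ^ 2 := by
  have h := hS.sum_path_sq_le hκ hκ1 (g := fun t i j => ⟪S.covVec t i j
    (S.θ₀.par.zeta (S.θ₀.g i)) (S.θ₀.par.delta (S.θ₀.h j)), e⟫_ℝ) (r := R * √S.m * ‖e‖)
    (by positivity) (fun s i j => by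
      refine (S.sum_inner_covVec_sq_le i j _ _ e s).trans ?_
      rw [mul_pow, mul_pow, Real.sq_sqrt (Nat.cast_nonneg _)]
      gcongr
      exact hR.sum_sq_le i j) s i j
  refine le_trans (le_of_eq (Finset.sum_congr rfl fun t _ => ?_)) h
  have := S.map_path (innerLeft e) (fun _ _ => 0) (fun t i j => S.covVec t i j
    (S.θ₀.par.zeta (S.θ₀.g i)) (S.θ₀.par.delta (S.θ₀.h j))) t i j
  simp only [innerLeft_apply, inner_zero_left] at this
  rw [← this]; rfl

theorem IsModel.sum_inner_noisePath_sq_le (hS : S.IsModel) (hκ : S.Stationarity κ) (hκ1 : κ < 1)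
    (e : EuclideanSpace ℝ S.NoiseIndex) (s : ℕ) (i : Fin S.N₁) (j : Fin S.N₂) :
    ∑ t ∈ Finset.range s, ⟪S.noisePath t i j, e⟫_ℝ ^ 2 ≤ (‖e‖ / (1 - κ)) ^ 2 := by
  have h := hS.sum_path_sq_le hκ hκ1 (g := fun t i j => ⟪S.noiseVec t i j, e⟫_ℝ)
    (norm_nonneg e) (fun s i j => S.sum_inner_noiseVec_sq_le i j e s) s i j
  refine le_trans (le_of_eq (Finset.sum_congr rfl fun t _ => ?_)) h
  have := S.map_path (innerLeft e) (fun _ _ => 0) S.noiseVec t i j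
  simp only [innerLeft_apply, inner_zero_left] at this
  rw [← this]; rfl

end Bounds

end Setting

/-- Test with `e = f t` and keep a single term of the sum. -/
theorem norm_sq_le_of_sum_inner_sq_le {E : Type*} [NormedAddCommGroup E] [InnerProductSpace ℝ E]
    {f : ℕ → E} {c : ℝ} (hc : 0 ≤ c)
    (h : ∀ (e : E) (s : ℕ), ∑ t ∈ Finset.range s, ⟪f t, e⟫_ℝ ^ 2 ≤ c * ‖e‖ ^ 2)
    (t : ℕ) : ‖f t‖ ^ 2 ≤ c := by
  have h2 : ⟪f t, f t⟫_ℝ ^ 2 ≤ c * ‖f t‖ ^ 2 :=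
    (Finset.single_le_sum (f := fun s => ⟪f s, f t⟫_ℝ ^ 2) (fun s _ => sq_nonneg _)
      (Finset.self_mem_range_succ t)).trans (h (f t) (t + 1))
  rw [real_inner_self_eq_norm_sq] at h2
  rcases eq_or_lt_of_le (sq_nonneg ‖f t‖) with h0 | h0
  · rwa [← h0]
  · nlinarith

/-- The adjoint of `e ↦ (⟪f t, e⟫)_t` has the same operator norm. -/
theorem norm_sum_smul_sq_le {E : Type*} [NormedAddCommGroup E] [InnerProductSpace ℝ E]
    {f : ℕ → E} {c : ℝ} (hc : 0 ≤ c) {s : Finset ℕ}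
    (h : ∀ e : E, ∑ t ∈ s, ⟪f t, e⟫_ℝ ^ 2 ≤ c * ‖e‖ ^ 2) (φ : ℕ → ℝ) :
    ‖∑ t ∈ s, φ t • f t‖ ^ 2 ≤ c * ∑ t ∈ s, φ t ^ 2 := by
  set d := ∑ t ∈ s, φ t • f t with hd
  have h1 : ‖d‖ ^ 2 = ∑ t ∈ s, φ t * ⟪f t, d⟫_ℝ := by
    rw [← real_inner_self_eq_norm_sq]
    nth_rewrite 1 [hd]
    rw [sum_inner]
    simp only [real_inner_smul_left]
  -- Cauchy–Schwarz in time, then the hypothesis at the test vector `d` itself; dividing by ‖d‖²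
  -- gives the claim.
  have h2 : (‖d‖ ^ 2) ^ 2 ≤ (∑ t ∈ s, φ t ^ 2) * (c * ‖d‖ ^ 2) := by
    rw [h1]
    refine (Finset.sum_mul_sq_le_sq_mul_sq _ _ _).trans ?_
    rw [← h1]
    gcongr
    exact h d
  have h3 : 0 ≤ ∑ t ∈ s, φ t ^ 2 := Finset.sum_nonneg fun _ _ => sq_nonneg _
  rcases eq_or_lt_of_le (sq_nonneg ‖d‖) with h0 | h0
  · rw [← h0]; positivity
  · nlinarith

namespace Setting

variable {S : Setting.{u}} {κ R K : ℝ}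

/-- Covariate coordinates contain no noise and lag coordinates inherit the path bound. The factor
`lagWeight a` keeps sums over coordinates at 3 instead of m. -/
theorem IsModel.sum_inner_noiseFeature_sq_le (hS : S.IsModel) (hκ : S.Stationarity κ) (hκ1 : κ < 1)
    (i : Fin S.N₁) (j : Fin S.N₂) (a : Coord S.p₁ S.p₂)
    (e : EuclideanSpace ℝ S.NoiseIndex) (s : ℕ) :
    ∑ t ∈ Finset.range s, ⟪S.noiseFeature t i j a, e⟫_ℝ ^ 2 ≤
      lagWeight a * (1 - κ)⁻¹ ^ 2 * ‖e‖ ^ 2 := by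
  have hκ' : 0 < 1 - κ := by linarith
  have hB : 0 ≤ ‖e‖ / (1 - κ) := by positivity
  have h0 := fun k l => hS.sum_inner_noisePath_sq_le hκ hκ1 e s k l
  have h1 : ∀ t, ⟪S.noiseFeature t i j a, e⟫_ℝ =
      S.features (fun k l => ⟪S.noisePath t k l, e⟫_ℝ) (fun _ => 0) (fun _ => 0) i j a := by
    intro t
    have := S.map_features (innerLeft e) (S.noisePath t) (fun _ => 0) (fun _ => 0) i j a
    simp only [innerLeft_apply, inner_zero_left] at this
    exact this
  simp_rw [h1]
  have h2 : lagWeight a * (1 - κ)⁻¹ ^ 2 * ‖e‖ ^ 2 = lagWeight a * (‖e‖ / (1 - κ)) ^ 2 := by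
    rw [div_eq_mul_inv]; ring
  rw [h2]
  rcases a with (_ | q) | (_ | q) | _ <;> simp only [features, lagWeight, Sum.elim_inl, Sum.elim_inr,
    one_mul, zero_mul]
  · exact hS.sum_rowLag_sq_le hB h0 i j
  · simp
  · exact hS.sum_colLag_sq_le hB h0 i j
  · simp
  · exact h0 i j

theorem IsModel.norm_noiseFeature_sq_le (hS : S.IsModel) (hκ : S.Stationarity κ) (hκ1 : κ < 1)
    (t : ℕ) (i : Fin S.N₁) (j : Fin S.N₂) (a : Coord S.p₁ S.p₂) :
    ‖S.noiseFeature t i j a‖ ^ 2 ≤ lagWeight a * (1 - κ)⁻¹ ^ 2 :=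
  norm_sq_le_of_sum_inner_sq_le (f := fun t => S.noiseFeature t i j a)
    (mul_nonneg (lagWeight_nonneg a) (sq_nonneg _))
    (fun e s => hS.sum_inner_noiseFeature_sq_le hκ hκ1 i j a e s) t

variable (S) in
/-- Coefficients of the covariate-driven part of `𝒳_ij(t+1)ᵀ u`. -/
def covComb (t : ℕ) (i : Fin S.N₁) (j : Fin S.N₂) (u : Coord S.p₁ S.p₂ → ℝ) :
    EuclideanSpace ℝ S.CovIndex := ∑ a, u a • S.covFeature t i j a

/-- The covariate coordinates of `u` are merged into a single block vector, so that they are charged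
‖u‖² jointly rather than one by one. -/
theorem covComb_eq (t : ℕ) (i : Fin S.N₁) (j : Fin S.N₂) (u : Coord S.p₁ S.p₂ → ℝ) :
    S.covComb t i j u = u (Sum.inl (Sum.inl ())) • S.rowLag (S.covPath t) i j +
      u (Sum.inr (Sum.inl (Sum.inl ()))) • S.colLag (S.covPath t) i j +
      u (Sum.inr (Sum.inr ())) • S.covPath t i j +
      S.covVec (t + 1) i j (fun q => u (Sum.inl (Sum.inr q)))
        (fun q => u (Sum.inr (Sum.inl (Sum.inr q)))) := by
  have h1 : S.covVec (t + 1) i j (fun q => u (Sum.inl (Sum.inr q)))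
        (fun q => u (Sum.inr (Sum.inl (Sum.inr q)))) =
      ∑ q, u (Sum.inl (Sum.inr q)) • S.covVec (t + 1) i j (Pi.single q 1) 0 +
      ∑ q, u (Sum.inr (Sum.inl (Sum.inr q))) • S.covVec (t + 1) i j 0 (Pi.single q 1) := by
    have h2 := map_sum (S.covVecₗ (t + 1) i j)
      (fun q => u (Sum.inl (Sum.inr q)) • ((Pi.single q 1, 0) : (Fin S.p₁ → ℝ) × (Fin S.p₂ → ℝ)))
      Finset.univ
    have h3 := map_sum (S.covVecₗ (t + 1) i j)
      (fun q => u (Sum.inr (Sum.inl (Sum.inr q))) •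
        ((0, Pi.single q 1) : (Fin S.p₁ → ℝ) × (Fin S.p₂ → ℝ))) Finset.univ
    simp only [map_smul] at h2 h3
    change _ = ∑ q, u (Sum.inl (Sum.inr q)) • S.covVecₗ (t + 1) i j (Pi.single q 1, 0) +
      ∑ q, u (Sum.inr (Sum.inl (Sum.inr q))) • S.covVecₗ (t + 1) i j (0, Pi.single q 1)
    rw [← h2, ← h3, ← map_add]
    change S.covVecₗ (t + 1) i j ((fun q => u (Sum.inl (Sum.inr q))),
      (fun q => u (Sum.inr (Sum.inl (Sum.inr q))))) = _
    congr 1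
    ext q <;> simp [Prod.fst_sum, Prod.snd_sum, Finset.sum_apply, Pi.single_apply]
  rw [h1]
  simp only [covComb, covFeature, features, Fintype.sum_sum_type, Sum.elim_inl, Sum.elim_inr,
    Finset.univ_unique, Finset.sum_singleton]
  abel

theorem initial_add (s : ℕ) (φ ψ : ℕ → ℝ) :
    initial s (fun t => φ t + ψ t) = initial s φ + initial s ψ := rfl

theorem initial_mul (s : ℕ) (c : ℝ) (φ : ℕ → ℝ) :
    initial s (fun t => c * φ t) = c • initial s φ := rfl

/-- Operator norm bound for the covariate-driven part of `𝒳_ijtᵀ u`. -/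
theorem IsModel.sum_inner_covComb_sq_le (hS : S.IsModel) (hκ : S.Stationarity κ) (hκ1 : κ < 1)
    (hR0 : 0 ≤ R) (hR : S.ParameterSpace R) (i : Fin S.N₁) (j : Fin S.N₂)
    (u : Coord S.p₁ S.p₂ → ℝ) (e : EuclideanSpace ℝ S.CovIndex) (s : ℕ) :
    ∑ t ∈ Finset.range s, ⟪S.covComb t i j u, e⟫_ℝ ^ 2 ≤
      (3 * R / (1 - κ) + 1) ^ 2 * S.m * (∑ a, u a ^ 2) * ‖e‖ ^ 2 := by
  have hκ' : 0 < 1 - κ := by linarith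
  set B := R * √S.m * ‖e‖ / (1 - κ) with hBdef
  have hB : 0 ≤ B := by positivity
  set U := √(∑ a, u a ^ 2) with hU
  have hu0 : 0 ≤ ∑ a, u a ^ 2 := Finset.sum_nonneg fun _ _ => sq_nonneg _
  have hua : ∀ a, |u a| ≤ U := fun a => by
    refine Real.abs_le_sqrt (Finset.single_le_sum (f := fun a => u a ^ 2)
      (fun a _ => sq_nonneg _) (Finset.mem_univ a))
  have hU0 : 0 ≤ U := Real.sqrt_nonneg _
  have hm : (1 : ℝ) ≤ √S.m := by
    rw [Real.one_le_sqrt]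
    exact_mod_cast (show 1 ≤ S.m by simp [m])
  have h0 := fun k l => hS.sum_inner_covPath_sq_le hκ hκ1 hR0 hR e s k l
  have hin : ∀ t, ⟪S.covComb t i j u, e⟫_ℝ =
      u (Sum.inl (Sum.inl ())) * S.rowLag (fun k l => ⟪S.covPath t k l, e⟫_ℝ) i j +
      u (Sum.inr (Sum.inl (Sum.inl ()))) * S.colLag (fun k l => ⟪S.covPath t k l, e⟫_ℝ) i j +
      u (Sum.inr (Sum.inr ())) * ⟪S.covPath t i j, e⟫_ℝ +
      ⟪S.covVec (t + 1) i j (fun q => u (Sum.inl (Sum.inr q)))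
        (fun q => u (Sum.inr (Sum.inl (Sum.inr q)))), e⟫_ℝ := by
    intro t
    have h1 := S.map_rowLag (innerLeft e) (S.covPath t) i j
    have h2 := S.map_colLag (innerLeft e) (S.covPath t) i j
    simp only [innerLeft_apply] at h1 h2
    rw [covComb_eq, inner_add_left, inner_add_left, inner_add_left, real_inner_smul_left,
      real_inner_smul_left, real_inner_smul_left, h1, h2]
  have hfin : (3 * R / (1 - κ) + 1) ^ 2 * S.m * (∑ a, u a ^ 2) * ‖e‖ ^ 2 =
      ((3 * R / (1 - κ) + 1) * √S.m * U * ‖e‖) ^ 2 := by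
    rw [mul_pow, mul_pow, mul_pow, hU, Real.sq_sqrt hu0, Real.sq_sqrt (Nat.cast_nonneg _)]
  rw [hfin, ← norm_initial_le_iff (by positivity) (φ := fun t => ⟪S.covComb t i j u, e⟫_ℝ)]
  simp_rw [hin]
  rw [initial_add, initial_add, initial_add, initial_mul, initial_mul, initial_mul]
  have h1 := (norm_initial_le_iff hB
    (φ := fun t => S.rowLag (fun k l => ⟪S.covPath t k l, e⟫_ℝ) i j)).2
      (hS.sum_rowLag_sq_le hB h0 i j)
  have h2 := (norm_initial_le_iff hB
    (φ := fun t => S.colLag (fun k l => ⟪S.covPath t k l, e⟫_ℝ) i j)).2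
      (hS.sum_colLag_sq_le hB h0 i j)
  have h3 := (norm_initial_le_iff hB (φ := fun t => ⟪S.covPath t i j, e⟫_ℝ)).2 (h0 i j)
  have h4 : ‖initial s fun t => ⟪S.covVec (t + 1) i j (fun q => u (Sum.inl (Sum.inr q)))
        (fun q => u (Sum.inr (Sum.inl (Sum.inr q)))), e⟫_ℝ‖ ≤ U * ‖e‖ := by
    rw [norm_initial_le_iff (by positivity)]
    refine (S.sum_inner_covVec_sq_le i j _ _ e s).trans ?_
    rw [mul_pow, hU, Real.sq_sqrt hu0]
    gcongr
    simp only [Fintype.sum_sum_type, Finset.univ_unique, Finset.sum_singleton]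
    nlinarith [sq_nonneg (u (Sum.inl (Sum.inl default))),
      sq_nonneg (u (Sum.inr (Sum.inl (Sum.inl default)))), sq_nonneg (u (Sum.inr (Sum.inr default)))]
  have hsm : ∀ (c : ℝ) (v : EuclideanSpace ℝ (Fin s)), |c| ≤ U → ‖v‖ ≤ B → ‖c • v‖ ≤ U * B := by
    intro c v hc hv
    rw [norm_smul, Real.norm_eq_abs]
    gcongr
  calc _ ≤ U * B + U * B + U * B + U * ‖e‖ := by
        refine (norm_add_le _ _).trans (add_le_add ((norm_add₃_le).trans
          (add_le_add (add_le_add ?_ ?_) ?_)) h4)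
        exacts [hsm _ _ (hua _) h1, hsm _ _ (hua _) h2, hsm _ _ (hua _) h3]
    _ ≤ U * B + U * B + U * B + √S.m * (U * ‖e‖) := by
        have := le_mul_of_one_le_left (mul_nonneg hU0 (norm_nonneg e)) hm
        linarith
    _ = _ := by rw [hBdef]; field_simp; ring

theorem IsModel.norm_covPath_sq_le (hS : S.IsModel) (hκ : S.Stationarity κ) (hκ1 : κ < 1)
    (hR0 : 0 ≤ R) (hR : S.ParameterSpace R) (t : ℕ) (i : Fin S.N₁) (j : Fin S.N₂) :
    ‖S.covPath t i j‖ ^ 2 ≤ (R * √S.m / (1 - κ)) ^ 2 :=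
  norm_sq_le_of_sum_inner_sq_le (f := fun t => S.covPath t i j) (sq_nonneg _)
    (fun e s => (hS.sum_inner_covPath_sq_le hκ hκ1 hR0 hR e s i j).trans_eq (by ring)) t

/-- Each of the three lags contributes O(m) and each covariate coordinate at most 1, so the total
stays linear in m. -/
theorem IsModel.sum_norm_covFeature_sq_le (hS : S.IsModel) (hκ : S.Stationarity κ) (hκ1 : κ < 1)
    (hR0 : 0 ≤ R) (hR : S.ParameterSpace R) (t : ℕ) (i : Fin S.N₁) (j : Fin S.N₂) :
    ∑ a, ‖S.covFeature t i j a‖ ^ 2 ≤ (3 * R / (1 - κ) + 1) ^ 2 * S.m := by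
  have hκ' : 0 < 1 - κ := by linarith
  set B := R * √S.m / (1 - κ) with hBdef
  have hB : 0 ≤ B := by positivity
  have h0 : ∀ k l, ‖S.covPath t k l‖ ≤ B := fun k l =>
    (sq_le_sq₀ (norm_nonneg _) hB).1 (hS.norm_covPath_sq_le hκ hκ1 hR0 hR t k l)
  have h1 := hS.norm_rowLag_le hB h0 i j
  have h2 := hS.norm_colLag_le hB h0 i j
  have h3 : ∀ q, ‖S.covVec (t + 1) i j (Pi.single q 1) 0‖ ^ 2 ≤ 1 := fun q =>
    (S.norm_covVec_sq_le _ i j _ _).trans (by simp [Pi.single_apply])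
  have h4 : ∀ q, ‖S.covVec (t + 1) i j 0 (Pi.single q 1)‖ ^ 2 ≤ 1 := fun q =>
    (S.norm_covVec_sq_le _ i j _ _).trans (by simp [Pi.single_apply])
  have hsq : ∀ v : EuclideanSpace ℝ S.CovIndex, ‖v‖ ≤ B → ‖v‖ ^ 2 ≤ B ^ 2 := fun v hv =>
    pow_le_pow_left₀ (norm_nonneg _) hv 2
  simp only [covFeature, features, Fintype.sum_sum_type, Sum.elim_inl, Sum.elim_inr,
    Finset.univ_unique, Finset.sum_singleton]
  have h5 : ∑ q, ‖S.covVec (t + 1) i j (Pi.single q 1) 0‖ ^ 2 ≤ S.p₁ :=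
    (Finset.sum_le_sum fun q _ => h3 q).trans (by simp)
  have h6 : ∑ q, ‖S.covVec (t + 1) i j 0 (Pi.single q 1)‖ ^ 2 ≤ S.p₂ :=
    (Finset.sum_le_sum fun q _ => h4 q).trans (by simp)
  have h7 := hsq _ h1
  have h8 := hsq _ h2
  have h9 := hsq _ (h0 i j)
  have hB2 : B ^ 2 = (R / (1 - κ)) ^ 2 * S.m := by
    rw [hBdef, div_pow, mul_pow, Real.sq_sqrt (Nat.cast_nonneg _), div_pow]; ring
  have hm : (S.m : ℝ) = S.p₁ + S.p₂ + 3 := by simp [m]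
  have hq : 0 ≤ R / (1 - κ) := by positivity
  have hm0 : (0 : ℝ) ≤ S.m := Nat.cast_nonneg _
  have : (3 * R / (1 - κ) + 1) ^ 2 * S.m =
      9 * ((R / (1 - κ)) ^ 2 * S.m) + 6 * (R / (1 - κ) * S.m) + S.m := by ring
  have h10 : 0 ≤ R / (1 - κ) * S.m := by positivity
  have h11 : 0 ≤ (R / (1 - κ)) ^ 2 * S.m := by positivity
  linarith

/-! ### Centering of the covariate-driven part -/

section Mean

theorem Covariates.memLp_inner (hS : S.IsModel) (hc : S.Covariates K) (hK : 0 < K)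
    (b : EuclideanSpace ℝ S.CovIndex) : MemLp (fun ω => ⟪b, S.covariateVector ω⟫_ℝ) 2 S.μ :=
  have := hS.prob
  (hc.concentration.inner_sq_le hK b).1

theorem Covariates.integrable_inner (hS : S.IsModel) (hc : S.Covariates K) (hK : 0 < K)
    (b : EuclideanSpace ℝ S.CovIndex) : Integrable (fun ω => ⟪b, S.covariateVector ω⟫_ℝ) S.μ :=
  have := hS.prob
  (hc.memLp_inner hS hK b).integrable (by norm_num)

/-- The mean of a linear functional of the covariates, as a function of its coefficients. -/
def Covariates.mean (hS : S.IsModel) (hc : S.Covariates K) (hK : 0 < K) :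
    EuclideanSpace ℝ S.CovIndex →ₗ[ℝ] ℝ where
  toFun b := ∫ ω, ⟪b, S.covariateVector ω⟫_ℝ ∂S.μ
  map_add' b b' := by
    simp_rw [inner_add_left]
    exact integral_add (hc.integrable_inner hS hK b) (hc.integrable_inner hS hK b')
  map_smul' c b := by
    simp_rw [real_inner_smul_left, integral_const_mul]; rfl

/-- Centering is assumed at the times 1, …, T only, whence the index `t + 1`; beyond T the
coefficient vector is zero. -/
theorem Covariates.mean_covVec (hS : S.IsModel) (hc : S.Covariates K) (hK : 0 < K) (t : ℕ)
    (i : Fin S.N₁) (j : Fin S.N₂) (a : Fin S.p₁ → ℝ) (b : Fin S.p₂ → ℝ) :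
    hc.mean hS hK (S.covVec (t + 1) i j a b) = 0 := by
  by_cases ht : t + 1 ≤ S.T
  · have hx : ∀ q, Integrable (fun ω => S.x (t + 1) ω i q) S.μ := fun q => by
      have := hc.integrable_inner hS hK (S.covVec (t + 1) i j (Pi.single q 1) 0)
      simpa [S.inner_covVec ht, Pi.single_apply] using this
    have hz : ∀ q, Integrable (fun ω => S.z (t + 1) ω j q) S.μ := fun q => by
      have := hc.integrable_inner hS hK (S.covVec (t + 1) i j 0 (Pi.single q 1))
      simpa [S.inner_covVec ht, Pi.single_apply] using this
    change ∫ ω, _ ∂S.μ = 0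
    simp_rw [S.inner_covVec ht]
    have htm : t + 1 ∈ Finset.Icc 1 S.T := by simp; omega
    rw [integral_add (integrable_finsetSum _ fun q _ => (hx q).mul_const _)
      (integrable_finsetSum _ fun q _ => (hz q).mul_const _),
      integral_finsetSum _ fun q _ => (hx q).mul_const _,
      integral_finsetSum _ fun q _ => (hz q).mul_const _]
    simp [integral_mul_const, hc.mean_x (t + 1) htm, hc.mean_z (t + 1) htm]
  · have : S.covVec (t + 1) i j a b = 0 := by
      ext k
      have : (k.1 : ℕ) ≠ t + 1 := by have := k.1.2; omega
      simp [covVec, this]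
    rw [this, map_zero]

/-- The path starts at zero and is forced from time 1 on, so the possibly uncentered covariates at
time 0 never enter. -/
theorem Covariates.mean_covPath (hS : S.IsModel) (hc : S.Covariates K) (hK : 0 < K) (t : ℕ)
    (i : Fin S.N₁) (j : Fin S.N₂) : hc.mean hS hK (S.covPath t i j) = 0 := by
  induction t generalizing i j with
  | zero => exact map_zero _
  | succ t ih =>
    change hc.mean hS hK (S.step (S.covPath t) i j + S.covVec (t + 1) i j _ _) = 0
    rw [map_add, mean_covVec, map_step]
    simp_rw [ih]
    simp [step, rowLag, colLag]

theorem Covariates.mean_covFeature (hS : S.IsModel) (hc : S.Covariates K) (hK : 0 < K) (t : ℕ)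
    (i : Fin S.N₁) (j : Fin S.N₂) (a : Coord S.p₁ S.p₂) :
    ∫ ω, ⟪S.covFeature t i j a, S.covariateVector ω⟫_ℝ ∂S.μ = 0 := by
  change hc.mean hS hK _ = 0
  rw [covFeature, map_features]
  simp_rw [mean_covPath, mean_covVec]
  rcases a with (_ | q) | (_ | q) | _ <;> simp [features, rowLag, colLag]

theorem Covariates.integral_inner_covFeature_sq_le (hS : S.IsModel) (hc : S.Covariates K)
    (hK : 0 < K) (t : ℕ) (i : Fin S.N₁) (j : Fin S.N₂) (a : Coord S.p₁ S.p₂) :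
    ∫ ω, ⟪S.covFeature t i j a, S.covariateVector ω⟫_ℝ ^ 2 ∂S.μ ≤
      2 * K ^ 2 * ‖S.covFeature t i j a‖ ^ 2 :=
  have := hS.prob
  (hc.concentration.inner_sq_le hK _).2 (hc.mean_covFeature hS hK t i j a)

end Mean

end Setting

/-! ### L² bounds for the initial response and the regressors -/

section SquareIntegrable

variable {Ω : Type*} [MeasurableSpace Ω] (μ : Measure Ω)

/-- The space of square integrable functions. -/
def squareIntegrable : Submodule ℝ (Ω → ℝ) where
  carrier := {f | MemLp f 2 μ}
  add_mem' hf hg := MemLp.add hf hg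
  zero_mem' := MemLp.zero
  smul_mem' c _ hf := MemLp.const_smul hf c

/-- The projection of square integrable functions to `L²`. -/
def toL2 : squareIntegrable μ →ₗ[ℝ] Lp ℝ 2 μ where
  toFun f := MemLp.toLp f.1 f.2
  map_add' _ _ := rfl
  map_smul' _ _ := rfl

variable {μ}

/-- Turns the model equation, valid almost surely, into an identity in L². Functions and classes are
kept apart: evaluation at a point makes sense for the former, the norm lives on the latter, and the
recursion is compatible with both. -/
theorem toL2_congr {f g : squareIntegrable μ} (h : f.1 =ᵐ[μ] g.1) : toL2 μ f = toL2 μ g :=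
  (MemLp.toLp_eq_toLp_iff f.2 g.2).2 h

theorem norm_toL2_sq (f : squareIntegrable μ) : ‖toL2 μ f‖ ^ 2 = ∫ ω, f.1 ω ^ 2 ∂μ := by
  rw [← real_inner_self_eq_norm_sq, L2.inner_def]
  refine integral_congr_ae ?_
  filter_upwards [MemLp.coeFn_toLp (show MemLp f.1 2 μ from f.2)] with ω hω
  change ⟪(MemLp.toLp f.1 f.2 : Ω → ℝ) ω, (MemLp.toLp f.1 f.2 : Ω → ℝ) ω⟫_ℝ = _
  rw [hω]
  simp [pow_two]

theorem norm_toL2_le {f : squareIntegrable μ} {B : ℝ} (hB : 0 ≤ B)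
    (h : ∫ ω, f.1 ω ^ 2 ∂μ ≤ B ^ 2) : ‖toL2 μ f‖ ≤ B := by
  rwa [← norm_toL2_sq, sq_le_sq₀ (norm_nonneg _) hB] at h

theorem integral_sq_le_of_norm_toL2_le {f : squareIntegrable μ} {B : ℝ}
    (h : ‖toL2 μ f‖ ≤ B) : ∫ ω, f.1 ω ^ 2 ∂μ ≤ B ^ 2 := by
  rw [← norm_toL2_sq]
  exact pow_le_pow_left₀ (norm_nonneg _) h 2

end SquareIntegrable

namespace Setting

variable {S : Setting.{u}} {κ R K τ : ℝ} {σ : ℝ≥0}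

/-- Evaluation of a square integrable function. -/
def evalL {Ω : Type*} [MeasurableSpace Ω] {μ : Measure Ω} (ω : Ω) : squareIntegrable μ →ₗ[ℝ] ℝ :=
  LinearMap.proj ω ∘ₗ (squareIntegrable μ).subtype

theorem Convexity.memLp_Y (hc : S.Convexity τ) {t : ℕ} (ht : t < S.T) (i : Fin S.N₁)
    (j : Fin S.N₂) : MemLp (fun ω => S.Y t ω i j) 2 S.μ := by
  have := hc.memLp (t + 1) (by simp; omega) i j (Sum.inr (Sum.inr ()))
  simpa [regressor] using this

theorem Convexity.integral_sq_eq (hc : S.Convexity τ) {t : ℕ} (ht : t < S.T) (i : Fin S.N₁)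
    (j : Fin S.N₂) (a : Coord S.p₁ S.p₂) : ∫ ω, S.regressor (t + 1) ω i j a ^ 2 ∂S.μ =
      ∫ ω, S.regressor 1 ω i j a ^ 2 ∂S.μ := by
  have := congrFun (congrFun (hc.stationary (t + 1) (by simp; omega) i j) a) a
  simpa [secondMoment, pow_two] using this

/-- Uniform bound on the `L²` norm of the responses. -/
def responseBound (S : Setting.{u}) (R K κ : ℝ) (σ : ℝ≥0) : ℝ :=
  (2 * K * R * √S.m + 10 * σ) / (1 - κ)

theorem responseBound_nonneg (hR : 0 ≤ R) (hK : 0 ≤ K) (hκ1 : κ < 1) :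
    0 ≤ S.responseBound R K κ σ := by
  have hκ' : 0 < 1 - κ := by linarith
  unfold responseBound
  positivity

theorem responseBound_sq_le (hR : 0 ≤ R) (hK : 0 ≤ K) (hκ1 : κ < 1) :
    S.responseBound R K κ σ ^ 2 ≤ ((2 * K * R + 10 * σ) / (1 - κ)) ^ 2 * S.m := by
  have hκ' : 0 < 1 - κ := by linarith
  have hm : (1 : ℝ) ≤ √S.m := by
    rw [Real.one_le_sqrt]
    exact_mod_cast (show 1 ≤ S.m by simp [m])
  have h1 : S.responseBound R K κ σ ≤ (2 * K * R + 10 * σ) / (1 - κ) * √S.m := by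
    rw [responseBound, div_mul_eq_mul_div, add_mul]
    have : 10 * (σ : ℝ) ≤ 10 * σ * √S.m := le_mul_of_one_le_right (by positivity) hm
    gcongr
  calc _ ≤ ((2 * K * R + 10 * σ) / (1 - κ) * √S.m) ^ 2 :=
        pow_le_pow_left₀ (responseBound_nonneg hR hK hκ1) h1 2
    _ = _ := by rw [mul_pow, Real.sq_sqrt (Nat.cast_nonneg _)]

/-- The initial response as an array of square integrable functions. -/
def Convexity.Y₀ (hc : S.Convexity τ) (hT : 0 < S.T) (i : Fin S.N₁) (j : Fin S.N₂) :
    squareIntegrable S.μ := ⟨fun ω => S.Y 0 ω i j, hc.memLp_Y hT i j⟩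

/-- Let B be the largest L² norm of the initial responses, attained at the node p. Time-invariant
second moments give Y₁ the same norm B at p, while the model equation bounds it by κB plus the norms
of the covariate and noise forcing. Hence B(1 − κ) is at most the forcing, which is O(√m). The
condition T > 1 is there because Y₁ appears in the regressor at time 2. -/
theorem Convexity.norm_Y₀_le (hS : S.IsModel) (hc : S.Convexity τ) (hT : 1 < S.T)
    (hκ : S.Stationarity κ) (hκ1 : κ < 1) (hR0 : 0 ≤ R) (hR : S.ParameterSpace R) (hσ : 0 < σ)
    (hε : S.Noise σ) (hK : 0 < K) (hx : S.Covariates K) (i : Fin S.N₁) (j : Fin S.N₂) :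
    ‖toL2 S.μ (hc.Y₀ hT.le i j)‖ ≤ S.responseBound R K κ σ := by
  have hprob := hS.prob
  have hκ' : 0 < 1 - κ := by linarith
  obtain ⟨p, -, hp⟩ := Finset.exists_max_image (Finset.univ : Finset (Fin S.N₁ × Fin S.N₂))
    (fun p => ‖toL2 S.μ (hc.Y₀ hT.le p.1 p.2)‖) ⟨(i, j), Finset.mem_univ _⟩
  set B := ‖toL2 S.μ (hc.Y₀ hT.le p.1 p.2)‖ with hB
  have hmax : ∀ k l, ‖toL2 S.μ (hc.Y₀ hT.le k l)‖ ≤ B := fun k l => hp (k, l) (Finset.mem_univ _)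
  let y₁ : squareIntegrable S.μ := ⟨fun ω => S.Y 1 ω p.1 p.2, hc.memLp_Y hT p.1 p.2⟩
  let b := S.covVec 1 p.1 p.2 (S.θ₀.par.zeta (S.θ₀.g p.1)) (S.θ₀.par.delta (S.θ₀.h p.2))
  let f : squareIntegrable S.μ := ⟨fun ω => ⟪b, S.covariateVector ω⟫_ℝ, hx.memLp_inner hS hK b⟩
  have h1T : 1 ∈ Finset.Icc 1 S.T := by simp; omega
  let e : squareIntegrable S.μ := ⟨fun ω => S.ε 1 ω p.1 p.2,
    (hε.subGaussian 1 h1T p.1 p.2).memLp 2⟩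
  have hsplit : toL2 S.μ y₁ =
      S.step (fun k l => toL2 S.μ (hc.Y₀ hT.le k l)) p.1 p.2 + (toL2 S.μ f + toL2 S.μ e) := by
    rw [← map_step, ← map_add, ← map_add]
    refine toL2_congr ?_
    filter_upwards [hS.equation] with ω hω
    have h2 := hω 1 h1T p.1 p.2
    rw [show (1 : ℕ) = 0 + 1 from rfl, fitted_succ] at h2
    have h3 := S.map_step (evalL (μ := S.μ) ω) (hc.Y₀ hT.le) p.1 p.2
    change S.Y 1 ω p.1 p.2 = evalL (μ := S.μ) ω (S.step (hc.Y₀ hT.le) p.1 p.2) +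
      (⟪b, S.covariateVector ω⟫_ℝ + S.ε 1 ω p.1 p.2)
    rw [h3, S.inner_covVec (by omega)]
    simp only [zero_add] at h2
    rw [h2, add_assoc]
    rfl
  -- Compares the own-lag coordinates of the regressors at the times 2 and 1.
  have hy : ‖toL2 S.μ y₁‖ = B := by
    have h4 := hc.integral_sq_eq hT p.1 p.2 (Sum.inr (Sum.inr ()))
    rw [← sq_eq_sq₀ (norm_nonneg _) (norm_nonneg _), norm_toL2_sq, norm_toL2_sq]
    simp only [regressor, Sum.elim_inr, Nat.add_sub_cancel, Nat.sub_self] at h4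
    exact h4
  have hf : ‖toL2 S.μ f‖ ≤ 2 * K * R * √S.m := by
    refine norm_toL2_le (by positivity) ?_
    refine ((hx.concentration.inner_sq_le hK b).2 (hx.mean_covVec hS hK 0 _ _ _ _)).trans ?_
    have h5 := (S.norm_covVec_sq_le 1 p.1 p.2 _ _).trans (hR.sum_sq_le p.1 p.2)
    calc 2 * K ^ 2 * ‖b‖ ^ 2 ≤ 2 * K ^ 2 * (R ^ 2 * S.m) := by gcongr
      _ ≤ 4 * K ^ 2 * (R ^ 2 * S.m) := by gcongr; norm_num
      _ = _ := by rw [mul_pow, mul_pow, mul_pow, Real.sq_sqrt (Nat.cast_nonneg _)]; ring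
  have he : ‖toL2 S.μ e‖ ≤ 10 * σ := by
    refine norm_toL2_le (by positivity) ?_
    refine (integral_sq_pow_four_le_of_subgaussian hσ (hε.subGaussian 1 h1T p.1 p.2)).1.trans ?_
    nlinarith [sq_nonneg (σ : ℝ)]
  have h6 : B ≤ κ * B + (2 * K * R * √S.m + 10 * σ) := by
    calc B = ‖toL2 S.μ y₁‖ := hy.symm
      _ ≤ _ := by
        rw [hsplit]
        refine (norm_add_le _ _).trans (add_le_add ?_ ((norm_add_le _ _).trans (add_le_add hf he)))
        exact hS.norm_step_le hκ (norm_nonneg _) hmax p.1 p.2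
  refine (hmax i j).trans ?_
  rw [responseBound, le_div_iff₀ hκ']
  linarith

variable (S) in
theorem kappa_nonneg (hκ : S.Stationarity κ) (i : Fin S.N₁) (j : Fin S.N₂) : 0 ≤ κ :=
  le_trans (by positivity) (hκ (S.θ₀.g i) (S.θ₀.h j))

/-- Bounds on features of an array of square integrable functions without covariates. -/
theorem IsModel.norm_features_zero_sq_le (hS : S.IsModel) {E : Type*} [SeminormedAddCommGroup E]
    [NormedSpace ℝ E] {y : Fin S.N₁ → Fin S.N₂ → E} {B : ℝ} (hB : 0 ≤ B)
    (hy : ∀ k l, ‖y k l‖ ≤ B) (i : Fin S.N₁) (j : Fin S.N₂) (a : Coord S.p₁ S.p₂) :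
    ‖S.features y (fun _ => 0) (fun _ => 0) i j a‖ ^ 2 ≤ lagWeight a * B ^ 2 := by
  have h : ∀ v : E, ‖v‖ ≤ B → ‖v‖ ^ 2 ≤ B ^ 2 := fun v hv => pow_le_pow_left₀ (norm_nonneg _) hv 2
  rcases a with (_ | q) | (_ | q) | _ <;> simp only [features, lagWeight, Sum.elim_inl,
    Sum.elim_inr, one_mul, zero_mul]
  · exact h _ (hS.norm_rowLag_le hB hy i j)
  · simp
  · exact h _ (hS.norm_colLag_le hB hy i j)
  · simp
  · exact h _ (hy i j)

/-- Second moments of the part of the regressors that stems from the initial value. -/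
theorem Convexity.integral_initFeature_sq_le (hS : S.IsModel) (hc : S.Convexity τ) (hT : 0 < S.T)
    (hκ : S.Stationarity κ) {B : ℝ} (hB : 0 ≤ B) (hY : ∀ i j, ‖toL2 S.μ (hc.Y₀ hT i j)‖ ≤ B)
    (t : ℕ) (i : Fin S.N₁) (j : Fin S.N₂) (a : Coord S.p₁ S.p₂) :
    MemLp (fun ω => S.initFeature t ω i j a) 2 S.μ ∧
      ∫ ω, S.initFeature t ω i j a ^ 2 ∂S.μ ≤ lagWeight a * (κ ^ t * B) ^ 2 := by
  have hκ0 := S.kappa_nonneg hκ i j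
  let P := S.path (hc.Y₀ hT) (fun _ _ _ => (0 : squareIntegrable S.μ))
  have hP : ∀ t i j, ‖toL2 S.μ (P t i j)‖ ≤ κ ^ t * B := by
    intro t
    induction t with
    | zero => intro i j; rw [pow_zero, one_mul]; exact hY i j
    | succ t ih =>
      intro i j
      change ‖toL2 S.μ (S.step (P t) i j + 0)‖ ≤ _
      rw [add_zero, map_step, pow_succ', mul_assoc]
      exact hS.norm_step_le hκ (by positivity) ih i j
  let F : squareIntegrable S.μ := S.features (P t) (fun _ => 0) (fun _ => 0) i j a
  have hF : ∀ ω, F.1 ω = S.initFeature t ω i j a := by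
    intro ω
    change evalL ω F = _
    simp only [F]
    rw [map_features, initFeature]
    simp only [map_zero]
    congr 1
    ext k l
    simp only [P]
    rw [map_path]
    simp only [map_zero]
    rfl
  have hF2 : F.1 = fun ω => S.initFeature t ω i j a := funext hF
  refine ⟨hF2 ▸ F.2, ?_⟩
  simp_rw [← hF]
  rw [← norm_toL2_sq]
  simp only [F]
  rw [map_features]
  simp only [map_zero]
  exact hS.norm_features_zero_sq_le (by positivity) (hP t) i j a

/-- Second moments of the regressors. -/
theorem Convexity.integral_regressor_sq_le (hS : S.IsModel) (hc : S.Convexity τ) (hT : 0 < S.T)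
    (hK : 0 < K) (hx : S.Covariates K) {B : ℝ} (hB : 0 ≤ B)
    (hY : ∀ i j, ‖toL2 S.μ (hc.Y₀ hT i j)‖ ≤ B)
    (i : Fin S.N₁) (j : Fin S.N₂) (a : Coord S.p₁ S.p₂) :
    ∫ ω, S.regressor 1 ω i j a ^ 2 ∂S.μ ≤ (lagWeight a * B + 2 * K) ^ 2 := by
  have hprob := hS.prob
  have hlag : ∀ v : squareIntegrable S.μ, ‖toL2 S.μ v‖ ≤ B →
      ∫ ω, v.1 ω ^ 2 ∂S.μ ≤ (1 * B + 2 * K) ^ 2 := fun v hv =>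
    integral_sq_le_of_norm_toL2_le (hv.trans (by linarith))
  have h0 := S.regressor_succ 0
  simp only [zero_add] at h0
  have hcov : ∀ b : EuclideanSpace ℝ S.CovIndex, hx.mean hS hK b = 0 → ‖b‖ ^ 2 ≤ 1 →
      ∫ ω, ⟪b, S.covariateVector ω⟫_ℝ ^ 2 ∂S.μ ≤ (0 * B + 2 * K) ^ 2 := by
    intro b hb hb1
    refine ((hx.concentration.inner_sq_le hK b).2 hb).trans ?_
    nlinarith [sq_nonneg K]
  simp_rw [h0]
  rcases a with (_ | q) | (_ | q) | _ <;> simp only [features, lagWeight, Sum.elim_inl, Sum.elim_inr]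
  · have h1 := hlag (S.rowLag (hc.Y₀ hT) i j) (by
      rw [map_rowLag]; exact hS.norm_rowLag_le hB hY i j)
    refine le_of_eq_of_le (integral_congr_ae (Eventually.of_forall fun ω => ?_)) h1
    change _ = (evalL (μ := S.μ) ω (S.rowLag (hc.Y₀ hT) i j)) ^ 2
    rw [map_rowLag]; rfl
  · have h1 := hcov (S.covVec 1 i j (Pi.single q 1) 0) (hx.mean_covVec hS hK 0 i j _ _)
      ((S.norm_covVec_sq_le _ i j _ _).trans (by simp [Pi.single_apply]))
    simpa [S.inner_covVec (show 1 ≤ S.T by omega), Pi.single_apply] using h1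
  · have h1 := hlag (S.colLag (hc.Y₀ hT) i j) (by
      rw [map_colLag]; exact hS.norm_colLag_le hB hY i j)
    refine le_of_eq_of_le (integral_congr_ae (Eventually.of_forall fun ω => ?_)) h1
    change _ = (evalL (μ := S.μ) ω (S.colLag (hc.Y₀ hT) i j)) ^ 2
    rw [map_colLag]; rfl
  · have h1 := hcov (S.covVec 1 i j 0 (Pi.single q 1)) (hx.mean_covVec hS hK 0 i j _ _)
      ((S.norm_covVec_sq_le _ i j _ _).trans (by simp [Pi.single_apply]))
    simpa [S.inner_covVec (show 1 ≤ S.T by omega), Pi.single_apply] using h1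
  · exact hlag (hc.Y₀ hT i j) (hY i j)

end Setting

open Matrix

/-! ### Empirical Gram matrices: noise part and cross moments -/

section Gram

variable {ι : Type*}

/-- Averaged cross product matrix of two sequences of vectors. -/
def avgGram (T : ℕ) (f g : ℕ → ι → ℝ) : Matrix ι ι ℝ :=
  Matrix.of fun a b => (T : ℝ)⁻¹ * ∑ t ∈ Finset.range T, f t a * g t b

theorem avgGram_isSymm (T : ℕ) (f : ℕ → ι → ℝ) : (avgGram T f f).IsSymm := by
  ext a b
  simp [avgGram, mul_comm]

variable [Fintype ι]

theorem dotProduct_avgGram_mulVec (T : ℕ) (f g : ℕ → ι → ℝ) (u : ι → ℝ) :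
    u ⬝ᵥ avgGram T f g *ᵥ u =
      (T : ℝ)⁻¹ * ∑ t ∈ Finset.range T, (∑ a, u a * f t a) * (∑ b, u b * g t b) := by
  simp only [dotProduct, mulVec, avgGram, Matrix.of_apply, Finset.mul_sum, Finset.sum_mul]
  rw [Finset.sum_comm]
  conv_rhs => rw [Finset.sum_comm]
  refine Finset.sum_congr rfl fun a _ => ?_
  rw [Finset.sum_comm]
  refine Finset.sum_congr rfl fun b _ => Finset.sum_congr rfl fun t _ => by ring

/-- Cauchy–Schwarz over index pairs. Frobenius control is affordable for the noise and cross
matrices, whose entries vanish outside three columns. -/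
theorem dotProduct_mulVec_sq_le (M : Matrix ι ι ℝ) (u : ι → ℝ) :
    (u ⬝ᵥ M *ᵥ u) ^ 2 ≤ (∑ a, ∑ b, M a b ^ 2) * (u ⬝ᵥ u) ^ 2 := by
  have h1 : u ⬝ᵥ M *ᵥ u = ∑ p : ι × ι, M p.1 p.2 * (u p.1 * u p.2) := by
    simp only [dotProduct, mulVec, Fintype.sum_prod_type, Finset.mul_sum]
    exact Finset.sum_congr rfl fun a _ => Finset.sum_congr rfl fun b _ => by ring
  have h2 : (u ⬝ᵥ u) ^ 2 = ∑ p : ι × ι, (u p.1 * u p.2) ^ 2 := by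
    simp only [dotProduct, Fintype.sum_prod_type, pow_two, Finset.sum_mul_sum]
    exact Finset.sum_congr rfl fun a _ => Finset.sum_congr rfl fun b _ => by ring
  have h3 : ∑ a, ∑ b, M a b ^ 2 = ∑ p : ι × ι, M p.1 p.2 ^ 2 := by
    rw [Fintype.sum_prod_type]
  rw [h1, h2, h3]
  exact Finset.sum_mul_sq_le_sq_mul_sq _ _ _

theorem abs_dotProduct_mulVec_le {M : Matrix ι ι ℝ} {c : ℝ} (hc : 0 ≤ c)
    (hM : ∑ a, ∑ b, M a b ^ 2 ≤ c ^ 2) (u : ι → ℝ) : |u ⬝ᵥ M *ᵥ u| ≤ c * (u ⬝ᵥ u) := by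
  have h0 : 0 ≤ u ⬝ᵥ u := by simpa using dotProduct_star_self_nonneg u
  refine abs_le_of_sq_le_sq ?_ (by positivity)
  refine (dotProduct_mulVec_sq_le M u).trans ?_
  rw [mul_pow]
  gcongr

end Gram

theorem measure_lt_le_of_integral {Ω : Type*} [MeasurableSpace Ω] {μ : Measure Ω} {f : Ω → ℝ}
    (hf : Integrable f μ) (h0 : ∀ ω, 0 ≤ f ω) {c I : ℝ} (hc : 0 < c) (hI : ∫ ω, f ω ∂μ ≤ I) :
    μ {ω | c < f ω} ≤ ENNReal.ofReal (I / c) := by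
  have h1 := meas_ge_le_lintegral_div (μ := μ) (f := fun ω => ENNReal.ofReal (f ω))
    hf.aestronglyMeasurable.aemeasurable.ennreal_ofReal (ε := ENNReal.ofReal c)
    (by simpa using hc) ENNReal.ofReal_ne_top
  rw [← ofReal_integral_eq_lintegral_ofReal hf (Eventually.of_forall h0),
    ← ENNReal.ofReal_div_of_pos hc] at h1
  refine (measure_mono fun ω hω => ?_).trans (h1.trans (ENNReal.ofReal_le_ofReal (by gcongr)))
  exact ENNReal.ofReal_le_ofReal (le_of_lt hω)

namespace Setting

variable {S : Setting.{u}} {κ R K τ v w : ℝ} {σ : ℝ≥0}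

variable (S) in
/-- The noise, indexed by time and node. -/
def noise (k : S.NoiseIndex) (ω : S.Ω) : ℝ := S.ε (k.1 + 1) ω k.2.1 k.2.2

theorem inner_noiseVector (b : EuclideanSpace ℝ S.NoiseIndex) (ω : S.Ω) :
    ⟪b, S.noiseVector ω⟫_ℝ = ∑ k, b k * S.noise k ω := by
  simp [PiLp.inner_apply, noiseVector, noise, mul_comm]

theorem IsModel.measurable_ε (hS : S.IsModel) (t : ℕ) (i : Fin S.N₁) (j : Fin S.N₂) :
    Measurable fun ω => S.ε t ω i j :=
  measurable_pi_iff.1 (measurable_pi_iff.1 (hS.meas_ε t) i) j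

theorem IsModel.measurable_noise (hS : S.IsModel) (k : S.NoiseIndex) : Measurable (S.noise k) :=
  hS.measurable_ε _ _ _

theorem Noise.exists_isWhiteNoise (hS : S.IsModel) (hσ : 0 < σ) (hε : S.Noise σ) :
    ∃ v, IsWhiteNoise S.μ S.noise v (96 * σ ^ 4) ∧ 0 ≤ v ∧ v ≤ 96 * σ ^ 2 := by
  have ht : ∀ k : S.NoiseIndex, (k.1 : ℕ) + 1 ∈ Finset.Icc 1 S.T := fun k => by
    simp
  have hmom := fun k : S.NoiseIndex =>
    integral_sq_pow_four_le_of_subgaussian hσ (hε.subGaussian _ (ht k) k.2.1 k.2.2)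
  rcases isEmpty_or_nonempty S.NoiseIndex with hE | ⟨⟨k₀⟩⟩
  · refine ⟨0, ⟨?_, hε.indep, ?_, ?_, ?_, ?_⟩, le_rfl, by positivity⟩ <;> intro k <;>
      exact (hE.false k).elim
  refine ⟨∫ ω, S.noise k₀ ω ^ 2 ∂S.μ, ⟨hS.measurable_noise, hε.indep, fun k => ?_, fun k => ?_,
    fun k => ?_, fun k => (hmom k).2⟩, integral_nonneg fun _ => sq_nonneg _, (hmom k₀).1⟩
  · exact (hε.subGaussian _ (ht k) k.2.1 k.2.2).memLp 4
  · exact hε.mean_zero _ (ht k) _ _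
  · have := hε.identDistrib _ (ht k) _ (ht k₀) k.2.1 k.2.2 k₀.2.1 k₀.2.2
    exact (this.comp (measurable_id.pow_const 2)).integral_eq

/-- Exogeneity in terms of the stacked covariates. -/
theorem Noise.indepFun_noise_covariateVector (hε : S.Noise σ) :
    IndepFun (fun ω k => S.noise k ω) S.covariateVector S.μ := by
  have h := hε.exogenous.comp
    (φ := fun (e : Fin S.T → Fin S.N₁ → Fin S.N₂ → ℝ) (k : S.NoiseIndex) => e k.1 k.2.1 k.2.2)
    (ψ := fun (p : (Fin (S.T + 1) → Fin S.N₁ → Fin S.p₁ → ℝ) ×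
      (Fin (S.T + 1) → Fin S.N₂ → Fin S.p₂ → ℝ)) => (WithLp.toLp 2 fun k : S.CovIndex =>
        Sum.elim (fun q => p.1 k.1 q.1 q.2) (fun q => p.2 k.1 q.1 q.2) k.2 :
          EuclideanSpace ℝ S.CovIndex)) (by fun_prop) (by
      refine (WithLp.measurable_toLp _ _).comp (measurable_pi_iff.2 fun k => ?_)
      rcases k with ⟨k, q | q⟩ <;> simp only [Sum.elim_inl, Sum.elim_inr] <;> fun_prop)
  exact h

variable (S) in
/-- Empirical second moments of the covariate-driven part of the regressors. -/
def covGram (i : Fin S.N₁) (j : Fin S.N₂) (ω : S.Ω) : Matrix (Coord S.p₁ S.p₂) (Coord S.p₁ S.p₂) ℝ :=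
  avgGram S.T (fun t a => ⟪S.covFeature t i j a, S.covariateVector ω⟫_ℝ)
    (fun t a => ⟪S.covFeature t i j a, S.covariateVector ω⟫_ℝ)

variable (S) in
/-- Empirical cross moments of the covariate- and the noise-driven parts of the regressors. -/
def crossGram (i : Fin S.N₁) (j : Fin S.N₂) (ω : S.Ω) :
    Matrix (Coord S.p₁ S.p₂) (Coord S.p₁ S.p₂) ℝ :=
  avgGram S.T (fun t a => ⟪S.covFeature t i j a, S.covariateVector ω⟫_ℝ)
    (fun t a => ⟪S.noiseFeature t i j a, S.noiseVector ω⟫_ℝ)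

variable (S) in
/-- Empirical second moments of the noise-driven part of the regressors. -/
def noiseGram (i : Fin S.N₁) (j : Fin S.N₂) (ω : S.Ω) :
    Matrix (Coord S.p₁ S.p₂) (Coord S.p₁ S.p₂) ℝ :=
  avgGram S.T (fun t a => ⟪S.noiseFeature t i j a, S.noiseVector ω⟫_ℝ)
    (fun t a => ⟪S.noiseFeature t i j a, S.noiseVector ω⟫_ℝ)

variable (S) in
/-- Second moments of the noise-driven part of the regressors, for noise of variance `v`. -/
def meanNoiseGram (v : ℝ) (i : Fin S.N₁) (j : Fin S.N₂) :
    Matrix (Coord S.p₁ S.p₂) (Coord S.p₁ S.p₂) ℝ :=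
  Matrix.of fun a b => v * ((S.T : ℝ)⁻¹ *
    ∑ t ∈ Finset.range S.T, ⟪S.noiseFeature t i j a, S.noiseFeature t i j b⟫_ℝ)

theorem inner_eq_sum {ι : Type*} [Fintype ι] (x y : EuclideanSpace ℝ ι) :
    ⟪x, y⟫_ℝ = ∑ k, x k * y k := by
  simp [PiLp.inner_apply, mul_comm]

/-- Concentration of the noise Gram matrix, entrywise in `L²`. -/
theorem IsModel.integral_noiseGram_sub_sq_le (hS : S.IsModel) (hT : 0 < S.T)
    (hκ : S.Stationarity κ) (hκ1 : κ < 1) (he : IsWhiteNoise S.μ S.noise v w)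
    (i : Fin S.N₁) (j : Fin S.N₂) (a b : Coord S.p₁ S.p₂) :
    MemLp (fun ω => S.noiseGram i j ω a b - S.meanNoiseGram v i j a b) 2 S.μ ∧
    ∫ ω, (S.noiseGram i j ω a b - S.meanNoiseGram v i j a b) ^ 2 ∂S.μ ≤
      4 * w * (lagWeight a * lagWeight b * (1 - κ)⁻¹ ^ 4 / S.T) := by
  have hprob := hS.prob
  have hT' : (0 : ℝ) < S.T := by exact_mod_cast hT
  have hwl := lagWeight_nonneg a
  have hwl' := lagWeight_nonneg b
  have hw : 0 ≤ w := by
    have k : S.NoiseIndex := ⟨⟨0, hT⟩, i, j⟩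
    exact (sq_nonneg v).trans (he.sq_le k)
  let A : S.NoiseIndex → S.NoiseIndex → ℝ := fun k l =>
    (S.T : ℝ)⁻¹ * ∑ t ∈ Finset.range S.T, S.noiseFeature t i j a k * S.noiseFeature t i j b l
  have h1 : ∀ ω, S.noiseGram i j ω a b - S.meanNoiseGram v i j a b =
      ∑ k, ∑ l, A k l * (S.noise k ω * S.noise l ω) - v * ∑ k, A k k := by
    intro ω
    congr 1
    · simp only [noiseGram, avgGram, Matrix.of_apply, inner_noiseVector, A, Finset.mul_sum,
        Finset.sum_mul]
      rw [Finset.sum_comm]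
      conv_lhs =>
        enter [2, k]
        rw [Finset.sum_comm]
      rw [Finset.sum_comm]
      refine Finset.sum_congr rfl fun k _ => Finset.sum_congr rfl fun l _ =>
        Finset.sum_congr rfl fun t _ => by ring
    · simp only [meanNoiseGram, Matrix.of_apply, A, inner_eq_sum, ← Finset.mul_sum]
      rw [Finset.sum_comm]
  -- For fixed `l` the vector `A · l` is T⁻¹ times a combination over time of the vectors
  -- `S.noiseFeature t i j a`, so the adjoint operator bound applies. Summing over `l` leaves T⁻²
  -- times T squared norms, which is O(1/T).
  have hA : ∑ k, ∑ l, A k l ^ 2 ≤ lagWeight a * lagWeight b * (1 - κ)⁻¹ ^ 4 / S.T := by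
    have h2 : ∀ l, ∑ k, A k l ^ 2 ≤ (S.T : ℝ)⁻¹ ^ 2 * (lagWeight a * (1 - κ)⁻¹ ^ 2 *
        ∑ t ∈ Finset.range S.T, S.noiseFeature t i j b l ^ 2) := by
      intro l
      have h3 := norm_sum_smul_sq_le (f := fun t => S.noiseFeature t i j a)
        (mul_nonneg hwl (sq_nonneg _)) (s := Finset.range S.T)
        (fun e => hS.sum_inner_noiseFeature_sq_le hκ hκ1 i j a e S.T)
        (fun t => S.noiseFeature t i j b l)
      refine le_trans (le_of_eq ?_) (mul_le_mul_of_nonneg_left h3 (sq_nonneg (S.T : ℝ)⁻¹))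
      rw [EuclideanSpace.real_norm_sq_eq, Finset.mul_sum]
      refine Finset.sum_congr rfl fun k _ => ?_
      simp only [A, mul_pow, WithLp.ofLp_sum, Finset.sum_apply, PiLp.smul_apply, smul_eq_mul]
      simp_rw [mul_comm (S.noiseFeature _ i j a k)]
    rw [Finset.sum_comm]
    calc ∑ l, ∑ k, A k l ^ 2 ≤ ∑ l, (S.T : ℝ)⁻¹ ^ 2 * (lagWeight a * (1 - κ)⁻¹ ^ 2 *
        ∑ t ∈ Finset.range S.T, S.noiseFeature t i j b l ^ 2) :=
          Finset.sum_le_sum fun l _ => h2 l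
      _ = (S.T : ℝ)⁻¹ ^ 2 * (lagWeight a * (1 - κ)⁻¹ ^ 2 *
        ∑ t ∈ Finset.range S.T, ‖S.noiseFeature t i j b‖ ^ 2) := by
          rw [← Finset.mul_sum, ← Finset.mul_sum, Finset.sum_comm]
          simp_rw [EuclideanSpace.real_norm_sq_eq]
      _ ≤ (S.T : ℝ)⁻¹ ^ 2 * (lagWeight a * (1 - κ)⁻¹ ^ 2 *
        ∑ t ∈ Finset.range S.T, lagWeight b * (1 - κ)⁻¹ ^ 2) := by
          gcongr with t
          exact hS.norm_noiseFeature_sq_le hκ hκ1 t i j b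
      _ = _ := by
          rw [Finset.sum_const, Finset.card_range, nsmul_eq_mul]
          field_simp
  have h4 := he.integral_quadForm_sq_le A Finset.univ
  simp_rw [h1]
  refine ⟨h4.1, h4.2.trans ?_⟩
  gcongr

theorem IsModel.measurable_covariateVector (hS : S.IsModel) : Measurable S.covariateVector := by
  refine (WithLp.measurable_toLp _ _).comp (measurable_pi_iff.2 fun k => ?_)
  rcases k with ⟨k, q | q⟩ <;> simp only [Sum.elim_inl, Sum.elim_inr]
  · exact measurable_pi_iff.1 (measurable_pi_iff.1 (hS.meas_x _) q.1) q.2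
  · exact measurable_pi_iff.1 (measurable_pi_iff.1 (hS.meas_z _) q.1) q.2

/-- The cross moments are small in `L²`. -/
theorem IsModel.integral_crossGram_sq_le (hS : S.IsModel)
    (hκ : S.Stationarity κ) (hκ1 : κ < 1) (hK : 0 < K) (hx : S.Covariates K) (hε : S.Noise σ)
    (he : IsWhiteNoise S.μ S.noise v w) (hv : 0 ≤ v)
    (i : Fin S.N₁) (j : Fin S.N₂) (a b : Coord S.p₁ S.p₂) :
    MemLp (fun ω => S.crossGram i j ω a b) 2 S.μ ∧
    ∫ ω, S.crossGram i j ω a b ^ 2 ∂S.μ ≤ v * ((S.T : ℝ)⁻¹ ^ 2 * (lagWeight b * (1 - κ)⁻¹ ^ 2 *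
        ∑ t ∈ Finset.range S.T, 2 * K ^ 2 * ‖S.covFeature t i j a‖ ^ 2)) := by
  have hprob := hS.prob
  have hwl := lagWeight_nonneg b
  -- Coefficients of the entry as a linear form in the noise. They depend on the covariates only, so
  -- by exogeneity the second moment is v times the sum of the second moments of the `δ k`.
  let δ : S.NoiseIndex → EuclideanSpace ℝ S.CovIndex → ℝ := fun k e =>
    (S.T : ℝ)⁻¹ * ∑ t ∈ Finset.range S.T, ⟪S.covFeature t i j a, e⟫_ℝ * S.noiseFeature t i j b k
  have hδ : ∀ k, Measurable (δ k) := fun k => by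
    have : Continuous (δ k) := by fun_prop
    exact this.measurable
  have hmem : ∀ t, MemLp (fun ω => ⟪S.covFeature t i j a, S.covariateVector ω⟫_ℝ) 2 S.μ :=
    fun t => hx.memLp_inner hS hK _
  have hδ2 : ∀ k, MemLp (fun ω => δ k (S.covariateVector ω)) 2 S.μ := fun k =>
    (memLp_finsetSum _ fun t _ => (hmem t).mul_const _).const_mul _
  have hind : IndepFun (fun ω k => S.noise k ω) (fun ω k => δ k (S.covariateVector ω)) S.μ :=
    hε.indepFun_noise_covariateVector.comp (φ := id) (ψ := fun e k => δ k e) measurable_id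
      (measurable_pi_iff.2 hδ)
  have h1 := he.integral_sum_mul_sq (d := fun k ω => δ k (S.covariateVector ω))
    (fun k => (hδ k).comp hS.measurable_covariateVector) hδ2 hind
  have h2 : ∀ ω, S.crossGram i j ω a b = ∑ k, δ k (S.covariateVector ω) * S.noise k ω := by
    intro ω
    simp only [crossGram, avgGram, Matrix.of_apply, inner_noiseVector, δ, Finset.mul_sum,
      Finset.sum_mul]
    rw [Finset.sum_comm]
    exact Finset.sum_congr rfl fun k _ => Finset.sum_congr rfl fun t _ => by ring
  simp_rw [h2]
  refine ⟨h1.1, h1.2.trans_le ?_⟩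
  gcongr
  rw [← integral_finsetSum _ fun k _ => (hδ2 k).integrable_sq]
  have h3 : ∀ ω, ∑ k, δ k (S.covariateVector ω) ^ 2 ≤ (S.T : ℝ)⁻¹ ^ 2 *
      (lagWeight b * (1 - κ)⁻¹ ^ 2 *
        ∑ t ∈ Finset.range S.T, ⟪S.covFeature t i j a, S.covariateVector ω⟫_ℝ ^ 2) := by
    intro ω
    have h4 := norm_sum_smul_sq_le (f := fun t => S.noiseFeature t i j b)
        (mul_nonneg hwl (sq_nonneg _)) (s := Finset.range S.T)
        (fun e => hS.sum_inner_noiseFeature_sq_le hκ hκ1 i j b e S.T)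
        (fun t => ⟪S.covFeature t i j a, S.covariateVector ω⟫_ℝ)
    refine le_trans (le_of_eq ?_) (mul_le_mul_of_nonneg_left h4 (sq_nonneg (S.T : ℝ)⁻¹))
    rw [EuclideanSpace.real_norm_sq_eq, Finset.mul_sum]
    refine Finset.sum_congr rfl fun k _ => ?_
    simp only [δ, mul_pow, WithLp.ofLp_sum, Finset.sum_apply, PiLp.smul_apply, smul_eq_mul]
  have h_int : Integrable (fun ω => ∑ t ∈ Finset.range S.T,
      ⟪S.covFeature t i j a, S.covariateVector ω⟫_ℝ ^ 2) S.μ :=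
    integrable_finsetSum _ fun t _ => (hmem t).integrable_sq
  refine (integral_mono (integrable_finsetSum _ fun k _ => (hδ2 k).integrable_sq)
    ((h_int.const_mul _).const_mul _) h3).trans ?_
  rw [integral_const_mul, integral_const_mul, integral_finsetSum _ fun t _ => (hmem t).integrable_sq]
  gcongr with t
  exact hx.integral_inner_covFeature_sq_le hS hK t i j a

end Setting

/-! ### Concentration of the covariate Gram matrix -/

namespace Setting

variable {S : Setting.{u}} {κ R K τ v w : ℝ} {σ : ℝ≥0}

variable (S) in
/-- Second moments of the covariate-driven part of the regressors. -/
def meanCovGram (i : Fin S.N₁) (j : Fin S.N₂) : Matrix (Coord S.p₁ S.p₂) (Coord S.p₁ S.p₂) ℝ :=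
  Matrix.of fun a b => ∫ ω, S.covGram i j ω a b ∂S.μ

theorem sum_mul_inner_covFeature (t : ℕ) (i : Fin S.N₁) (j : Fin S.N₂) (u : Coord S.p₁ S.p₂ → ℝ)
    (e : EuclideanSpace ℝ S.CovIndex) :
    ∑ a, u a * ⟪S.covFeature t i j a, e⟫_ℝ = ⟪S.covComb t i j u, e⟫_ℝ := by
  simp only [covComb, sum_inner, real_inner_smul_left]

theorem dotProduct_covGram_mulVec (i : Fin S.N₁) (j : Fin S.N₂) (u : Coord S.p₁ S.p₂ → ℝ)
    (ω : S.Ω) : u ⬝ᵥ S.covGram i j ω *ᵥ u =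
      (S.T : ℝ)⁻¹ * ∑ t ∈ Finset.range S.T, ⟪S.covComb t i j u, S.covariateVector ω⟫_ℝ ^ 2 := by
  rw [covGram, dotProduct_avgGram_mulVec]
  simp_rw [sum_mul_inner_covFeature, pow_two]

theorem Covariates.integrable_covGram (hS : S.IsModel) (hK : 0 < K) (hx : S.Covariates K)
    (i : Fin S.N₁) (j : Fin S.N₂) (a b : Coord S.p₁ S.p₂) :
    Integrable (fun ω => S.covGram i j ω a b) S.μ :=
  (integrable_finsetSum _ fun _ _ => (hx.memLp_inner hS hK _).integrable_mul
    (hx.memLp_inner hS hK _)).const_mul _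

theorem Covariates.dotProduct_meanCovGram_mulVec (hS : S.IsModel) (hK : 0 < K)
    (hx : S.Covariates K) (i : Fin S.N₁) (j : Fin S.N₂) (u : Coord S.p₁ S.p₂ → ℝ) :
    u ⬝ᵥ S.meanCovGram i j *ᵥ u = ∫ ω, u ⬝ᵥ S.covGram i j ω *ᵥ u ∂S.μ := by
  have hi := hx.integrable_covGram hS hK i j
  simp only [dotProduct, mulVec, meanCovGram, Matrix.of_apply]
  rw [integral_finsetSum _ fun a _ => (integrable_finsetSum _ fun b _ =>
    (hi a b).mul_const _).const_mul _]
  refine Finset.sum_congr rfl fun a _ => ?_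
  rw [integral_const_mul, integral_finsetSum _ fun b _ => (hi a b).mul_const _]
  simp_rw [integral_mul_const]

theorem Covariates.posSemidef_meanCovGram (hS : S.IsModel) (hK : 0 < K)
    (hx : S.Covariates K) (i : Fin S.N₁) (j : Fin S.N₂) : (S.meanCovGram i j).PosSemidef := by
  refine PosSemidef.of_dotProduct_mulVec_nonneg ?_ fun u => ?_
  · ext a b
    simp only [conjTranspose_apply, star_trivial, meanCovGram, Matrix.of_apply]
    congr 1; ext ω
    exact congrFun (congrFun (avgGram_isSymm S.T
      fun t a => ⟪S.covFeature t i j a, S.covariateVector ω⟫_ℝ) a) b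
  · rw [star_trivial, hx.dotProduct_meanCovGram_mulVec hS hK]
    refine integral_nonneg fun ω => ?_
    simp only [dotProduct_covGram_mulVec]
    positivity

/-- Concentration of the covariate Gram matrix in a fixed direction. -/
theorem Covariates.measure_covGram_le (hS : S.IsModel) (hT : 0 < S.T) (hκ : S.Stationarity κ)
    (hκ1 : κ < 1) (hR0 : 0 ≤ R) (hR : S.ParameterSpace R) (hK : 0 < K)
    (hx : S.Covariates K) (i : Fin S.N₁) (j : Fin S.N₂) {c : ℝ} (hc : 0 < c) (hc1 : c ≤ 1)
    {L : ℝ} (hL : 0 < L) (hL2 : L ^ 2 = 9 / 4 * (3 * R / (1 - κ) + 1) ^ 2 * (S.m / S.T))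
    (hLK : 2 * (L * K) ^ 2 ≤ c / 2)
    (u : Coord S.p₁ S.p₂ → ℝ) (hu : u ⬝ᵥ u ≤ 9 / 4) (hu' : u ⬝ᵥ S.meanCovGram i j *ᵥ u ≤ 9 / 4) :
    S.μ {ω | c < |u ⬝ᵥ (S.covGram i j ω - S.meanCovGram i j) *ᵥ u|} ≤
      ENNReal.ofReal (2 * Real.exp (-((c / 8) ^ 2 / (L * K) ^ 2))) := by
  have hprob := hS.prob
  have hT' : (0 : ℝ) < S.T := by exact_mod_cast hT
  let Λ : EuclideanSpace ℝ S.CovIndex →ₗ[ℝ] EuclideanSpace ℝ (Fin S.T) :=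
    initialₗ S.T ∘ₗ LinearMap.pi fun t => innerₗ _ (S.covComb t i j u)
  have hΛ : ∀ e, ‖Λ e‖ ^ 2 = ∑ t ∈ Finset.range S.T, ⟪S.covComb t i j u, e⟫_ℝ ^ 2 := fun e =>
    norm_initial_sq _ _
  have hs : 0 < √(S.T : ℝ)⁻¹ := Real.sqrt_pos.2 (by positivity)
  -- The root of the quadratic form is the norm of a linear image, hence convex and Lipschitz; the
  -- form itself is not globally Lipschitz.
  let F : EuclideanSpace ℝ S.CovIndex → ℝ := fun e => √(S.T : ℝ)⁻¹ * ‖Λ e‖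
  have hF2 : ∀ ω, F (S.covariateVector ω) ^ 2 = u ⬝ᵥ S.covGram i j ω *ᵥ u := by
    intro ω
    rw [dotProduct_covGram_mulVec, ← hΛ, mul_pow, Real.sq_sqrt (by positivity)]
  have hFconv : ConvexOn ℝ Set.univ F := by
    have h1 : ConvexOn ℝ Set.univ fun e => ‖Λ e‖ :=
      (convexOn_univ_norm (E := EuclideanSpace ℝ (Fin S.T))).comp_linearMap Λ
    exact h1.smul hs.le
  have hFLip : ∀ e e', |F e - F e'| ≤ L * ‖e - e'‖ := by
    intro e e'
    simp only [F]
    rw [← mul_sub, abs_mul, abs_of_pos hs]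
    refine (mul_le_mul_of_nonneg_left (abs_norm_sub_norm_le _ _) hs.le).trans ?_
    rw [← map_sub]
    refine le_of_sq_le_sq ?_ (by positivity)
    rw [mul_pow, mul_pow, Real.sq_sqrt (by positivity), hΛ, hL2]
    have h1 := hS.sum_inner_covComb_sq_le hκ hκ1 hR0 hR i j u (e - e') S.T
    have h2 : ∑ a, u a ^ 2 ≤ 9 / 4 := by simpa [dotProduct, pow_two] using hu
    calc (S.T : ℝ)⁻¹ * ∑ t ∈ Finset.range S.T, ⟪S.covComb t i j u, e - e'⟫_ℝ ^ 2
        ≤ (S.T : ℝ)⁻¹ * ((3 * R / (1 - κ) + 1) ^ 2 * S.m * (9 / 4) * ‖e - e'‖ ^ 2) := by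
          gcongr
          refine h1.trans ?_
          gcongr
      _ = _ := by ring
  obtain ⟨-, htail⟩ := hx.concentration.tail hFconv hL hFLip
  obtain ⟨hmem, hvar⟩ := hx.concentration.variance_le hK hFconv hL hFLip
  refine (measure_mono fun ω hω => ?_).trans (htail (c / 8) (by positivity))
  by_contra hcon
  simp only [Set.mem_ofPred_eq, not_le] at hcon hω
  set μF := ∫ ω, F (S.covariateVector ω) ∂S.μ with hμF
  have hμ0 : 0 ≤ μF := integral_nonneg fun ω => by positivity
  have hmean : u ⬝ᵥ S.meanCovGram i j *ᵥ u = ∫ ω, F (S.covariateVector ω) ^ 2 ∂S.μ := by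
    rw [hx.dotProduct_meanCovGram_mulVec hS hK]
    simp_rw [hF2]
  have hvar0 : μF ^ 2 ≤ ∫ ω, F (S.covariateVector ω) ^ 2 ∂S.μ := by
    have h3 := variance_nonneg (fun ω => F (S.covariateVector ω)) S.μ
    rw [variance_eq_sub hmem] at h3
    simpa using h3
  have hμ1 : μF ≤ 3 / 2 := by
    refine le_of_sq_le_sq ?_ (by norm_num)
    linarith
  rw [sub_mulVec, dotProduct_sub, ← hF2, hmean] at hω
  have h4 := abs_lt.1 hcon
  -- Since μF ≤ 3/2, a deviation c/8 of F moves F² by at most c/8 · (c/8 + 3) ≤ c/2. The other half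
  -- of c pays for replacing μF² by the mean of F², a difference equal to the variance of F.
  have h5 : |F (S.covariateVector ω) ^ 2 - μF ^ 2| ≤ c / 2 := by
    have h6 : F (S.covariateVector ω) ^ 2 - μF ^ 2 =
      (F (S.covariateVector ω) - μF) * ((F (S.covariateVector ω) - μF) + 2 * μF) := by ring
    rw [h6, abs_mul]
    calc _ ≤ c / 8 * (c / 8 + 3) := by
          gcongr
          refine (abs_add_le _ _).trans (add_le_add hcon.le ?_)
          rw [abs_of_nonneg (by positivity)]; linarith
      _ ≤ c / 2 := by nlinarith
  have h7 := abs_le.1 h5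
  refine absurd hω (not_lt.2 (abs_le.2 ⟨?_, ?_⟩)) <;> linarith

/-- Uniform concentration of the covariate Gram matrix. -/
theorem Covariates.measure_exists_covGram_le (hS : S.IsModel) (hT : 0 < S.T)
    (hκ : S.Stationarity κ) (hκ1 : κ < 1) (hR0 : 0 ≤ R) (hR : S.ParameterSpace R) (hK : 0 < K)
    (hx : S.Covariates K) (i : Fin S.N₁) (j : Fin S.N₂) {c c₀ : ℝ} (hc : 0 < c) (hc1 : c ≤ 1)
    (hc₀ : 0 < c₀) (hc₀1 : c₀ ≤ 1) (hm : S.m ≤ c₀ * √S.T)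
    (h1 : 9 * (3 * R / (1 - κ) + 1) ^ 2 * K ^ 2 * c₀ ≤ c)
    (h2 : 5 * c₀ * (144 * (3 * R / (1 - κ) + 1) ^ 2 * K ^ 2) ≤ c ^ 2) :
    S.μ {ω | ∃ u : Coord S.p₁ S.p₂ → ℝ, 5 * c * (u ⬝ᵥ S.meanCovGram i j *ᵥ u + u ⬝ᵥ u) <
      |u ⬝ᵥ (S.covGram i j ω - S.meanCovGram i j) *ᵥ u|} ≤ ENNReal.ofReal (2 / √S.T) := by
  have hT' : (0 : ℝ) < S.T := by exact_mod_cast hT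
  have hs : 0 < √(S.T : ℝ) := Real.sqrt_pos.2 hT'
  have hsq : √(S.T : ℝ) ^ 2 = S.T := Real.sq_sqrt hT'.le
  have hκ' : 0 < 1 - κ := by linarith
  set ξ := 3 * R / (1 - κ) + 1 with hξ
  have hξ0 : 0 < ξ := by positivity
  have hm1 : (1 : ℝ) ≤ S.m := by exact_mod_cast (show 1 ≤ S.m by simp [m])
  have hm0 : (0 : ℝ) < S.m := by linarith
  have hmT : (S.m : ℝ) / S.T ≤ c₀ := by
    rw [div_le_iff₀ hT', ← hsq]
    have h3 : (1 : ℝ) ≤ √S.T := by nlinarith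
    nlinarith
  let L := √(9 / 4 * ξ ^ 2 * (S.m / S.T))
  have hL : 0 < L := Real.sqrt_pos.2 (by positivity)
  have hL2 : L ^ 2 = 9 / 4 * ξ ^ 2 * (S.m / S.T) := Real.sq_sqrt (by positivity)
  have hLK : 2 * (L * K) ^ 2 ≤ c / 2 := by
    rw [mul_pow, hL2]
    have : ξ ^ 2 * K ^ 2 * ((S.m : ℝ) / S.T) ≤ ξ ^ 2 * K ^ 2 * c₀ := by gcongr
    linarith
  have h3 := measure_exists_quadForm_le (μ := S.μ) (S.covGram i j)
    (fun ω => avgGram_isSymm S.T _) (hx.posSemidef_meanCovGram hS hK i j)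
    (fun u hu hu' => hx.measure_covGram_le hS hT hκ hκ1 hR0 hR hK i j hc hc1 hL hL2 hLK u hu hu')
  refine h3.trans ?_
  rw [card_coord, show (25 : ℝ≥0∞) = ENNReal.ofReal 25 by simp, ← ENNReal.ofReal_pow (by norm_num),
    ← ENNReal.ofReal_mul (by positivity)]
  refine ENNReal.ofReal_le_ofReal ?_
  have h25 : (25 : ℝ) ≤ Real.exp 4 := by
    have h4 := Real.exp_one_gt_d9
    have h5 : Real.exp 4 = Real.exp 1 ^ 4 := by rw [← Real.exp_nat_mul]; norm_num
    rw [h5]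
    calc (25 : ℝ) ≤ 2.7 ^ 4 := by norm_num
      _ ≤ _ := by gcongr; linarith
  have h26 : (25 : ℝ) ^ S.m ≤ Real.exp (4 * S.m) := by
    calc (25 : ℝ) ^ S.m ≤ Real.exp 4 ^ S.m := by gcongr
      _ = _ := by rw [← Real.exp_nat_mul]; ring_nf
  -- From m ≤ c₀√T follows c₀T/m ≥ √T, so the concentration exponent is at least 5√T by `h2`. The
  -- net costs only 4m ≤ 4√T, and √T remains.
  have hexp : 4 * (S.m : ℝ) + -((c / 8) ^ 2 / (L * K) ^ 2) ≤ -√S.T := by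
    have h5 : (c / 8) ^ 2 / (L * K) ^ 2 = c ^ 2 / (144 * ξ ^ 2 * K ^ 2) * (S.T / S.m) := by
      rw [mul_pow, hL2]; field_simp; norm_num
    have h6 : 5 * c₀ ≤ c ^ 2 / (144 * ξ ^ 2 * K ^ 2) := by
      rw [le_div_iff₀ (by positivity)]; exact h2
    have h7 : √S.T ≤ c₀ * (S.T / S.m) := by
      rw [← mul_div_assoc, le_div_iff₀ hm0]
      calc √S.T * (S.m : ℝ) ≤ √S.T * (c₀ * √S.T) := by gcongr
        _ = c₀ * √S.T ^ 2 := by ring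
        _ = _ := by rw [hsq]
    have h8 : 5 * √S.T ≤ c ^ 2 / (144 * ξ ^ 2 * K ^ 2) * (S.T / S.m) := by
      calc 5 * √S.T ≤ 5 * (c₀ * (S.T / S.m)) := by gcongr
        _ = 5 * c₀ * (S.T / S.m) := by ring
        _ ≤ _ := by gcongr
    rw [h5]
    nlinarith
  calc (25 : ℝ) ^ S.m * (2 * Real.exp (-((c / 8) ^ 2 / (L * K) ^ 2)))
      ≤ Real.exp (4 * S.m) * (2 * Real.exp (-((c / 8) ^ 2 / (L * K) ^ 2))) := by gcongr
    _ = 2 * Real.exp (4 * S.m + -((c / 8) ^ 2 / (L * K) ^ 2)) := by rw [Real.exp_add]; ring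
    _ ≤ 2 * Real.exp (-√S.T) := by gcongr
    _ ≤ 2 / √S.T := by
        rw [Real.exp_neg, div_eq_mul_inv]
        gcongr
        linarith [Real.add_one_le_exp √(S.T : ℝ)]

end Setting

/-! ### Lower bounds for population and empirical Gram matrices -/

namespace Setting

variable {S : Setting.{u}} {κ R K τ v w B : ℝ} {σ : ℝ≥0}

variable (S) in
/-- Coefficients of the noise-driven part of `𝒳_ij(t+1)ᵀ u`. -/
def noiseComb (t : ℕ) (i : Fin S.N₁) (j : Fin S.N₂) (u : Coord S.p₁ S.p₂ → ℝ) :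
    EuclideanSpace ℝ S.NoiseIndex := ∑ a, u a • S.noiseFeature t i j a

theorem sum_mul_inner_noiseFeature (t : ℕ) (i : Fin S.N₁) (j : Fin S.N₂)
    (u : Coord S.p₁ S.p₂ → ℝ) (e : EuclideanSpace ℝ S.NoiseIndex) :
    ∑ a, u a * ⟪S.noiseFeature t i j a, e⟫_ℝ = ⟪S.noiseComb t i j u, e⟫_ℝ := by
  simp only [noiseComb, sum_inner, real_inner_smul_left]

theorem dotProduct_noiseGram_mulVec (i : Fin S.N₁) (j : Fin S.N₂) (u : Coord S.p₁ S.p₂ → ℝ)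
    (ω : S.Ω) : u ⬝ᵥ S.noiseGram i j ω *ᵥ u =
      (S.T : ℝ)⁻¹ * ∑ t ∈ Finset.range S.T, ⟪S.noiseComb t i j u, S.noiseVector ω⟫_ℝ ^ 2 := by
  rw [noiseGram, dotProduct_avgGram_mulVec]
  simp_rw [sum_mul_inner_noiseFeature, pow_two]

theorem dotProduct_crossGram_mulVec (i : Fin S.N₁) (j : Fin S.N₂) (u : Coord S.p₁ S.p₂ → ℝ)
    (ω : S.Ω) : u ⬝ᵥ S.crossGram i j ω *ᵥ u =
      (S.T : ℝ)⁻¹ * ∑ t ∈ Finset.range S.T, ⟪S.covComb t i j u, S.covariateVector ω⟫_ℝ *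
        ⟪S.noiseComb t i j u, S.noiseVector ω⟫_ℝ := by
  rw [crossGram, dotProduct_avgGram_mulVec]
  simp_rw [sum_mul_inner_noiseFeature, sum_mul_inner_covFeature]

theorem dotProduct_meanNoiseGram_mulVec (v : ℝ) (i : Fin S.N₁) (j : Fin S.N₂)
    (u : Coord S.p₁ S.p₂ → ℝ) : u ⬝ᵥ S.meanNoiseGram v i j *ᵥ u =
      v * ((S.T : ℝ)⁻¹ * ∑ t ∈ Finset.range S.T, ‖S.noiseComb t i j u‖ ^ 2) := by
  have h1 : ∀ t, ‖S.noiseComb t i j u‖ ^ 2 =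
      ∑ a, ∑ b, u a * (⟪S.noiseFeature t i j a, S.noiseFeature t i j b⟫_ℝ * u b) := by
    intro t
    rw [← real_inner_self_eq_norm_sq, noiseComb, sum_inner]
    simp_rw [inner_sum, real_inner_smul_left, real_inner_smul_right]
    exact Finset.sum_congr rfl fun a _ => Finset.sum_congr rfl fun b _ => by ring
  simp_rw [h1]
  rw [Finset.sum_comm]
  simp_rw [Finset.sum_comm (s := Finset.range S.T)]
  simp only [dotProduct, mulVec, meanNoiseGram, Matrix.of_apply, Finset.mul_sum, Finset.sum_mul]
  exact Finset.sum_congr rfl fun a _ => Finset.sum_congr rfl fun b _ =>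
    Finset.sum_congr rfl fun t _ => by ring

theorem sq_sum_mul_initFeature_le (t : ℕ) (ω : S.Ω) (i : Fin S.N₁) (j : Fin S.N₂)
    (u : Coord S.p₁ S.p₂ → ℝ) : (∑ a, u a * S.initFeature t ω i j a) ^ 2 ≤
      (u ⬝ᵥ u) * ∑ a, S.initFeature t ω i j a ^ 2 := by
  refine (Finset.sum_mul_sq_le_sq_mul_sq _ _ _).trans (le_of_eq ?_)
  simp only [dotProduct, pow_two]

theorem IsModel.ae_sum_mul_regressor (hS : S.IsModel) (i : Fin S.N₁) (j : Fin S.N₂) :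
    ∀ᵐ ω ∂S.μ, ∀ t < S.T, ∀ u : Coord S.p₁ S.p₂ → ℝ,
    ∑ a, u a * S.regressor (t + 1) ω i j a = ⟪S.covComb t i j u, S.covariateVector ω⟫_ℝ +
      ⟪S.noiseComb t i j u, S.noiseVector ω⟫_ℝ + ∑ a, u a * S.initFeature t ω i j a := by
  filter_upwards [hS.ae_regressor_eq] with ω hω t ht u
  rw [← sum_mul_inner_covFeature, ← sum_mul_inner_noiseFeature, ← Finset.sum_add_distrib,
    ← Finset.sum_add_distrib]
  exact Finset.sum_congr rfl fun a _ => by rw [hω t ht i j a]; ring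

/-- The initial value contributes a bounded sum of second moments. -/
theorem Convexity.integral_sum_initFeature_sq_le (hS : S.IsModel) (hc : S.Convexity τ)
    (hT : 0 < S.T) (hκ : S.Stationarity κ) (hκ1 : κ < 1) (hB : 0 ≤ B)
    (hY : ∀ i j, ‖toL2 S.μ (hc.Y₀ hT i j)‖ ≤ B) (i : Fin S.N₁) (j : Fin S.N₂) :
    Integrable (fun ω => (S.T : ℝ)⁻¹ * ∑ t ∈ Finset.range S.T, ∑ a, S.initFeature t ω i j a ^ 2) S.μ ∧
    ∫ ω, (S.T : ℝ)⁻¹ * ∑ t ∈ Finset.range S.T, ∑ a, S.initFeature t ω i j a ^ 2 ∂S.μ ≤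
      3 * B ^ 2 / (1 - κ) / S.T := by
  have hκ0 := S.kappa_nonneg hκ i j
  have hκ' : 0 < 1 - κ := by linarith
  have h := hc.integral_initFeature_sq_le hS hT hκ hB hY
  have h_int : ∀ t, Integrable (fun ω => ∑ a, S.initFeature t ω i j a ^ 2) S.μ := fun t =>
    integrable_finsetSum _ fun a _ => (h t i j a).1.integrable_sq
  refine ⟨(integrable_finsetSum _ fun t _ => h_int t).const_mul _, ?_⟩
  rw [integral_const_mul, integral_finsetSum _ fun t _ => h_int t]
  have h1 : ∀ t, ∫ ω, ∑ a, S.initFeature t ω i j a ^ 2 ∂S.μ ≤ 3 * B ^ 2 * κ ^ t := by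
    intro t
    rw [integral_finsetSum _ fun a _ => (h t i j a).1.integrable_sq]
    refine (Finset.sum_le_sum fun a _ => (h t i j a).2).trans ?_
    rw [← Finset.sum_mul, sum_lagWeight, mul_pow]
    have h2 : (κ ^ t) ^ 2 ≤ κ ^ t := by
      have := pow_le_one₀ (n := t) hκ0 hκ1.le
      have := pow_nonneg hκ0 t
      nlinarith
    calc 3 * ((κ ^ t) ^ 2 * B ^ 2) ≤ 3 * (κ ^ t * B ^ 2) := by gcongr
      _ = _ := by ring
  have h3 : ∑ t ∈ Finset.range S.T, κ ^ t ≤ 1 / (1 - κ) := by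
    rw [le_div_iff₀ hκ', mul_comm, mul_neg_geom_sum]
    linarith [pow_nonneg hκ0 S.T]
  calc _ ≤ (S.T : ℝ)⁻¹ * (3 * B ^ 2 * (1 / (1 - κ))) := by
        gcongr
        refine (Finset.sum_le_sum fun t _ => h1 t).trans ?_
        rw [← Finset.mul_sum]
        gcongr
    _ = _ := by ring

theorem Convexity.le_integral_sq (hc : S.Convexity τ) {t : ℕ} (ht : t < S.T) (i : Fin S.N₁)
    (j : Fin S.N₂) (u : Coord S.p₁ S.p₂ → ℝ) :
    MemLp (fun ω => ∑ a, u a * S.regressor (t + 1) ω i j a) 2 S.μ ∧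
    τ * (u ⬝ᵥ u) ≤ ∫ ω, (∑ a, u a * S.regressor (t + 1) ω i j a) ^ 2 ∂S.μ := by
  have htm : t + 1 ∈ Finset.Icc 1 S.T := by simp; omega
  have hm := hc.memLp (t + 1) htm i j
  have hi : ∀ a b, Integrable (fun ω => S.regressor (t + 1) ω i j a * S.regressor (t + 1) ω i j b)
    S.μ := fun a b => (hm a).integrable_mul (hm b)
  refine ⟨memLp_finsetSum _ fun a _ => (hm a).const_mul _, ?_⟩
  have h1 : ∫ ω, (∑ a, u a * S.regressor (t + 1) ω i j a) ^ 2 ∂S.μ =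
      u ⬝ᵥ S.secondMoment (t + 1) i j *ᵥ u := by
    have h2 : ∀ ω, (∑ a, u a * S.regressor (t + 1) ω i j a) ^ 2 = ∑ a, ∑ b, u a * u b *
        (S.regressor (t + 1) ω i j a * S.regressor (t + 1) ω i j b) := by
      intro ω
      rw [pow_two, Finset.sum_mul_sum]
      exact Finset.sum_congr rfl fun a _ => Finset.sum_congr rfl fun b _ => by ring
    simp_rw [h2]
    rw [integral_finsetSum _ fun a _ => integrable_finsetSum _ fun b _ => (hi a b).const_mul _]
    simp_rw [integral_finsetSum _ fun b _ => (hi _ b).const_mul _, integral_const_mul]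
    simp only [dotProduct, mulVec, secondMoment, Matrix.of_apply, Finset.mul_sum]
    exact Finset.sum_congr rfl fun a _ => Finset.sum_congr rfl fun b _ => by ring
  have h3 := (hc.lowerBound i j).dotProduct_mulVec_nonneg u
  rw [star_trivial, sub_mulVec, dotProduct_sub, smul_mulVec, one_mulVec, dotProduct_smul,
    smul_eq_mul] at h3
  rw [h1, hc.stationary _ htm]
  linarith

/-- The population Gram matrices of the covariate- and noise-driven parts are jointly bounded
below. -/
theorem Convexity.le_meanGram (hS : S.IsModel) (hc : S.Convexity τ)
    (hT : 0 < S.T) (hκ : S.Stationarity κ) (hκ1 : κ < 1) (hB : 0 ≤ B)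
    (hY : ∀ i j, ‖toL2 S.μ (hc.Y₀ hT i j)‖ ≤ B) (hK : 0 < K) (hx : S.Covariates K)
    (hε : S.Noise σ) (he : IsWhiteNoise S.μ S.noise v w) (hBT : 3 * B ^ 2 / (1 - κ) / S.T ≤ τ / 4)
    (i : Fin S.N₁) (j : Fin S.N₂) (u : Coord S.p₁ S.p₂ → ℝ) :
    τ / 4 * (u ⬝ᵥ u) ≤ u ⬝ᵥ S.meanCovGram i j *ᵥ u + u ⬝ᵥ S.meanNoiseGram v i j *ᵥ u := by
  have hprob := hS.prob
  have hT' : (0 : ℝ) < S.T := by exact_mod_cast hT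
  have hu : 0 ≤ u ⬝ᵥ u := by simpa using dotProduct_star_self_nonneg u
  have hp : ∀ t, MemLp (fun ω => ⟪S.covComb t i j u, S.covariateVector ω⟫_ℝ) 2 S.μ := fun t =>
    hx.memLp_inner hS hK _
  have hq : ∀ t, MemLp (fun ω => ⟪S.noiseComb t i j u, S.noiseVector ω⟫_ℝ) 2 S.μ ∧
      ∫ ω, ⟪S.noiseComb t i j u, S.noiseVector ω⟫_ℝ ^ 2 ∂S.μ = v * ‖S.noiseComb t i j u‖ ^ 2 := by
    intro t
    have := he.integral_linear_sq fun k => S.noiseComb t i j u k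
    simp_rw [inner_noiseVector, EuclideanSpace.real_norm_sq_eq]
    exact this
  have hq0 : ∀ t, ∫ ω, ⟪S.noiseComb t i j u, S.noiseVector ω⟫_ℝ ∂S.μ = 0 := by
    intro t
    simp_rw [inner_noiseVector]
    rw [integral_finsetSum _ fun k _ => ((he.memLp k).integrable (by norm_num)).const_mul _]
    simp_rw [integral_const_mul, he.mean, mul_zero, Finset.sum_const_zero]
  -- Exogeneity and centered noise make the two parts orthogonal, so the population matrix of their
  -- sum is the sum of theirs.
  have hpq : ∀ t, ∫ ω, ⟪S.covComb t i j u, S.covariateVector ω⟫_ℝ *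
      ⟪S.noiseComb t i j u, S.noiseVector ω⟫_ℝ ∂S.μ = 0 := by
    intro t
    have h1 := hε.indepFun_noise_covariateVector.integral_fun_comp_mul_comp
      (f := fun x : S.NoiseIndex → ℝ => ∑ k, S.noiseComb t i j u k * x k)
      (g := fun e => ⟪S.covComb t i j u, e⟫_ℝ)
      (measurable_pi_iff.2 hS.measurable_noise).aemeasurable
      hS.measurable_covariateVector.aemeasurable
      (Measurable.aestronglyMeasurable (by fun_prop)) (by fun_prop)
    simp_rw [← inner_noiseVector] at h1
    simp_rw [mul_comm ⟪S.covComb t i j u, S.covariateVector _⟫_ℝ]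
    rw [h1, hq0, zero_mul]
  have hr : ∀ t, MemLp (fun ω => ∑ a, u a * S.initFeature t ω i j a) 2 S.μ := fun t =>
    memLp_finsetSum _ fun a _ => ((hc.integral_initFeature_sq_le hS hT hκ hB hY t i j a).1).const_mul _
  have hI := hc.integral_sum_initFeature_sq_le hS hT hκ hκ1 hB hY i j
  have hIt : ∀ t, Integrable (fun ω => ∑ a, S.initFeature t ω i j a ^ 2) S.μ := fun t =>
    integrable_finsetSum _ fun a _ =>
      (hc.integral_initFeature_sq_le hS hT hκ hB hY t i j a).1.integrable_sq
  have hpqsq : ∀ t, ∫ ω, (⟪S.covComb t i j u, S.covariateVector ω⟫_ℝ +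
      ⟪S.noiseComb t i j u, S.noiseVector ω⟫_ℝ) ^ 2 ∂S.μ =
      ∫ ω, ⟪S.covComb t i j u, S.covariateVector ω⟫_ℝ ^ 2 ∂S.μ + v * ‖S.noiseComb t i j u‖ ^ 2 := by
    intro t
    have i1 := (hp t).integrable_sq
    have i2 := (hq t).1.integrable_sq
    have i3 : Integrable (fun ω => 2 * (⟪S.covComb t i j u, S.covariateVector ω⟫_ℝ *
      ⟪S.noiseComb t i j u, S.noiseVector ω⟫_ℝ)) S.μ := ((hp t).integrable_mul (hq t).1).const_mul 2
    have h1 : ∀ a b : ℝ, (a + b) ^ 2 = a ^ 2 + b ^ 2 + 2 * (a * b) := fun a b => by ring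
    simp_rw [h1]
    have i12 : Integrable (fun ω => ⟪S.covComb t i j u, S.covariateVector ω⟫_ℝ ^ 2 +
      ⟪S.noiseComb t i j u, S.noiseVector ω⟫_ℝ ^ 2) S.μ := i1.add i2
    rw [integral_add i12 i3, integral_add i1 i2, integral_const_mul, hpq, (hq t).2]
    ring
  -- Uses (p + q + r)² ≤ 2(p + q)² + 2r². Averaged over time, the r term takes at most 2 · τ/4 of τ,
  -- and half of what remains is the asserted τ/4.
  have hstep : ∀ t < S.T, τ * (u ⬝ᵥ u) ≤
      2 * (∫ ω, ⟪S.covComb t i j u, S.covariateVector ω⟫_ℝ ^ 2 ∂S.μ +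
        v * ‖S.noiseComb t i j u‖ ^ 2) +
      2 * ((u ⬝ᵥ u) * ∫ ω, ∑ a, S.initFeature t ω i j a ^ 2 ∂S.μ) := by
    intro t ht
    obtain ⟨h1, h2⟩ := hc.le_integral_sq ht i j u
    refine h2.trans ?_
    have i1 : Integrable (fun ω => 2 * (⟪S.covComb t i j u, S.covariateVector ω⟫_ℝ +
        ⟪S.noiseComb t i j u, S.noiseVector ω⟫_ℝ) ^ 2) S.μ :=
      ((hp t).add (hq t).1).integrable_sq.const_mul 2
    have i2 : Integrable (fun ω => 2 * ((u ⬝ᵥ u) * ∑ a, S.initFeature t ω i j a ^ 2)) S.μ :=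
      ((hIt t).const_mul _).const_mul 2
    rw [← hpqsq, ← integral_const_mul, ← integral_const_mul, ← integral_const_mul,
      ← integral_add i1 i2]
    refine integral_mono_ae h1.integrable_sq (i1.add i2) ?_
    filter_upwards [hS.ae_sum_mul_regressor i j] with ω hω
    rw [hω t ht u]
    have h3 := sq_sum_mul_initFeature_le t ω i j u
    nlinarith [sq_nonneg (⟪S.covComb t i j u, S.covariateVector ω⟫_ℝ +
      ⟪S.noiseComb t i j u, S.noiseVector ω⟫_ℝ - ∑ a, u a * S.initFeature t ω i j a)]
  have hsum := Finset.sum_le_sum fun t ht => hstep t (Finset.mem_range.1 ht)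
  rw [Finset.sum_const, Finset.card_range, nsmul_eq_mul, Finset.sum_add_distrib, ← Finset.mul_sum,
    ← Finset.mul_sum, ← Finset.mul_sum, Finset.sum_add_distrib, ← Finset.mul_sum] at hsum
  rw [hx.dotProduct_meanCovGram_mulVec hS hK, dotProduct_meanNoiseGram_mulVec]
  simp_rw [dotProduct_covGram_mulVec]
  rw [integral_const_mul, integral_finsetSum _ fun t _ => (hp t).integrable_sq]
  have hI2 := hI.2
  rw [integral_const_mul, integral_finsetSum _ fun t _ => hIt t] at hI2
  have hI3 := hI2.trans hBT
  have hsum' := mul_le_mul_of_nonneg_left hsum (inv_nonneg.2 hT'.le)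
  have h5 : (S.T : ℝ)⁻¹ * (S.T * (τ * (u ⬝ᵥ u))) = τ * (u ⬝ᵥ u) := by field_simp
  rw [h5] at hsum'
  have h6 := mul_le_mul_of_nonneg_left hI3 hu
  nlinarith

/-- Lower bound for the empirical Gram matrix on the event where all parts are under control. -/
theorem gram_lower_bound {ω : S.Ω} {c : ℝ} (hT : 0 < S.T) (hτ : 0 < τ) (hc : 0 < c) (hc1 : c ≤ 1 / 10)
    (hcτ : c ≤ τ / 160) (i : Fin S.N₁) (j : Fin S.N₂)
    (hreg : ∀ t < S.T, ∀ u : Coord S.p₁ S.p₂ → ℝ,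
      ∑ a, u a * S.regressor (t + 1) ω i j a = ⟪S.covComb t i j u, S.covariateVector ω⟫_ℝ +
      ⟪S.noiseComb t i j u, S.noiseVector ω⟫_ℝ + ∑ a, u a * S.initFeature t ω i j a)
    (hmean : ∀ u : Coord S.p₁ S.p₂ → ℝ, τ / 4 * (u ⬝ᵥ u) ≤
      u ⬝ᵥ S.meanCovGram i j *ᵥ u + u ⬝ᵥ S.meanNoiseGram v i j *ᵥ u) (hv : 0 ≤ v)
    (h1 : ∀ u : Coord S.p₁ S.p₂ → ℝ, |u ⬝ᵥ (S.covGram i j ω - S.meanCovGram i j) *ᵥ u| ≤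
      5 * c * (u ⬝ᵥ S.meanCovGram i j *ᵥ u + u ⬝ᵥ u))
    (h2 : ∑ a, ∑ b, S.crossGram i j ω a b ^ 2 ≤ c ^ 2)
    (h3 : ∑ a, ∑ b, (S.noiseGram i j ω a b - S.meanNoiseGram v i j a b) ^ 2 ≤ c ^ 2)
    (h4 : (S.T : ℝ)⁻¹ * ∑ t ∈ Finset.range S.T, ∑ a, S.initFeature t ω i j a ^ 2 ≤ c)
    (u : Coord S.p₁ S.p₂ → ℝ) :
    τ / 32 * (u ⬝ᵥ u) ≤
      (S.T : ℝ)⁻¹ * ∑ t ∈ Finset.range S.T, (∑ a, u a * S.regressor (t + 1) ω i j a) ^ 2 := by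
  have hT' : (0 : ℝ) < S.T := by exact_mod_cast hT
  have hu : 0 ≤ u ⬝ᵥ u := by simpa using dotProduct_star_self_nonneg u
  have g1 := abs_le.1 (h1 u)
  have g2 := abs_le.1 (abs_dotProduct_mulVec_le hc.le h2 u)
  have g3 := abs_le.1 (abs_dotProduct_mulVec_le (M := S.noiseGram i j ω - S.meanNoiseGram v i j)
    hc.le h3 u)
  rw [sub_mulVec, dotProduct_sub] at g1 g3
  have g0 := hmean u
  have hN0 : 0 ≤ u ⬝ᵥ S.meanNoiseGram v i j *ᵥ u := by
    rw [dotProduct_meanNoiseGram_mulVec]; positivity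
  have hr : (S.T : ℝ)⁻¹ * ∑ t ∈ Finset.range S.T, (∑ a, u a * S.initFeature t ω i j a) ^ 2 ≤
      (u ⬝ᵥ u) * c := by
    calc _ ≤ (S.T : ℝ)⁻¹ * ∑ t ∈ Finset.range S.T,
          (u ⬝ᵥ u) * ∑ a, S.initFeature t ω i j a ^ 2 := by
          gcongr with t
          exact sq_sum_mul_initFeature_le t ω i j u
      _ = (u ⬝ᵥ u) * ((S.T : ℝ)⁻¹ * ∑ t ∈ Finset.range S.T, ∑ a, S.initFeature t ω i j a ^ 2) := by
          rw [← Finset.mul_sum]; ring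
      _ ≤ _ := by gcongr
  -- Pointwise (p + q + r)² ≥ (p + q)²/2 − r², averaged over time.
  have hpq : 1 / 2 * (u ⬝ᵥ S.covGram i j ω *ᵥ u + 2 * (u ⬝ᵥ S.crossGram i j ω *ᵥ u) +
        u ⬝ᵥ S.noiseGram i j ω *ᵥ u) -
      (S.T : ℝ)⁻¹ * ∑ t ∈ Finset.range S.T, (∑ a, u a * S.initFeature t ω i j a) ^ 2 ≤
      (S.T : ℝ)⁻¹ * ∑ t ∈ Finset.range S.T, (∑ a, u a * S.regressor (t + 1) ω i j a) ^ 2 := by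
    have h5 : 1 / 2 * (u ⬝ᵥ S.covGram i j ω *ᵥ u + 2 * (u ⬝ᵥ S.crossGram i j ω *ᵥ u) +
        u ⬝ᵥ S.noiseGram i j ω *ᵥ u) -
      (S.T : ℝ)⁻¹ * ∑ t ∈ Finset.range S.T, (∑ a, u a * S.initFeature t ω i j a) ^ 2 =
      (S.T : ℝ)⁻¹ * ∑ t ∈ Finset.range S.T, (1 / 2 * (⟪S.covComb t i j u, S.covariateVector ω⟫_ℝ +
      ⟪S.noiseComb t i j u, S.noiseVector ω⟫_ℝ) ^ 2 -
        (∑ a, u a * S.initFeature t ω i j a) ^ 2) := by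
      rw [dotProduct_covGram_mulVec, dotProduct_noiseGram_mulVec, dotProduct_crossGram_mulVec,
        Finset.sum_sub_distrib, ← Finset.mul_sum]
      simp_rw [add_sq, Finset.sum_add_distrib, mul_assoc, ← Finset.mul_sum]
      ring
    rw [h5]
    gcongr with t ht
    rw [hreg t (Finset.mem_range.1 ht) u]
    nlinarith [sq_nonneg (⟪S.covComb t i j u, S.covariateVector ω⟫_ℝ +
      ⟪S.noiseComb t i j u, S.noiseVector ω⟫_ℝ + 2 * ∑ a, u a * S.initFeature t ω i j a)]
  refine le_trans ?_ hpq
  -- The errors add up to (5c + 2c + c)/2 + c = 5c ≤ τ/32. The main term is at least (1 − 5c)/2 ·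
  -- τ/4 ≥ τ/16, as c ≤ 1/10.
  have hA : (1 / 2) * (τ / 4 * (u ⬝ᵥ u)) ≤
      (1 - 5 * c) * (u ⬝ᵥ S.meanCovGram i j *ᵥ u + u ⬝ᵥ S.meanNoiseGram v i j *ᵥ u) := by
    refine mul_le_mul (by linarith) g0 (by positivity) (by linarith)
  have hB : 0 ≤ 5 * c * (u ⬝ᵥ S.meanNoiseGram v i j *ᵥ u) := by positivity
  have hC : c * (u ⬝ᵥ u) ≤ τ / 160 * (u ⬝ᵥ u) := by gcongr
  nlinarith

end Setting

/-! ### The restricted eigenvalue property of a node -/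

namespace Setting

variable {S : Setting.{u}} {κ R K τ v w B : ℝ} {σ : ℝ≥0}

/-- Markov's inequality for the squared Frobenius norm. The noise index runs over three lags and the
covariate index costs the O(m) of `sum_norm_covFeature_sq_le`, whence m/T. -/
theorem IsModel.measure_crossGram_le (hS : S.IsModel) (hT : 0 < S.T)
    (hκ : S.Stationarity κ) (hκ1 : κ < 1) (hR0 : 0 ≤ R) (hR : S.ParameterSpace R) (hK : 0 < K)
    (hx : S.Covariates K) (hε : S.Noise σ)
    (he : IsWhiteNoise S.μ S.noise v w) (hv : 0 ≤ v) (i : Fin S.N₁) (j : Fin S.N₂)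
    {c : ℝ} (hc : 0 < c) :
    S.μ {ω | c ^ 2 < ∑ a, ∑ b, S.crossGram i j ω a b ^ 2} ≤ ENNReal.ofReal
      (6 * v * (1 - κ)⁻¹ ^ 2 * K ^ 2 * (3 * R / (1 - κ) + 1) ^ 2 * (S.m / S.T) / c ^ 2) := by
  have h := hS.integral_crossGram_sq_le hκ hκ1 hK hx hε he hv i j
  have hT' : (0 : ℝ) < S.T := by exact_mod_cast hT
  refine measure_lt_le_of_integral (integrable_finsetSum _ fun a _ => integrable_finsetSum _
    fun b _ => (h a b).1.integrable_sq) (fun ω => by positivity) (by positivity) ?_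
  rw [integral_finsetSum _ fun a _ => integrable_finsetSum _ fun b _ => (h a b).1.integrable_sq]
  simp_rw [integral_finsetSum _ fun b _ => (h _ b).1.integrable_sq]
  calc _ ≤ ∑ a, ∑ b, v * ((S.T : ℝ)⁻¹ ^ 2 * (lagWeight b * (1 - κ)⁻¹ ^ 2 *
        ∑ t ∈ Finset.range S.T, 2 * K ^ 2 * ‖S.covFeature t i j a‖ ^ 2)) :=
        Finset.sum_le_sum fun a _ => Finset.sum_le_sum fun b _ => (h a b).2
    _ = v * ((S.T : ℝ)⁻¹ ^ 2 * (3 * (1 - κ)⁻¹ ^ 2 *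
        (2 * K ^ 2 * ∑ t ∈ Finset.range S.T, ∑ a, ‖S.covFeature t i j a‖ ^ 2))) := by
        simp_rw [← Finset.mul_sum, ← Finset.sum_mul, sum_lagWeight, ← Finset.mul_sum]
        rw [Finset.sum_comm]
    _ ≤ v * ((S.T : ℝ)⁻¹ ^ 2 * (3 * (1 - κ)⁻¹ ^ 2 *
        (2 * K ^ 2 * ∑ t ∈ Finset.range S.T, (3 * R / (1 - κ) + 1) ^ 2 * S.m))) := by
        gcongr with t
        exact hS.sum_norm_covFeature_sq_le hκ hκ1 hR0 hR t i j
    _ = _ := by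
        rw [Finset.sum_const, Finset.card_range, nsmul_eq_mul]
        field_simp
        ring

theorem IsModel.measure_noiseGram_le (hS : S.IsModel) (hT : 0 < S.T)
    (hκ : S.Stationarity κ) (hκ1 : κ < 1) (he : IsWhiteNoise S.μ S.noise v w)
    (i : Fin S.N₁) (j : Fin S.N₂) {c : ℝ} (hc : 0 < c) :
    S.μ {ω | c ^ 2 < ∑ a, ∑ b, (S.noiseGram i j ω a b - S.meanNoiseGram v i j a b) ^ 2} ≤
      ENNReal.ofReal (36 * w * (1 - κ)⁻¹ ^ 4 / S.T / c ^ 2) := by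
  have h := hS.integral_noiseGram_sub_sq_le hT hκ hκ1 he i j
  refine measure_lt_le_of_integral (integrable_finsetSum _ fun a _ => integrable_finsetSum _
    fun b _ => (h a b).1.integrable_sq) (fun ω => by positivity) (by positivity) ?_
  rw [integral_finsetSum _ fun a _ => integrable_finsetSum _ fun b _ => (h a b).1.integrable_sq]
  simp_rw [integral_finsetSum _ fun b _ => (h _ b).1.integrable_sq]
  calc _ ≤ ∑ a, ∑ b, 4 * w * (lagWeight a * lagWeight b * (1 - κ)⁻¹ ^ 4 / S.T) :=
        Finset.sum_le_sum fun a _ => Finset.sum_le_sum fun b _ => (h a b).2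
    _ = _ := by
        have h1 : ∀ a b : Coord S.p₁ S.p₂, 4 * w * (lagWeight a * lagWeight b * (1 - κ)⁻¹ ^ 4 / S.T)
          = 4 * w * (1 - κ)⁻¹ ^ 4 / S.T * lagWeight a * lagWeight b := fun a b => by ring
        simp_rw [h1, ← Finset.mul_sum, ← Finset.sum_mul, ← Finset.mul_sum, sum_lagWeight]
        ring

theorem exists_pos_forall_mul_le {A a : ℝ} (hA : 0 ≤ A) (ha : 0 < a) :
    ∃ x : ℝ, 0 < x ∧ ∀ y, 0 ≤ y → y ≤ x → A * y ≤ a := by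
  refine ⟨a / (A + 1), by positivity, fun y hy hyx => ?_⟩
  calc A * y ≤ (A + 1) * (a / (A + 1)) := by gcongr; linarith
    _ = a := by field_simp

theorem div_le_of_le_mul_sqrt {a t c : ℝ} (ht : 0 < t) (ha : 1 ≤ a) (hc : 0 < c) (hc1 : c ≤ 1 / 2)
    (h : a ≤ c * √t) : 0 < √t ∧ 1 < t ∧ a / t ≤ c ∧ a / t ≤ 1 / √t ∧ 1 / t ≤ 1 / √t := by
  have hs : 0 < √t := Real.sqrt_pos.2 ht
  have hs1 : 2 ≤ √t := by nlinarith
  have hsq : √t * √t = t := Real.mul_self_sqrt ht.le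
  have has : a ≤ √t := h.trans (by nlinarith)
  have hst : √t ≤ t := by nlinarith
  refine ⟨hs, by linarith, ?_, ?_, one_div_le_one_div_of_le hs hst⟩
  · rw [div_le_iff₀ ht]
    exact h.trans (by gcongr)
  · rw [div_le_div_iff₀ ht hs, one_mul]
    calc a * √t ≤ √t * √t := by gcongr
      _ = t := hsq

set_option maxHeartbeats 1000000 in
/-- Restricted eigenvalue property: if `m / √T` is small, the empirical Gram matrix of every node is
bounded below outside an event of probability `O(T^{-1/2})`. -/
theorem exists_gram_lower_bound (hR0 : 0 < R) (hτ : 0 < τ) (hσ : 0 < σ) (hK : 0 < K)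
    (hκ1 : κ < 1) : ∃ c₀ C : ℝ, 0 < c₀ ∧ c₀ ≤ 1 / 2 ∧ 0 ≤ C ∧ ∀ S : Setting.{u}, S.IsModel → 0 < S.T →
      S.ParameterSpace R → S.Convexity τ → S.Noise σ → S.Covariates K → S.Stationarity κ →
      S.m ≤ c₀ * √S.T → ∀ i j, ∃ bad : Set S.Ω, S.μ bad ≤ ENNReal.ofReal (C / √S.T) ∧
      ∀ᵐ ω ∂S.μ, ω ∉ bad → ∀ u : Coord S.p₁ S.p₂ → ℝ, τ / 32 * (u ⬝ᵥ u) ≤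
        (S.T : ℝ)⁻¹ * ∑ t ∈ Finset.range S.T, (∑ a, u a * S.regressor (t + 1) ω i j a) ^ 2 := by
  have hκ' : 0 < 1 - κ := by linarith
  set ξ := 3 * R / (1 - κ) + 1 with hξ
  set D := ((2 * K * R + 10 * σ) / (1 - κ)) ^ 2 with hD
  have hD0 : 0 ≤ D := sq_nonneg _
  set c := min (1 / 10) (τ / 160) with hcdef
  have hc : 0 < c := by positivity
  have hc1 : c ≤ 1 / 10 := min_le_left _ _
  have hc2 : c ≤ τ / 160 := min_le_right _ _
  -- The threshold `x₁` keeps the variance of the root of the covariate form below c/2, `x₂` lets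
  -- concentration beat the net, and `x₃` keeps the initial-value remainder below τ/4.
  obtain ⟨x₁, hx₁, h₁⟩ := exists_pos_forall_mul_le (A := 9 * ξ ^ 2 * K ^ 2) (by positivity) hc
  obtain ⟨x₂, hx₂, h₂⟩ := exists_pos_forall_mul_le (A := 5 * (144 * ξ ^ 2 * K ^ 2)) (by positivity)
    (sq_pos_of_pos hc)
  obtain ⟨x₃, hx₃, h₃⟩ := exists_pos_forall_mul_le (A := 3 * D / (1 - κ)) (by positivity)
    (show 0 < τ / 4 by positivity)
  -- Since m ≥ 1, the cap 1/2 forces √T ≥ 2, so T > 1 as the bound for the initial response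
  -- requires.
  set c₀ := min (1 / 2) (min x₁ (min x₂ x₃)) with hc₀def
  have hc₀ : 0 < c₀ := by positivity
  have hc₀1 : c₀ ≤ 1 / 2 := min_le_left _ _
  have hc₀x₁ : c₀ ≤ x₁ := (min_le_right _ _).trans (min_le_left _ _)
  have hc₀x₂ : c₀ ≤ x₂ := (min_le_right _ _).trans ((min_le_right _ _).trans (min_le_left _ _))
  have hc₀x₃ : c₀ ≤ x₃ := (min_le_right _ _).trans ((min_le_right _ _).trans (min_le_right _ _))
  -- `C₁`, `C₂`, `C₃` belong to the cross moments, the noise moments and the initial value. The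
  -- probabilities are O(m/T) or O(1/T), both at most O(1/√T) because m ≤ √T.
  set C₁ := 6 * (96 * (σ : ℝ) ^ 2) * (1 - κ)⁻¹ ^ 2 * K ^ 2 * ξ ^ 2 / c ^ 2 with hC₁
  set C₂ := 36 * (96 * (σ : ℝ) ^ 4) * (1 - κ)⁻¹ ^ 4 / c ^ 2 with hC₂
  set C₃ := 3 * D / (1 - κ) / c with hC₃
  have hC₁0 : 0 ≤ C₁ := by positivity
  have hC₂0 : 0 ≤ C₂ := by positivity
  have hC₃0 : 0 ≤ C₃ := by positivity
  refine ⟨c₀, 2 + C₁ + C₂ + C₃, hc₀, hc₀1, by positivity, ?_⟩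
  intro S hS hT hR hconv hε hx hκ hm i j
  have hT' : (0 : ℝ) < S.T := by exact_mod_cast hT
  have hm1 : (1 : ℝ) ≤ S.m := by exact_mod_cast (show 1 ≤ S.m by simp [m])
  obtain ⟨hs, hT1', hmT, hmT', hTT⟩ := div_le_of_le_mul_sqrt hT' hm1 hc₀ hc₀1 hm
  have hT1 : 1 < S.T := by exact_mod_cast hT1'
  obtain ⟨v, he, hv0, hv⟩ := hε.exists_isWhiteNoise hS hσ
  have hB := responseBound_nonneg (S := S) (σ := σ) hR0.le hK.le hκ1
  have hB2 : S.responseBound R K κ σ ^ 2 ≤ D * S.m := responseBound_sq_le hR0.le hK.le hκ1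
  have hY := fun i j => hconv.norm_Y₀_le hS hT1 hκ hκ1 hR0.le hR hσ hε hK hx i j
  have hBT : 3 * S.responseBound R K κ σ ^ 2 / (1 - κ) / S.T ≤ 3 * D / (1 - κ) * (S.m / S.T) := by
    calc _ ≤ 3 * (D * S.m) / (1 - κ) / S.T := by gcongr
      _ = _ := by ring
  have hmT0 : (0 : ℝ) ≤ S.m / S.T := by positivity
  have hmean := hconv.le_meanGram hS hT hκ hκ1 hB hY hK hx hε he
    (hBT.trans (h₃ _ hmT0 (hmT.trans hc₀x₃))) i j
  have e₁ := hx.measure_exists_covGram_le hS hT hκ hκ1 hR0.le hR hK i j hc (by linarith) hc₀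
    (by linarith) hm (h₁ c₀ hc₀.le hc₀x₁) (by linarith [h₂ c₀ hc₀.le hc₀x₂])
  have e₂ := hS.measure_crossGram_le hT hκ hκ1 hR0.le hR hK hx hε he hv0 i j hc
  have e₃ := hS.measure_noiseGram_le hT hκ hκ1 he i j hc
  have hI := hconv.integral_sum_initFeature_sq_le hS hT hκ hκ1 hB hY i j
  have e₄ := measure_lt_le_of_integral hI.1 (fun ω => by positivity) hc hI.2
  refine ⟨_ ∪ (_ ∪ (_ ∪ _)), (measure_union_le _ _).trans ((add_le_add e₁
    ((measure_union_le _ _).trans (add_le_add e₂ ((measure_union_le _ _).trans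
      (add_le_add e₃ e₄))))).trans ?_), ?_⟩
  · rw [← ENNReal.ofReal_add (by positivity) (by positivity),
      ← ENNReal.ofReal_add (by positivity) (by positivity),
      ← ENNReal.ofReal_add (by positivity) (by positivity)]
    refine ENNReal.ofReal_le_ofReal ?_
    have f₂ : 6 * v * (1 - κ)⁻¹ ^ 2 * K ^ 2 * ξ ^ 2 * (S.m / S.T) / c ^ 2 ≤ C₁ * (1 / √S.T) := by
      calc _ ≤ 6 * (96 * (σ : ℝ) ^ 2) * (1 - κ)⁻¹ ^ 2 * K ^ 2 * ξ ^ 2 * (1 / √S.T) / c ^ 2 := by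
            gcongr
        _ = _ := by rw [hC₁]; ring
    have f₃ : 36 * (96 * (σ : ℝ) ^ 4) * (1 - κ)⁻¹ ^ 4 / S.T / c ^ 2 ≤ C₂ * (1 / √S.T) := by
      calc _ = C₂ * (1 / S.T) := by rw [hC₂]; ring
        _ ≤ _ := by gcongr
    have f₄ : 3 * S.responseBound R K κ σ ^ 2 / (1 - κ) / S.T / c ≤ C₃ * (1 / √S.T) := by
      calc _ ≤ 3 * D / (1 - κ) * (1 / √S.T) / c := by
            gcongr
            exact hBT.trans (by gcongr)
        _ = _ := by rw [hC₃]; ring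
    calc _ ≤ 2 / √S.T + (C₁ * (1 / √S.T) + (C₂ * (1 / √S.T) + C₃ * (1 / √S.T))) := by gcongr
      _ = _ := by ring
  · filter_upwards [hS.ae_sum_mul_regressor i j] with ω hω hbad
    simp only [Set.mem_union, Set.mem_ofPred_eq, not_or, not_exists, not_lt] at hbad
    exact gram_lower_bound hT hτ hc hc1 hc2 i j hω hmean hv0 hbad.1 hbad.2.1 hbad.2.2.1 hbad.2.2.2

end Setting

/-! ### Martingale bound for the scores -/

theorem integral_add_mul_sq {Ω : Type*} [MeasurableSpace Ω] {μ : Measure Ω} {P e X : Ω → ℝ}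
    (hP : MemLp P 2 μ) (he : MemLp e 2 μ) (hX : MemLp X 2 μ) (he1 : Integrable e μ)
    (heX : IndepFun e X μ) (hePX : IndepFun e (fun ω => P ω * X ω) μ) (he0 : ∫ ω, e ω ∂μ = 0) :
    MemLp (fun ω => P ω + e ω * X ω) 2 μ ∧
      ∫ ω, (P ω + e ω * X ω) ^ 2 ∂μ = ∫ ω, P ω ^ 2 ∂μ + (∫ ω, e ω ^ 2 ∂μ) * ∫ ω, X ω ^ 2 ∂μ := by
  have hsq : IndepFun (fun ω => e ω ^ 2) (fun ω => X ω ^ 2) μ :=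
    heX.comp (φ := fun y : ℝ => y ^ 2) (ψ := fun y : ℝ => y ^ 2) (by fun_prop) (by fun_prop)
  have i1 : Integrable (fun ω => e ω ^ 2 * X ω ^ 2) μ :=
    hsq.integrable_mul he.integrable_sq hX.integrable_sq
  have i2 : Integrable (fun ω => P ω * X ω) μ := hP.integrable_mul hX
  have i3 : Integrable (fun ω => e ω * (P ω * X ω)) μ := hePX.integrable_mul he1 i2
  have hm : MemLp (fun ω => e ω * X ω) 2 μ := by
    refine (memLp_two_iff_integrable_sq (he.1.mul hX.1)).2 ?_
    simpa only [Pi.mul_apply, mul_pow] using i1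
  refine ⟨hP.add hm, ?_⟩
  have h1 : ∫ ω, e ω ^ 2 * X ω ^ 2 ∂μ = (∫ ω, e ω ^ 2 ∂μ) * ∫ ω, X ω ^ 2 ∂μ :=
    hsq.integral_fun_mul_eq_mul_integral he.integrable_sq.1 hX.integrable_sq.1
  -- Orthogonality of martingale increments: `e` is centered and independent of the product of the
  -- past sum and the new regressor.
  have h2 : ∫ ω, e ω * (P ω * X ω) ∂μ = 0 := by
    rw [hePX.integral_fun_mul_eq_mul_integral he.1 i2.1, he0, zero_mul]
  have h3 : ∀ ω, (P ω + e ω * X ω) ^ 2 = P ω ^ 2 + 2 * (e ω * (P ω * X ω)) + e ω ^ 2 * X ω ^ 2 :=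
    fun ω => by ring
  have i4 : Integrable (fun ω => P ω ^ 2 + 2 * (e ω * (P ω * X ω))) μ :=
    hP.integrable_sq.add (i3.const_mul 2)
  simp_rw [h3]
  rw [integral_add i4 i1, integral_add hP.integrable_sq (i3.const_mul 2), integral_const_mul, h1, h2]
  ring

namespace Setting

variable {S : Setting.{u}} {κ R K τ B : ℝ} {σ : ℝ≥0}

/-- The cross product of noise and regressor, summed over the first `s` times. -/
def score (S : Setting.{u}) (i : Fin S.N₁) (j : Fin S.N₂) (a : Coord S.p₁ S.p₂) (s : ℕ) (ω : S.Ω) :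
    ℝ :=
  ∑ t ∈ Finset.range s, S.ε (t + 1) ω i j * S.regressor (t + 1) ω i j a

/-- The σ-algebra is arbitrary so that the statement applies to the one generated by the past, not
only to the ambient one. -/
theorem measurable_regressor {𝓕 : MeasurableSpace S.Ω} {t : ℕ} (hY : Measurable[𝓕] (S.Y t))
    (hx : Measurable[𝓕] (S.x (t + 1))) (hz : Measurable[𝓕] (S.z (t + 1))) (i : Fin S.N₁)
    (j : Fin S.N₂) (a : Coord S.p₁ S.p₂) :
    Measurable[𝓕] fun ω => S.regressor (t + 1) ω i j a := by
  have hY' : ∀ k l, Measurable[𝓕] fun ω => S.Y t ω k l := fun k l =>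
    measurable_pi_iff.1 (measurable_pi_iff.1 hY k) l
  rcases a with (a | a) | (a | a) | a
  · exact Finset.measurable_fun_sum Finset.univ fun k _ => (hY' k j).const_mul (rowNormalize S.A₁ i k)
  · exact measurable_pi_iff.1 (measurable_pi_iff.1 hx i) a
  · exact Finset.measurable_fun_sum Finset.univ fun k _ => (hY' i k).mul_const (colNormalize S.A₂ k j)
  · exact measurable_pi_iff.1 (measurable_pi_iff.1 hz j) a
  · exact hY' i j

theorem measurable_residual {𝓕 : MeasurableSpace S.Ω} {t : ℕ} (hY : Measurable[𝓕] (S.Y t))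
    (hY' : Measurable[𝓕] (S.Y (t + 1)))
    (hx : Measurable[𝓕] (S.x (t + 1))) (hz : Measurable[𝓕] (S.z (t + 1))) (i : Fin S.N₁)
    (j : Fin S.N₂) :
    Measurable[𝓕] fun ω => S.Y (t + 1) ω i j - S.fitted S.θ₀ (t + 1) ω i j := by
  simp_rw [fitted_eq]
  exact (measurable_pi_iff.1 (measurable_pi_iff.1 hY' i) j).sub
    (Finset.measurable_fun_sum _ fun a _ => (measurable_regressor hY hx hz i j a).mul_const _)

/-- The noise at time `s + 1` is independent of every function of the regressors up to that time and
of the responses up to time `s`. -/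
theorem Noise.indepFun_of_measurable (hε : S.Noise σ) {s : ℕ} (hs : s < S.T) (i : Fin S.N₁)
    (j : Fin S.N₂) {Z : S.Ω → ℝ}
    (hZ : ∀ 𝓕 : MeasurableSpace S.Ω, (∀ r ≤ s, Measurable[𝓕] (S.Y r)) →
      (∀ r ≤ s + 1, Measurable[𝓕] (S.x r)) → (∀ r ≤ s + 1, Measurable[𝓕] (S.z r)) →
      Measurable[𝓕] Z) : IndepFun (fun ω => S.ε (s + 1) ω i j) Z S.μ := by
  have h := hε.indep_past (s + 1) (by simp; omega) i j
  rw [IndepFun_iff_Indep] at h ⊢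
  have h0 := comap_measurable (m := inferInstance) (fun ω => ((fun s' : Fin (s + 1) => S.Y s' ω),
    (fun s' : Fin (s + 1 + 1) => S.x s' ω), (fun s' : Fin (s + 1 + 1) => S.z s' ω)))
  refine indep_of_indep_of_le_right h (Measurable.comap_le (hZ _ ?_ ?_ ?_))
  all_goals intro r hr
  · exact (@measurable_pi_iff _ _ _ (_) _ _).1 h0.fst ⟨r, by omega⟩
  · exact (@measurable_pi_iff _ _ _ (_) _ _).1 h0.snd.fst ⟨r, by omega⟩
  · exact (@measurable_pi_iff _ _ _ (_) _ _).1 h0.snd.snd ⟨r, by omega⟩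

/-- The independence hypothesis speaks of past responses and covariates, not of past noise.
Replacing past noise by model residuals makes the score a function of that past. -/
theorem IsModel.ae_score_eq (hS : S.IsModel) {s : ℕ} (hs : s ≤ S.T) (i : Fin S.N₁)
    (j : Fin S.N₂) (a : Coord S.p₁ S.p₂) : S.score i j a s =ᵐ[S.μ] fun ω =>
      ∑ t ∈ Finset.range s,
        (S.Y (t + 1) ω i j - S.fitted S.θ₀ (t + 1) ω i j) * S.regressor (t + 1) ω i j a := by
  filter_upwards [hS.equation] with ω hω
  refine Finset.sum_congr rfl fun t ht => ?_
  rw [hω (t + 1) (by simp at ht ⊢; omega), add_sub_cancel_left]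

/-- Every time step adds E ε² · E 𝒳² to the second moment, and E 𝒳² does not depend on time. -/
theorem integral_score_sq_le (hS : S.IsModel) (hc : S.Convexity τ) (hσ : 0 < σ) (hε : S.Noise σ)
    (i : Fin S.N₁) (j : Fin S.N₂) (a : Coord S.p₁ S.p₂) {s : ℕ} (hs : s ≤ S.T) :
    MemLp (S.score i j a s) 2 S.μ ∧ ∫ ω, S.score i j a s ω ^ 2 ∂S.μ ≤
      s * (96 * σ ^ 2 * ∫ ω, S.regressor 1 ω i j a ^ 2 ∂S.μ) := by
  have hprob := hS.prob
  induction s with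
  | zero =>
    have h0 : S.score i j a 0 = fun _ => 0 := by ext; simp [score]
    simp [h0]
  | succ s ih =>
    obtain ⟨hP, hI⟩ := ih (by omega)
    have ht : s + 1 ∈ Finset.Icc 1 S.T := by simp; omega
    have hsub := hε.subGaussian _ ht i j
    have he : MemLp (fun ω => S.ε (s + 1) ω i j) 2 S.μ := by simpa using hsub.memLp 2
    have hX := hc.memLp _ ht i j a
    have hPr := hS.ae_score_eq (s := s) (by omega) i j a
    have hP' := hP.ae_eq hPr
    have heX : IndepFun (fun ω => S.ε (s + 1) ω i j) (fun ω => S.regressor (s + 1) ω i j a) S.μ :=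
      hε.indepFun_of_measurable hs i j fun 𝓕 hY hx hz =>
        measurable_regressor (hY _ le_rfl) (hx _ le_rfl) (hz _ le_rfl) i j a
    have hePX := hε.indepFun_of_measurable hs i j (Z := fun ω => (∑ t ∈ Finset.range s,
        (S.Y (t + 1) ω i j - S.fitted S.θ₀ (t + 1) ω i j) * S.regressor (t + 1) ω i j a) *
          S.regressor (s + 1) ω i j a) fun 𝓕 hY hx hz => by
      refine Measurable.mul (Finset.measurable_fun_sum _ fun t ht => ?_)
        (measurable_regressor (hY _ le_rfl) (hx _ le_rfl) (hz _ le_rfl) i j a)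
      have := Finset.mem_range.1 ht
      exact (measurable_residual (hY _ (by omega)) (hY _ (by omega)) (hx _ (by omega))
        (hz _ (by omega)) i j).mul
        (measurable_regressor (hY _ (by omega)) (hx _ (by omega)) (hz _ (by omega)) i j a)
    obtain ⟨h1, h2⟩ := integral_add_mul_sq hP' he hX (he.integrable (by norm_num)) heX hePX
      (hε.mean_zero _ ht i j)
    have hae : S.score i j a (s + 1) =ᵐ[S.μ] fun ω => (∑ t ∈ Finset.range s,
        (S.Y (t + 1) ω i j - S.fitted S.θ₀ (t + 1) ω i j) * S.regressor (t + 1) ω i j a) +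
          S.ε (s + 1) ω i j * S.regressor (s + 1) ω i j a := by
      filter_upwards [hPr] with ω hω
      rw [← hω, score, Finset.sum_range_succ, score]
    refine ⟨h1.ae_eq hae.symm, ?_⟩
    have h3 : ∫ ω, S.score i j a (s + 1) ω ^ 2 ∂S.μ = _ :=
      (integral_congr_ae (hae.mono fun ω h => by simp only [h])).trans h2
    have h4 := integral_congr_ae (hPr.mono fun ω h => congrArg (· ^ 2) h)
    rw [h3, ← h4, hc.integral_sq_eq hs i j a]
    have h5 := (integral_sq_pow_four_le_of_subgaussian hσ hsub).1
    have h6 : 0 ≤ ∫ ω, S.regressor 1 ω i j a ^ 2 ∂S.μ := integral_nonneg fun _ => sq_nonneg _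
    push_cast
    rw [add_mul, one_mul]
    gcongr

/-- The averaged scores of a node are `O(m / √T)` in mean. -/
theorem exists_sum_integral_abs_score_le (hR0 : 0 < R) (hσ : 0 < σ) (hK : 0 < K) (hκ1 : κ < 1) :
    ∃ C : ℝ, 0 ≤ C ∧ ∀ S : Setting.{u}, S.IsModel → 1 < S.T → S.ParameterSpace R →
      S.Convexity τ → S.Noise σ → S.Covariates K → S.Stationarity κ → ∀ i j,
      (∀ a, Integrable (fun ω => |S.score i j a S.T ω|) S.μ) ∧
      ∑ a, (S.T : ℝ)⁻¹ * ∫ ω, |S.score i j a S.T ω| ∂S.μ ≤ C * (S.m / √S.T) := by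
  have hκ' : 0 < 1 - κ := by linarith
  set D := (2 * K * R + 10 * σ) / (1 - κ) with hD
  have hD0 : 0 ≤ D := by positivity
  refine ⟨10 * σ * (3 * D + 2 * K), by positivity, fun S hS hT hR hc hε hx hκ i j => ?_⟩
  have hprob := hS.prob
  have hT' : (0 : ℝ) < S.T := by exact_mod_cast hT.le
  have hm1 : (1 : ℝ) ≤ S.m := by exact_mod_cast (show 1 ≤ S.m by simp [m])
  set B := S.responseBound R K κ σ
  have hB0 : 0 ≤ B := responseBound_nonneg hR0.le hK.le hκ1
  have hB : B ≤ D * S.m := by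
    refine abs_le_of_sq_le_sq' ((responseBound_sq_le hR0.le hK.le hκ1).trans ?_) (by positivity) |>.2
    rw [mul_pow]
    gcongr
    nlinarith
  have hsc := fun a => integral_score_sq_le hS hc hσ hε i j a le_rfl
  refine ⟨fun a => ((hsc a).1.integrable (by norm_num)).abs, ?_⟩
  -- The mean of |score| is at most its root mean square; 96 ≤ 10² gives the factor 10σ.
  have hE : ∀ a, ∫ ω, |S.score i j a S.T ω| ∂S.μ ≤ √S.T * (10 * σ) * (lagWeight a * B + 2 * K) := by
    intro a
    have hl : 0 ≤ lagWeight a := lagWeight_nonneg a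
    refine abs_le_of_sq_le_sq' ?_ (by positivity) |>.2
    have h1 : (∫ ω, |S.score i j a S.T ω| ∂S.μ) ^ 2 ≤ ∫ ω, S.score i j a S.T ω ^ 2 ∂S.μ := by
      have := ProbabilityTheory.variance_nonneg (fun ω => |S.score i j a S.T ω|) S.μ
      rw [ProbabilityTheory.variance_eq_sub (X := fun ω => |S.score i j a S.T ω|) (hsc a).1.abs] at this
      simpa [sq_abs] using this
    have h2 := hc.integral_regressor_sq_le hS hT.le hK hx hB0
      (fun i j => hc.norm_Y₀_le hS hT hκ hκ1 hR0.le hR hσ hε hK hx i j) i j a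
    calc _ ≤ S.T * (96 * σ ^ 2 * (lagWeight a * B + 2 * K) ^ 2) := (h1.trans (hsc a).2).trans (by gcongr)
      _ ≤ S.T * (100 * σ ^ 2 * (lagWeight a * B + 2 * K) ^ 2) := by gcongr; norm_num
      _ = _ := by rw [mul_pow, mul_pow, Real.sq_sqrt hT'.le]; ring
  calc _ ≤ ∑ a, (S.T : ℝ)⁻¹ * (√S.T * (10 * σ) * (lagWeight a * B + 2 * K)) := by
        gcongr with a; exact hE a
    -- Only the three lag coordinates carry B, which is at most of order m; each coordinate adds a
    -- constant. The sum is therefore O(m), not O(m²).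
    _ = 10 * σ * (3 * B + 2 * K * S.m) * (√S.T / S.T) := by
        simp_rw [← Finset.mul_sum, Finset.sum_add_distrib, ← Finset.sum_mul, sum_lagWeight]
        rw [Finset.sum_const, Finset.card_univ, card_coord, nsmul_eq_mul]
        ring
    _ ≤ 10 * σ * (3 * (D * S.m) + 2 * K * S.m) * (√S.T / S.T) := by gcongr
    _ = _ := by rw [Real.sqrt_div_self']; ring

end Setting

/-! ### Basic inequality and domination of the pseudo-distance -/

/-- View parameters with `G₀` and `H₀` groups as parameters with more groups, the additional ones
being empty. -/
def Grouped.pad {N₁ N₂ p₁ p₂ G₀ H₀ G H : ℕ} (hG : G₀ ≤ G) (hH : H₀ ≤ H)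
    (θ : Grouped N₁ N₂ p₁ p₂ G₀ H₀) : Grouped N₁ N₂ p₁ p₂ G H where
  par :=
    { lam := fun g => if hg : g.1 < G₀ then θ.par.lam ⟨g, hg⟩ else 0
      zeta := fun g => if hg : g.1 < G₀ then θ.par.zeta ⟨g, hg⟩ else 0
      gam := fun h => if hh : h.1 < H₀ then θ.par.gam ⟨h, hh⟩ else 0
      delta := fun h => if hh : h.1 < H₀ then θ.par.delta ⟨h, hh⟩ else 0
      alpha := fun g h => if hgh : g.1 < G₀ ∧ h.1 < H₀ then
        θ.par.alpha ⟨g, hgh.1⟩ ⟨h, hgh.2⟩ else 0 }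
  g := fun i => (θ.g i).castLE hG
  h := fun j => (θ.h j).castLE hH

theorem Grouped.tensor_pad {N₁ N₂ p₁ p₂ G₀ H₀ G H : ℕ} (hG : G₀ ≤ G) (hH : H₀ ≤ H)
    (θ : Grouped N₁ N₂ p₁ p₂ G₀ H₀) : (θ.pad hG hH).tensor = θ.tensor := by
  funext i j a
  rcases a with (a | a) | (a | a) | a <;> simp [Grouped.tensor, Grouped.pad]

theorem pseudoDist_le {N₁ N₂ p₁ p₂ : ℕ} {Θ Θ' : Fin N₁ → Fin N₂ → Coord p₁ p₂ → ℝ}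
    {c : ℝ} (h₁ : 0 < N₁) (h₂ : 0 < N₂)
    (hΔ : ∀ i j, ∑ a, (Θ i j a - Θ' i j a) ^ 2 ≤ c) :
    pseudoDist Θ Θ' ≤ c := by
  have h₁' : (0 : ℝ) < N₁ := by exact_mod_cast h₁
  have h₂' : (0 : ℝ) < N₂ := by exact_mod_cast h₂
  calc _ ≤ 1 / ((N₁ : ℝ) * N₂) * ∑ _i : Fin N₁, ∑ _j : Fin N₂, c := by
        rw [pseudoDist]
        gcongr with i _ j
        exact hΔ i j
    _ = c := by simp; field_simp

namespace Setting

variable {S : Setting.{u}} {κ R K τ : ℝ} {σ : ℝ≥0}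

/-- The basic inequality of least squares. -/
theorem IsLeastSquares.sum_sq_le {G H : ℕ} (hG : S.G₀ ≤ G) (hH : S.H₀ ≤ H)
    (hR : S.ParameterSpace R) {ω : S.Ω}
    (hω : ∀ t ∈ Finset.Icc 1 S.T, ∀ i j, S.Y t ω i j = S.fitted S.θ₀ t ω i j + S.ε t ω i j)
    {θ : Grouped S.N₁ S.N₂ S.p₁ S.p₂ G H} (hθ : S.IsLeastSquares R ω θ) :
    ∑ i, ∑ j, ∑ t ∈ Finset.range S.T,
        (∑ a, (θ.tensor i j a - S.θ₀.tensor i j a) * S.regressor (t + 1) ω i j a) ^ 2 ≤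
      2 * ∑ i, ∑ j, ∑ a, (θ.tensor i j a - S.θ₀.tensor i j a) * S.score i j a S.T ω := by
  -- The constraint concerns the tensor only, which padding with empty groups leaves unchanged, so
  -- the truth is a feasible competitor.
  have hQ := hθ.2 (S.θ₀.pad hG hH) fun i j a => by
    rw [Grouped.tensor_pad]; exact (hR i j a).le
  have hIcc : ∀ f : ℕ → ℝ, ∑ t ∈ Finset.Icc 1 S.T, f t = ∑ t ∈ Finset.range S.T, f (t + 1) := by
    intro f
    rw [Finset.range_eq_Ico, Finset.sum_Ico_add' f 0 S.T 1, zero_add]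
    rfl
  have hres : ∀ t ∈ Finset.range S.T, ∀ i j, S.Y (t + 1) ω i j - S.fitted θ (t + 1) ω i j =
      S.ε (t + 1) ω i j -
        ∑ a, (θ.tensor i j a - S.θ₀.tensor i j a) * S.regressor (t + 1) ω i j a := by
    intro t ht i j
    rw [hω (t + 1) (by simp at ht ⊢; omega), fitted_eq, fitted_eq]
    simp_rw [sub_mul, Finset.sum_sub_distrib, mul_comm (S.regressor _ _ _ _ _)]
    ring
  have hres0 : ∀ t ∈ Finset.range S.T, ∀ i j,
      S.Y (t + 1) ω i j - S.fitted (S.θ₀.pad hG hH) (t + 1) ω i j = S.ε (t + 1) ω i j := by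
    intro t ht i j
    rw [hω (t + 1) (by simp at ht ⊢; omega), fitted_eq, fitted_eq, Grouped.tensor_pad,
      add_sub_cancel_left]
  have h1 : S.Q ω θ = ∑ i, ∑ j, ∑ t ∈ Finset.range S.T, (S.ε (t + 1) ω i j -
      ∑ a, (θ.tensor i j a - S.θ₀.tensor i j a) * S.regressor (t + 1) ω i j a) ^ 2 := by
    simp_rw [Q, hIcc]
    refine Finset.sum_congr rfl fun i _ => Finset.sum_congr rfl fun j _ =>
      Finset.sum_congr rfl fun t ht => by rw [hres t ht]
  have h0 : S.Q ω (S.θ₀.pad hG hH) = ∑ i, ∑ j, ∑ t ∈ Finset.range S.T, S.ε (t + 1) ω i j ^ 2 := by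
    simp_rw [Q, hIcc]
    refine Finset.sum_congr rfl fun i _ => Finset.sum_congr rfl fun j _ =>
      Finset.sum_congr rfl fun t ht => by rw [hres0 t ht]
  have hsc : ∀ i j, ∑ a, (θ.tensor i j a - S.θ₀.tensor i j a) * S.score i j a S.T ω =
      ∑ t ∈ Finset.range S.T, S.ε (t + 1) ω i j *
        ∑ a, (θ.tensor i j a - S.θ₀.tensor i j a) * S.regressor (t + 1) ω i j a := by
    intro i j
    simp_rw [score, Finset.mul_sum]
    rw [Finset.sum_comm]
    exact Finset.sum_congr rfl fun t _ => Finset.sum_congr rfl fun a _ => by ring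
  rw [h1, h0] at hQ
  simp_rw [sub_sq, Finset.sum_add_distrib, Finset.sum_sub_distrib, mul_assoc,
    ← Finset.mul_sum] at hQ
  simp_rw [hsc]
  linarith

theorem sum_tensor_sub_sq_le {G H : ℕ} (hR : S.ParameterSpace R)
    {θ : Grouped S.N₁ S.N₂ S.p₁ S.p₂ G H} (hθ : ∀ i j a, |θ.tensor i j a| ≤ R)
    (i : Fin S.N₁) (j : Fin S.N₂) :
    (∀ a, |θ.tensor i j a - S.θ₀.tensor i j a| ≤ 2 * R) ∧
      ∑ a, (θ.tensor i j a - S.θ₀.tensor i j a) ^ 2 ≤ 4 * R ^ 2 * S.m := by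
  have h : ∀ a, |θ.tensor i j a - S.θ₀.tensor i j a| ≤ 2 * R := fun a =>
    (abs_sub _ _).trans (by linarith [hθ i j a, (hR i j a).le])
  refine ⟨h, ?_⟩
  calc _ ≤ ∑ _a : Coord S.p₁ S.p₂, (2 * R) ^ 2 :=
        Finset.sum_le_sum fun a _ => sq_le_sq' (abs_le.1 (h a)).1 (abs_le.1 (h a)).2
    _ = _ := by
        rw [Finset.sum_const, Finset.card_univ, card_coord, nsmul_eq_mul]
        ring

/-- On an event where the basic inequality holds, the pseudo-distance is controlled by the scores and
by the fraction of nodes with a degenerate Gram matrix. -/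
theorem IsLeastSquares.pseudoDist_le {G H : ℕ} (hτ : 0 < τ) (hT : 0 < S.T) (hG : S.G₀ ≤ G)
    (hH : S.H₀ ≤ H) (hR : S.ParameterSpace R) {ω : S.Ω} {bad : Fin S.N₁ → Fin S.N₂ → Set S.Ω}
    (hω : ∀ t ∈ Finset.Icc 1 S.T, ∀ i j, S.Y t ω i j = S.fitted S.θ₀ t ω i j + S.ε t ω i j)
    (hbad : ∀ i j, ω ∉ bad i j → ∀ u : Coord S.p₁ S.p₂ → ℝ, τ / 32 * (u ⬝ᵥ u) ≤
        (S.T : ℝ)⁻¹ * ∑ t ∈ Finset.range S.T, (∑ a, u a * S.regressor (t + 1) ω i j a) ^ 2)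
    {θ : Grouped S.N₁ S.N₂ S.p₁ S.p₂ G H} (hθ : S.IsLeastSquares R ω θ) :
    pseudoDist θ.tensor S.θ₀.tensor ≤ 1 / ((S.N₁ : ℝ) * S.N₂) * ∑ i, ∑ j,
      (128 * R / τ * ∑ a, (S.T : ℝ)⁻¹ * |S.score i j a S.T ω| +
        4 * R ^ 2 * S.m * (bad i j).indicator (fun _ => 1) ω) := by
  have hT' : (0 : ℝ) < S.T := by exact_mod_cast hT
  rw [pseudoDist]
  gcongr ?_ * ?_
  -- The basic inequality holds only after summation over all nodes. Hence the quadratic term is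
  -- kept at bad nodes too, where it is merely nonnegative and the diameter bound 4R²m does the
  -- work.
  have hnode : ∀ i j, ∑ a, (θ.tensor i j a - S.θ₀.tensor i j a) ^ 2 ≤
      32 / τ * (S.T : ℝ)⁻¹ * ∑ t ∈ Finset.range S.T,
        (∑ a, (θ.tensor i j a - S.θ₀.tensor i j a) * S.regressor (t + 1) ω i j a) ^ 2 +
      4 * R ^ 2 * S.m * (bad i j).indicator (fun _ => 1) ω := by
    intro i j
    by_cases hb : ω ∈ bad i j
    · rw [Set.indicator_of_mem hb, mul_one]
      have := (sum_tensor_sub_sq_le hR hθ.1 i j).2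
      have h0 : 0 ≤ 32 / τ * (S.T : ℝ)⁻¹ * ∑ t ∈ Finset.range S.T,
        (∑ a, (θ.tensor i j a - S.θ₀.tensor i j a) * S.regressor (t + 1) ω i j a) ^ 2 := by
        positivity
      linarith
    · rw [Set.indicator_of_notMem hb, mul_zero, add_zero]
      have h := hbad i j hb fun a => θ.tensor i j a - S.θ₀.tensor i j a
      simp only [dotProduct, ← pow_two] at h
      calc _ = 32 / τ * (τ / 32 * ∑ a, (θ.tensor i j a - S.θ₀.tensor i j a) ^ 2) := by
            field_simp
        _ ≤ _ := mul_le_mul_of_nonneg_left h (by positivity)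
        _ = _ := by ring
  have hscore : ∀ i j, ∑ a, (θ.tensor i j a - S.θ₀.tensor i j a) * S.score i j a S.T ω ≤
      ∑ a, 2 * R * |S.score i j a S.T ω| := by
    intro i j
    refine Finset.sum_le_sum fun a _ => (le_abs_self _).trans ?_
    rw [abs_mul]
    gcongr
    exact (sum_tensor_sub_sq_le hR hθ.1 i j).1 a
  have hbasic := hθ.sum_sq_le hG hH hR hω
  calc _ ≤ ∑ i, ∑ j, (32 / τ * (S.T : ℝ)⁻¹ * ∑ t ∈ Finset.range S.T,
          (∑ a, (θ.tensor i j a - S.θ₀.tensor i j a) * S.regressor (t + 1) ω i j a) ^ 2 +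
        4 * R ^ 2 * S.m * (bad i j).indicator (fun _ => 1) ω) :=
        Finset.sum_le_sum fun i _ => Finset.sum_le_sum fun j _ => hnode i j
    _ = 32 / τ * (S.T : ℝ)⁻¹ * ∑ i, ∑ j, ∑ t ∈ Finset.range S.T,
          (∑ a, (θ.tensor i j a - S.θ₀.tensor i j a) * S.regressor (t + 1) ω i j a) ^ 2 +
        ∑ i, ∑ j, 4 * R ^ 2 * S.m * (bad i j).indicator (fun _ => 1) ω := by
        simp_rw [Finset.sum_add_distrib, ← Finset.mul_sum]
    -- The constant arises as 128R/τ = 32/τ · 2 · 2R, with |Δ| ≤ 2R used coordinatewise.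
    _ ≤ 32 / τ * (S.T : ℝ)⁻¹ * (2 * ∑ i, ∑ j, ∑ a, 2 * R * |S.score i j a S.T ω|) +
        ∑ i, ∑ j, 4 * R ^ 2 * S.m * (bad i j).indicator (fun _ => 1) ω := by
        gcongr
        exact hbasic.trans (mul_le_mul_of_nonneg_left (Finset.sum_le_sum fun i _ =>
          Finset.sum_le_sum fun j _ => hscore i j) two_pos.le)
    _ = _ := by
        simp_rw [Finset.sum_add_distrib, ← Finset.mul_sum]
        ring

/-- The pseudo-distance of a least squares estimator is dominated by a random variable of mean
`O(m / √T)`. -/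
theorem exists_dominating (hR0 : 0 < R) (hτ : 0 < τ) (hσ : 0 < σ) (hK : 0 < K) (hκ1 : κ < 1) :
    ∃ c₀ C : ℝ, 0 < c₀ ∧ 0 ≤ C ∧ ∀ S : Setting.{u}, S.IsModel → 0 < S.T →
      S.ParameterSpace R → S.Convexity τ → S.Noise σ → S.Covariates K → S.Stationarity κ →
      S.m ≤ c₀ * √S.T → 0 < S.N₁ → 0 < S.N₂ → ∃ W : S.Ω → ℝ, Integrable W S.μ ∧ (∀ ω, 0 ≤ W ω) ∧
      ∫ ω, W ω ∂S.μ ≤ C * (S.m / √S.T) ∧ ∀ᵐ ω ∂S.μ, ∀ G H, S.G₀ ≤ G → S.H₀ ≤ H →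
        ∀ θ : Grouped S.N₁ S.N₂ S.p₁ S.p₂ G H, S.IsLeastSquares R ω θ →
        pseudoDist θ.tensor S.θ₀.tensor ≤ W ω := by
  obtain ⟨c₀, C₁, hc₀, hc₀1, hC₁, hgram⟩ := exists_gram_lower_bound.{u} hR0 hτ hσ hK hκ1
  obtain ⟨C₂, hC₂, hscore⟩ := exists_sum_integral_abs_score_le.{u} (τ := τ) hR0 hσ hK hκ1
  refine ⟨c₀, 128 * R / τ * C₂ + 4 * R ^ 2 * C₁, hc₀, by positivity,
    fun S hS hT hR hc hε hx hκ hm h₁ h₂ => ?_⟩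
  have hprob := hS.prob
  have hT' : (0 : ℝ) < S.T := by exact_mod_cast hT
  have hm1 : (1 : ℝ) ≤ S.m := by exact_mod_cast (show 1 ≤ S.m by simp [m])
  obtain ⟨hs, hT1', -⟩ := div_le_of_le_mul_sqrt hT' hm1 hc₀ hc₀1 hm
  have hT1 : 1 < S.T := by exact_mod_cast hT1'
  have h₁' : (0 : ℝ) < S.N₁ := by exact_mod_cast h₁
  have h₂' : (0 : ℝ) < S.N₂ := by exact_mod_cast h₂
  choose bad hbad hlow using hgram S hS hT hR hc hε hx hκ hm
  have hsc := hscore S hS hT1 hR hc hε hx hκ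
  -- Bad sets need not be measurable, so their measurable hulls, of equal measure, are used. Nothing
  -- here depends on the estimator, so its measurability is irrelevant.
  let V : Fin S.N₁ → Fin S.N₂ → S.Ω → ℝ := fun i j ω =>
    128 * R / τ * ∑ a, (S.T : ℝ)⁻¹ * |S.score i j a S.T ω| +
      4 * R ^ 2 * S.m * (toMeasurable S.μ (bad i j)).indicator (fun _ => 1) ω
  have i1 : ∀ i j, Integrable (fun ω => 128 * R / τ * ∑ a, (S.T : ℝ)⁻¹ * |S.score i j a S.T ω|)
      S.μ := fun i j =>
    (integrable_finsetSum _ fun a _ => ((hsc i j).1 a).const_mul _).const_mul _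
  have i2 : ∀ i j, Integrable (fun ω => 4 * R ^ 2 * S.m *
      (toMeasurable S.μ (bad i j)).indicator (fun _ => (1 : ℝ)) ω) S.μ := fun i j =>
    ((integrable_const (1 : ℝ)).indicator (measurableSet_toMeasurable _ _)).const_mul _
  have hVi : ∀ i j, Integrable (V i j) S.μ := fun i j => (i1 i j).add (i2 i j)
  have hVI : ∀ i j, ∫ ω, V i j ω ∂S.μ ≤
      (128 * R / τ * C₂ + 4 * R ^ 2 * C₁) * (S.m / √S.T) := by
    intro i j
    rw [integral_add (i1 i j) (i2 i j), integral_const_mul, integral_const_mul,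
      integral_finsetSum _ fun a _ => ((hsc i j).1 a).const_mul _]
    simp_rw [integral_const_mul]
    rw [integral_indicator_const _ (measurableSet_toMeasurable _ _), smul_eq_mul, mul_one,
      measureReal_def, measure_toMeasurable]
    have hb : (S.μ (bad i j)).toReal ≤ C₁ / √S.T :=
      ENNReal.toReal_le_of_le_ofReal (by positivity) (hbad i j)
    calc _ ≤ 128 * R / τ * (C₂ * (S.m / √S.T)) + 4 * R ^ 2 * S.m * (C₁ / √S.T) := by
          gcongr
          exact (hsc i j).2
      _ = _ := by ring
  have hV0 : ∀ i j ω, 0 ≤ V i j ω := fun i j ω => by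
    have : 0 ≤ (toMeasurable S.μ (bad i j)).indicator (fun _ => (1 : ℝ)) ω :=
      Set.indicator_nonneg (fun _ _ => zero_le_one) _
    positivity
  refine ⟨fun ω => 1 / ((S.N₁ : ℝ) * S.N₂) * ∑ i, ∑ j, V i j ω,
    (integrable_finsetSum _ fun i _ => integrable_finsetSum _ fun j _ => hVi i j).const_mul _,
    fun ω => mul_nonneg (by positivity)
      (Finset.sum_nonneg fun i _ => Finset.sum_nonneg fun j _ => hV0 i j ω), ?_, ?_⟩
  · rw [integral_const_mul,
      integral_finsetSum _ fun i _ => integrable_finsetSum _ fun j _ => hVi i j]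
    simp_rw [integral_finsetSum _ fun j _ => hVi _ j]
    calc _ ≤ 1 / ((S.N₁ : ℝ) * S.N₂) * ∑ _i : Fin S.N₁, ∑ _j : Fin S.N₂,
          (128 * R / τ * C₂ + 4 * R ^ 2 * C₁) * (S.m / √S.T) := by
          gcongr with i _ j
          exact hVI i j
      _ = _ := by
          simp only [Finset.sum_const, Finset.card_univ, Fintype.card_fin, nsmul_eq_mul]
          field_simp
  · filter_upwards [hS.equation, ae_all_iff.2 fun i => ae_all_iff.2 fun j => hlow i j]
      with ω hω hl G H hG hH θ hθ
    exact hθ.pseudoDist_le hτ hT hG hH hR hω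
      fun i j hb => hl i j fun h => hb (subset_toMeasurable _ _ h)

end Setting

end GMNAR

end

/-! ### The rate, uniformly over the sequence -/

theorem theorem1
    -- an arbitrary sequence of instances of the model, and specified group numbers
    (S : ℕ → GMNAR.Setting) (G H : ℕ → ℕ)
    -- constants that do not depend on the instance
    (R τ K κ : ℝ) (σ : ℝ≥0)
    (hR : 0 < R) (hτ : 0 < τ) (hσ : 0 < σ) (hK : 0 < K) (hκ : 0 < κ) (hκ1 : κ < 1)
    (hmodel : ∀ n, (S n).IsModel)
    (hG : ∀ n, (S n).G₀ ≤ G n) (hH : ∀ n, (S n).H₀ ≤ H n)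
    (hparam : ∀ n, (S n).ParameterSpace R)
    (hconv : ∀ n, (S n).Convexity τ)
    (hnoise : ∀ n, (S n).Noise σ)
    (hcov : ∀ n, (S n).Covariates K)
    (hstat : ∀ n, (S n).Stationarity κ)
    -- asymptotic regime: `m = o(√T)`
    (hT : ∀ n, 0 < (S n).T)
    (hm : Tendsto (fun n => ((S n).m : ℝ) / √((S n).T : ℝ)) atTop (𝓝 0))
    -- the least squares estimator
    (θhat : ∀ n, (S n).Ω →
      GMNAR.Grouped (S n).N₁ (S n).N₂ (S n).p₁ (S n).p₂ (G n) (H n))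
    (hθhat : ∀ n, ∀ᵐ ω ∂(S n).μ, (S n).IsLeastSquares R ω (θhat n ω)) :
    -- `d(Θ̂, Θ⁰) = O_p(T^{-1/2} (m + log (N₁ N₂)))`
    ∀ δ : ℝ≥0∞, 0 < δ → ∃ M : ℝ, 0 < M ∧ ∀ n,
      (S n).μ {ω | M * (((S n).T : ℝ) ^ (-(1 / 2) : ℝ) *
            (((S n).m : ℝ) + Real.log (((S n).N₁ : ℝ) * ((S n).N₂ : ℝ)))) <
          GMNAR.pseudoDist (θhat n ω).tensor (S n).θ₀.tensor} ≤ δ := by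
  intro δ hδ
  obtain ⟨c₀, C, hc₀, hC, hdom⟩ := GMNAR.Setting.exists_dominating hR hτ hσ hK hκ1
  obtain ⟨n₀, hn₀⟩ := eventually_atTop.1 (hm.eventually (gt_mem_nhds hc₀))
  -- Markov's inequality will give probability at most C/M, so M ≥ C/δ suffices when δ is finite.
  obtain ⟨b, hb, hCb⟩ : ∃ b : ℝ, 0 ≤ b ∧ ∀ M, 0 < M → b ≤ M → ENNReal.ofReal (C / M) ≤ δ := by
    rcases eq_or_ne δ ⊤ with rfl | hδ'
    · exact ⟨0, le_rfl, fun _ _ _ => le_top⟩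
    · have hpos : 0 < δ.toReal := ENNReal.toReal_pos hδ.ne' hδ'
      refine ⟨C / δ.toReal, by positivity, fun M hM hbM => ?_⟩
      refine ENNReal.ofReal_le_of_le_toReal ?_
      rw [div_le_iff₀ hpos] at hbM
      rw [div_le_iff₀ hM]
      linarith
  have hsum : 0 ≤ ∑ n ∈ Finset.range n₀, 4 * R ^ 2 * √((S n).T : ℝ) :=
    Finset.sum_nonneg fun n _ => by positivity
  -- The finite sum covers the instances before `n₀`, where m/√T need not be small.
  set M := 1 + b + ∑ n ∈ Finset.range n₀, 4 * R ^ 2 * √((S n).T : ℝ) with hMdef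
  have hM : 0 < M := by linarith
  refine ⟨M, hM, fun n => ?_⟩
  have hT' : (0 : ℝ) < (S n).T := by exact_mod_cast hT n
  have hs : 0 < √((S n).T : ℝ) := Real.sqrt_pos.2 hT'
  have hm0 : (0 : ℝ) < (S n).m := by exact_mod_cast (show 0 < (S n).m by simp [GMNAR.Setting.m])
  have hrpow : ((S n).T : ℝ) ^ (-(1 / 2) : ℝ) = 1 / √((S n).T : ℝ) := by
    rw [Real.rpow_neg hT'.le, ← Real.sqrt_eq_rpow, one_div]
  -- All that is needed of the logarithm; at N₁N₂ = 0 its value is 0 as well.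
  have hlog : 0 ≤ Real.log (((S n).N₁ : ℝ) * ((S n).N₂ : ℝ)) := by
    rw [← Nat.cast_mul]; exact Real.log_natCast_nonneg _
  have hrate : M * ((S n).m / √((S n).T : ℝ)) ≤ M * (((S n).T : ℝ) ^ (-(1 / 2) : ℝ) *
      (((S n).m : ℝ) + Real.log (((S n).N₁ : ℝ) * ((S n).N₂ : ℝ)))) := by
    rw [hrpow, one_div_mul_eq_div]
    gcongr
    linarith
  have hzero : (∀ᵐ ω ∂(S n).μ, GMNAR.pseudoDist (θhat n ω).tensor (S n).θ₀.tensor ≤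
      M * ((S n).m / √((S n).T : ℝ))) → (S n).μ {ω | M * (((S n).T : ℝ) ^ (-(1 / 2) : ℝ) *
            (((S n).m : ℝ) + Real.log (((S n).N₁ : ℝ) * ((S n).N₂ : ℝ)))) <
          GMNAR.pseudoDist (θhat n ω).tensor (S n).θ₀.tensor} ≤ δ := by
    intro h
    refine (measure_mono_null (fun ω hω => ?_) h).le.trans zero_le
    exact not_le.2 (hrate.trans_lt hω)
  -- Without nodes the prefactor 1/0 is 0, so the pseudo-distance vanishes.
  rcases Nat.eq_zero_or_pos ((S n).N₁ * (S n).N₂) with hN | hN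
  · refine hzero (Eventually.of_forall fun ω => ?_)
    have hN' : ((S n).N₁ : ℝ) * (S n).N₂ = 0 := by exact_mod_cast hN
    rw [GMNAR.pseudoDist, hN', div_zero, zero_mul]
    positivity
  have h₁ : 0 < (S n).N₁ := Nat.pos_of_mul_pos_right hN
  have h₂ : 0 < (S n).N₂ := Nat.pos_of_mul_pos_left hN
  rcases lt_or_ge n n₀ with hn | hn
  -- Early instances: the distance is at most 4R²m = 4R²√T · m/√T, and M exceeds 4R²√T.
  · refine hzero ((hθhat n).mono fun ω hω => ?_)
    refine (GMNAR.pseudoDist_le h₁ h₂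
      fun i j => (GMNAR.Setting.sum_tensor_sub_sq_le (hparam n) hω.1 i j).2).trans ?_
    have h4 : 4 * R ^ 2 * √((S n).T : ℝ) ≤ M := by
      have := Finset.single_le_sum (f := fun n => 4 * R ^ 2 * √((S n).T : ℝ))
        (fun n _ => by positivity) (Finset.mem_range.2 hn)
      linarith
    calc 4 * R ^ 2 * ((S n).m : ℝ) = 4 * R ^ 2 * √((S n).T : ℝ) * ((S n).m / √((S n).T : ℝ)) := by
          field_simp
      _ ≤ _ := by gcongr
  · obtain ⟨W, hWi, hW0, hWI, hW⟩ := hdom (S n) (hmodel n) (hT n) (hparam n) (hconv n) (hnoise n)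
      (hcov n) (hstat n) ((div_le_iff₀ hs).1 (hn₀ n hn).le) h₁ h₂
    have hpos : 0 < M * ((S n).m / √((S n).T : ℝ)) := by positivity
    calc _ ≤ (S n).μ {ω | M * ((S n).m / √((S n).T : ℝ)) < W ω} := by
          refine measure_mono_ae ?_
          filter_upwards [hW, hθhat n] with ω h1 h2 h3
          exact (hrate.trans_lt h3).trans_le (h1 _ _ (hG n) (hH n) _ h2)
      _ ≤ ENNReal.ofReal (C * ((S n).m / √((S n).T : ℝ)) / (M * ((S n).m / √((S n).T : ℝ)))) :=
          GMNAR.measure_lt_le_of_integral hWi hW0 hpos hWI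
      _ = ENNReal.ofReal (C / M) := by
          rw [mul_div_mul_right _ _ (by positivity)]
      _ ≤ δ := hCb M hM (by linarith)
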